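/- **Theorem.** Let $X$ be a coarsely connected, countably generated coarse space and let $A,B\subset X$ be such that * $(X;A,B)$ is excisive: for every entourage $E$ there is an entourage $F$ with $\mathrm{Pen}_E(A)\cap \mathrm{Pen}_E(B)\subset \mathrm{Pen}_F(A\cap B)$; * $A$ and $B$ are weak generalized controlled deformation retracts of $X$: for $C\in\{A,B\}$ there is a family $\mathcal U=(U_x)_{x\in X}$ of neighbourhoods of the diagonal of $[0,1]$ satisfying the suspension condition relative to $C$ (for every $\varepsilon>0$ there is an entourage $E$ with $|s-t|\le\varepsilon$ for all $x\notin \mathrm{Pen}_E(C)$ and $(s,t)\in U_x$), and a controlled map $H^C\colon X\times_{\mathcal U}[0,1]\to X$ with $H^C(x,0)=x$, $H^C(x,1)\in C$ for $x\in X$, and $H^C(x,t)\in C$ for $x\in C$, $t\in[0,1]$. Here $X\times_{\mathcal U}K$ is $X\times K$ with the coarse structure generated by the sets $\{((x,s),(y,s)) : (x,y)\in E\}$, $E$ an entourage of $X$, and $\{((x,s),(x,t)) : (s,t)\in U_x\}$. Let $M_1\times M_2\to M_3$ be a bilinear map of abelian groups and let $m,n\ge 0$ with $n\le m+1$ (in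 all other degrees the groups in question vanish). Let $\mathrm{HX}_*$, $\mathrm{HX}^*$ be ordinary coarse homology and cohomology: the (co)homology of the complexes of locally finite formal sums $c=\sum m_{\mathbf x}\mathbf x$ of tuples supported in a penumbra of the multidiagonal, resp. of functions $\varphi\colon X^{n+1}\to M$ whose support meets each penumbra of the multidiagonal in a precompact set, with the usual alternating (co)boundary maps. 1. *Roe secondary cap product.* Choose base-points $a\in A$, $b\in B$. For a relative cycle $c\in \mathrm{CX}_m(X,A+B;M_1)=\mathrm{CX}_m(X;M_1)/(\mathrm{CX}_m(A;M_1)+\mathrm{CX}_m(B;M_1))$ representing $[c]\in \mathrm{HX}_m(X,A\cup B;M_1)$ and a cocycle $\varphi\in\mathrm{CX}^n(X,B;M_2)$, the product $[c]\divideontimes[\varphi]\in\mathrm{HX}_{m-n+1}(X,A;M_3)$ is the class of $$c\divideontimes\varphi=-r_a(c\cap\varphi)-(-1)^m\,c\cap(s_b\varphi),$$ where $r_a(x_0,\dots,x_p)=(a,x_0,\dots,x_p)$, $(s_b\varphi)(x_1,\dots,x_n)=\varphi(b,x_1,\dots,x_n)$ and $(m_1\cdot(x_0,\dots,x_m))\cap\varphi=(m_1\cdot\varphi(x_m,\dots,x_{m-n}))\,(x_0,\dots,x_{m-n})$;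 the first term is $0$ if $n=m+1$ and the second is $0$ if $n=0$. 2. *Secondary cap product.* Let $I=[-1,1]$, $\Gamma\colon X\times I\to X\times X$, $\Gamma(x,t)=(H^A(x,\max(-t,0)),H^B(x,\max(t,0)))$, and let $\mathcal U$ be a family of neighbourhoods of the diagonal of $I$ satisfying the suspension condition relative to $A\cup B$ for which $\Gamma$ is a coarse map on $X\times_{\mathcal U}I$. Then $x\Cap y$ is $(-1)^{m+1}$ times the image of $x\otimes y$ under $$\mathrm{HX}_m(X,A\cup B;M_1)\otimes\mathrm{HX}^n(X,B;M_2)\xrightarrow{\sigma_*\otimes\mathrm{id}}\mathrm{HX}_{m+1}((X,A\cup B)\times_{\mathcal U}(I,\partial I);M_1)\otimes\mathrm{HX}^n(X,B;M_2)$$ $$\xrightarrow{\Gamma_*\otimes\mathrm{id}}\mathrm{HX}_{m+1}((X,A)\times(X,B);M_1)\otimes\mathrm{HX}^n(X,B;M_2)\xrightarrow{/}\mathrm{HX}_{m-n+1}(X,A;M_3).$$ Here $\sigma_*$ is the suspension homomorphism, i.e. (after passing to a refinement of $\mathcal U$ of the form $U'_x=\{|s-t|<\varepsilon_x\}$ and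 mapping back) the inverse of the connecting homomorphism $\mathrm{HX}_{m+1}((X,A\cup B)\times_{\mathcal U'}(I,\partial I))\to\mathrm{HX}_m(X\times\partial I\cup (A\cup B)\times I,\,X\times\{1\}\cup (A\cup B)\times I)\cong\mathrm{HX}_m(X,A\cup B)$, the isomorphism being the excision induced by $x\mapsto(x,-1)$; and $/$ is the canonical slant product, the inverse of $\mathrm{HX}_{m+1}(X\times X,A\times X+X\times B)\cong\mathrm{HX}_{m+1}((X,A)\times(X,B))$ followed by the map induced by $(m_1\cdot((x_0,y_0),\dots,(x_N,y_N)))/\varphi=(m_1\cdot\varphi(y_N,\dots,y_{N-n}))\,(x_0,\dots,x_{N-n})$. Then both products are well-defined biadditive maps $\mathrm{HX}_m(X,A\cup B;M_1)\times\mathrm{HX}^n(X,B;M_2)\to\mathrm{HX}_{m-n+1}(X,A;M_3)$, independent of all choices (base-points, representatives, $H^A,H^B,\mathcal U$), and they coincide up to the difference of the sign conventions in 1 and 2: for all $x\in\mathrm{HX}_m(X,A\cup B;M_1)$, $y\in\mathrm{HX}^n(X,B;M_2)$ $$x\Cap y=(-1)^{m+1}\,x\divideontimes y ,$$ that is, $x\divideontimes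 y=\Gamma_*(\sigma_*x)/y$. -/

import Mathlib

open Set Topology

namespace CoarseCap

universe u v w

/-- A coarse structure on `X`: a family of entourages which contains the diagonal and is closed
under subsets, finite unions, inverses and compositions. -/
structure CoarseStructure (X : Type u) where
  entourages : Set (Set (X × X))
  diagonal_mem : diagonal X ∈ entourages
  subset_mem : ∀ {E F : Set (X × X)}, E ∈ entourages → F ⊆ E → F ∈ entourages
  union_mem : ∀ {E F : Set (X × X)}, E ∈ entourages → F ∈ entourages → E ∪ F ∈ entourages
  inv_mem : ∀ {E : Set (X × X)}, E ∈ entourages → {p | (p.2, p.1) ∈ E} ∈ entourages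
  comp_mem : ∀ {E F : Set (X × X)}, E ∈ entourages → F ∈ entourages →
    {p | ∃ y, (p.1, y) ∈ E ∧ (y, p.2) ∈ F} ∈ entourages

/-- The entourages of the coarse structure generated by a family `S` of subsets of `X × X`. -/
inductive GeneratedEntourage {X : Type u} (S : Set (Set (X × X))) : Set (X × X) → Prop
  | basic (E : Set (X × X)) : E ∈ S → GeneratedEntourage S E
  | diagonal : GeneratedEntourage S (diagonal X)
  | subset (E F : Set (X × X)) : GeneratedEntourage S E → F ⊆ E → GeneratedEntourage S F
  | union (E F : Set (X × X)) : GeneratedEntourage S E → GeneratedEntourage S F →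
      GeneratedEntourage S (E ∪ F)
  | inv (E : Set (X × X)) : GeneratedEntourage S E → GeneratedEntourage S {p | (p.2, p.1) ∈ E}
  | comp (E F : Set (X × X)) : GeneratedEntourage S E → GeneratedEntourage S F →
      GeneratedEntourage S {p | ∃ y, (p.1, y) ∈ E ∧ (y, p.2) ∈ F}

/-- The penumbra `Pen_E(A) = {x | ∃ y ∈ A, (x, y) ∈ E}`. -/
def penumbra {X : Type u} (E : Set (X × X)) (A : Set X) : Set X := {x | ∃ y ∈ A, (x, y) ∈ E}

/-- The multidiagonal in `X^ι`. -/
def multidiagonal (ι : Type*) (X : Type u) : Set (ι → X) := range fun (x : X) (_ : ι) => x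

namespace CoarseStructure

variable {X : Type u} {Y : Type v}

/-- The smallest coarse structure for which all members of `S` are entourages. -/
def generate (S : Set (Set (X × X))) : CoarseStructure X where
  entourages := {E | GeneratedEntourage S E}
  diagonal_mem := .diagonal
  subset_mem := fun hE h => .subset _ _ hE h
  union_mem := fun hE hF => .union _ _ hE hF
  inv_mem := fun hE => .inv _ hE
  comp_mem := fun hE hF => .comp _ _ hE hF

/-- The coarse structure has a countable family of generators. -/
def IsCountablyGenerated (𝓔 : CoarseStructure X) : Prop :=
  ∃ E : ℕ → Set (X × X), 𝓔 = generate (range E)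

/-- Any two points are related by some entourage. -/
def IsCoarselyConnected (𝓔 : CoarseStructure X) : Prop :=
  ∀ x y : X, ∃ E ∈ 𝓔.entourages, (x, y) ∈ E

/-- Bounded subsets. -/
def IsBounded (𝓔 : CoarseStructure X) (K : Set X) : Prop := K ×ˢ K ∈ 𝓔.entourages

/-- Precompact subsets: finite unions of bounded subsets. -/
def IsPrecompact (𝓔 : CoarseStructure X) (S : Set X) : Prop :=
  ∃ F : Set (Set X), F.Finite ∧ (∀ K ∈ F, 𝓔.IsBounded K) ∧ S = ⋃₀ F

/-- Controlled maps: they send entourages to entourages. -/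
def IsControlled (𝓔 : CoarseStructure X) (𝓕 : CoarseStructure Y) (f : X → Y) : Prop :=
  ∀ E ∈ 𝓔.entourages, Prod.map f f '' E ∈ 𝓕.entourages

/-- Coarse maps: controlled maps which are proper, that is, preimages of bounded subsets are
bounded. -/
def IsCoarse (𝓔 : CoarseStructure X) (𝓕 : CoarseStructure Y) (f : X → Y) : Prop :=
  𝓔.IsControlled 𝓕 f ∧ ∀ K, 𝓕.IsBounded K → 𝓔.IsBounded (f ⁻¹' K)

/-- The triad `(X; A, B)` is coarsely excisive. -/
def IsExcisive (𝓔 : CoarseStructure X) (A B : Set X) : Prop :=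
  ∀ E ∈ 𝓔.entourages, ∃ F ∈ 𝓔.entourages, penumbra E A ∩ penumbra E B ⊆ penumbra F (A ∩ B)

/-- The product coarse structure on `X × Y`. -/
def prod (𝓔 : CoarseStructure X) (𝓕 : CoarseStructure Y) : CoarseStructure (X × Y) where
  entourages := {G | ∃ E ∈ 𝓔.entourages, ∃ F ∈ 𝓕.entourages,
    ∀ p ∈ G, (p.1.1, p.2.1) ∈ E ∧ (p.1.2, p.2.2) ∈ F}
  diagonal_mem := ⟨_, 𝓔.diagonal_mem, _, 𝓕.diagonal_mem, fun p hp => by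
    rw [mem_diagonal_iff] at hp
    simp [mem_diagonal_iff, hp]⟩
  subset_mem := fun ⟨E, hE, F, hF, h⟩ hsub => ⟨E, hE, F, hF, fun p hp => h p (hsub hp)⟩
  union_mem := fun ⟨E, hE, F, hF, h⟩ ⟨E', hE', F', hF', h'⟩ =>
    ⟨_, 𝓔.union_mem hE hE', _, 𝓕.union_mem hF hF', fun p hp =>
      hp.elim (fun hp => ⟨Or.inl (h p hp).1, Or.inl (h p hp).2⟩)
        (fun hp => ⟨Or.inr (h' p hp).1, Or.inr (h' p hp).2⟩)⟩
  inv_mem := fun ⟨E, hE, F, hF, h⟩ => ⟨_, 𝓔.inv_mem hE, _, 𝓕.inv_mem hF, fun p hp => h _ hp⟩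
  comp_mem := fun ⟨E, hE, F, hF, h⟩ ⟨E', hE', F', hF', h'⟩ =>
    ⟨_, 𝓔.comp_mem hE hE', _, 𝓕.comp_mem hF hF', fun _ ⟨y, h1, h2⟩ =>
      ⟨⟨y.1, (h _ h1).1, (h' _ h2).1⟩, ⟨y.2, (h _ h1).2, (h' _ h2).2⟩⟩⟩

/-- The product coarse structure on the cartesian power `X^ι` (for finite `ι`). -/
def power (𝓔 : CoarseStructure X) (ι : Type*) : CoarseStructure (ι → X) where
  entourages := {G | ∃ E ∈ 𝓔.entourages, ∀ p ∈ G, ∀ i, (p.1 i, p.2 i) ∈ E}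
  diagonal_mem := ⟨_, 𝓔.diagonal_mem, fun p hp i => by
    rw [mem_diagonal_iff] at hp
    simp [mem_diagonal_iff, hp]⟩
  subset_mem := fun ⟨E, hE, h⟩ hsub => ⟨E, hE, fun p hp => h p (hsub hp)⟩
  union_mem := fun ⟨E, hE, h⟩ ⟨E', hE', h'⟩ => ⟨_, 𝓔.union_mem hE hE', fun p hp i =>
    hp.elim (fun hp => Or.inl (h p hp i)) (fun hp => Or.inr (h' p hp i))⟩
  inv_mem := fun ⟨E, hE, h⟩ => ⟨_, 𝓔.inv_mem hE, fun p hp i => h _ hp i⟩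
  comp_mem := fun ⟨E, hE, h⟩ ⟨E', hE', h'⟩ => ⟨_, 𝓔.comp_mem hE hE', fun _ ⟨y, h1, h2⟩ i =>
    ⟨y i, h _ h1 i, h' _ h2 i⟩⟩

/-- `𝒩(X; K)`: families of neighbourhoods of the diagonal in `K × K` indexed by `X`. -/
def IsNhdFamily {X : Type u} {K : Type w} [TopologicalSpace K] (U : X → Set (K × K)) : Prop :=
  ∀ x, U x ∈ 𝓝ˢ (diagonal K)

/-- The coarse structure of the warped cartesian product of `X` with `K` with respect to `U`. -/
def warped {K : Type w} (𝓔 : CoarseStructure X) (U : X → Set (K × K)) : CoarseStructure (X × K) :=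
  generate ({G | ∃ E ∈ 𝓔.entourages, G = {p | (p.1.1, p.2.1) ∈ E ∧ p.1.2 = p.2.2}} ∪
    {{p | p.1.1 = p.2.1 ∧ (p.1.2, p.2.2) ∈ U p.1.1}})

/-- `𝒩^σ(X, A; [a, b])`: the families in `𝒩(X; [a, b])` satisfying the suspension condition. -/
def IsSuspensionFamily (𝓔 : CoarseStructure X) (A : Set X) {a b : ℝ}
    (U : X → Set (Icc a b × Icc a b)) : Prop :=
  IsNhdFamily U ∧ ∀ ε > 0, ∃ E ∈ 𝓔.entourages, ∀ x ∉ penumbra E A, ∀ p ∈ U x,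
    |(p.1 : ℝ) - p.2| ≤ ε

/-- `H` is a generalized controlled homotopy which exhibits `A` as a weak generalized controlled
deformation retract of `X`. -/
def IsDeformation (𝓔 : CoarseStructure X) (A : Set X) (H : X × Icc (0 : ℝ) 1 → X) : Prop :=
  (∃ U : X → Set (Icc (0 : ℝ) 1 × Icc (0 : ℝ) 1), 𝓔.IsSuspensionFamily A U ∧
    (𝓔.warped U).IsControlled 𝓔 H) ∧
  (∀ x, H (x, 0) = x) ∧ (∀ x, H (x, 1) ∈ A) ∧ ∀ x ∈ A, ∀ t, H (x, t) ∈ A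

/-- `A` is a weak generalized controlled deformation retract of `X`. -/
def IsWeakDeformationRetract (𝓔 : CoarseStructure X) (A : Set X) : Prop :=
  ∃ H, 𝓔.IsDeformation A H

lemma mem_of_subset {𝓔 : CoarseStructure X} {E F : Set (X × X)} (hE : E ∈ 𝓔.entourages)
    (h : F ⊆ E) : F ∈ 𝓔.entourages := 𝓔.subset_mem hE h

lemma IsBounded.subset {𝓔 : CoarseStructure X} {K L : Set X} (hK : 𝓔.IsBounded K)
    (h : L ⊆ K) : 𝓔.IsBounded L :=
  𝓔.subset_mem hK (prod_mono h h)

/-- Enlarging a bounded set by an entourage gives a bounded set. -/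
lemma IsBounded.penumbra {𝓔 : CoarseStructure X} {K : Set X} (hK : 𝓔.IsBounded K)
    {E : Set (X × X)} (hE : E ∈ 𝓔.entourages) : 𝓔.IsBounded (penumbra E K) := by
  refine 𝓔.subset_mem (𝓔.comp_mem (𝓔.comp_mem hE hK) (𝓔.inv_mem hE)) ?_
  rintro ⟨x, y⟩ ⟨⟨a, ha, hxa⟩, b, hb, hyb⟩
  exact ⟨b, ⟨a, hxa, ha, hb⟩, hyb⟩

lemma isBounded_power_iff {𝓔 : CoarseStructure X} {ι : Type*} [Finite ι] {K : Set (ι → X)} :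
    (𝓔.power ι).IsBounded K ↔ ∀ i, 𝓔.IsBounded ((fun x => x i) '' K) := by
  constructor
  · rintro ⟨E, hE, h⟩ i
    refine 𝓔.subset_mem hE ?_
    rintro ⟨_, _⟩ ⟨⟨x, hx, rfl⟩, ⟨y, hy, rfl⟩⟩
    exact h (x, y) ⟨hx, hy⟩ i
  · intro h
    have key : ∀ s : Set ι, s.Finite → (⋃ i ∈ s, ((fun x : ι → X => x i) '' K) ×ˢ
        ((fun x : ι → X => x i) '' K)) ∈ 𝓔.entourages := by
      intro s hs
      induction s, hs using Set.Finite.induction_on with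
      | empty => simpa using 𝓔.subset_mem 𝓔.diagonal_mem (empty_subset _)
      | insert _ _ ih =>
        rw [biUnion_insert]
        exact 𝓔.union_mem (h _) ih
    refine ⟨_, key univ finite_univ, fun p hp i => ?_⟩
    simp only [mem_univ, iUnion_true, mem_iUnion]
    exact ⟨i, ⟨p.1, hp.1, rfl⟩, ⟨p.2, hp.2, rfl⟩⟩

lemma isBounded_prod_iff {𝓔 : CoarseStructure X} {𝓕 : CoarseStructure Y} {K : Set (X × Y)} :
    (𝓔.prod 𝓕).IsBounded K ↔ 𝓔.IsBounded (Prod.fst '' K) ∧ 𝓕.IsBounded (Prod.snd '' K) := by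
  constructor
  · rintro ⟨E, hE, F, hF, h⟩
    constructor
    · refine 𝓔.subset_mem hE ?_
      rintro ⟨_, _⟩ ⟨⟨x, hx, rfl⟩, ⟨y, hy, rfl⟩⟩
      exact (h (x, y) ⟨hx, hy⟩).1
    · refine 𝓕.subset_mem hF ?_
      rintro ⟨_, _⟩ ⟨⟨x, hx, rfl⟩, ⟨y, hy, rfl⟩⟩
      exact (h (x, y) ⟨hx, hy⟩).2
  · rintro ⟨h1, h2⟩
    exact ⟨_, h1, _, h2, fun p hp =>
      ⟨⟨⟨_, hp.1, rfl⟩, ⟨_, hp.2, rfl⟩⟩, ⟨⟨_, hp.1, rfl⟩, ⟨_, hp.2, rfl⟩⟩⟩⟩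

/-- A map out of a generated structure is controlled if it is so on the generators. -/
lemma isControlled_generate {S : Set (Set (X × X))} {𝓕 : CoarseStructure Y} {f : X → Y}
    (h : ∀ E ∈ S, Prod.map f f '' E ∈ 𝓕.entourages) : (generate S).IsControlled 𝓕 f := by
  intro E hE
  induction hE with
  | basic E hE => exact h E hE
  | diagonal =>
    refine 𝓕.subset_mem 𝓕.diagonal_mem ?_
    rintro _ ⟨⟨x, y⟩, hxy, rfl⟩
    rw [mem_diagonal_iff] at hxy ⊢
    exact congrArg f hxy
  | subset E F _ hs ih => exact 𝓕.subset_mem ih (image_mono hs)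
  | union E F _ _ ihE ihF => rw [image_union]; exact 𝓕.union_mem ihE ihF
  | inv E _ ih =>
    refine 𝓕.subset_mem (𝓕.inv_mem ih) ?_
    rintro _ ⟨⟨x, y⟩, hxy, rfl⟩
    exact ⟨(y, x), hxy, rfl⟩
  | comp E F _ _ ihE ihF =>
    refine 𝓕.subset_mem (𝓕.comp_mem ihE ihF) ?_
    rintro _ ⟨⟨x, y⟩, ⟨z, h1, h2⟩, rfl⟩
    exact ⟨f z, ⟨(x, z), h1, rfl⟩, ⟨(z, y), h2, rfl⟩⟩

end CoarseStructure

noncomputable section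

/-- Summation along the fibres of `f`: the linear extension of `f` to (locally finite) formal
linear combinations, regarded as functions `α → M`. -/
def push {α : Type*} {β : Type*} {M : Type*} [AddCommGroup M] (f : α → β) (c : α → M) : β → M :=
  fun b => ∑ᶠ a ∈ f ⁻¹' {b}, c a

/-- The fibres of `f` meet the support of `c` in finite sets. -/
def FiniteFibres {α : Type*} {β : Type*} {M : Type*} [AddCommGroup M] (f : α → β)
    (c : α → M) : Prop := ∀ b, (f ⁻¹' {b} ∩ Function.support c).Finite

section Push

variable {α : Type*} {β : Type*} {γ : Type*} {M : Type*} {N : Type*} [AddCommGroup M]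
  [AddCommGroup N]

open Classical in
lemma push_eq_sum {f : α → β} {c : α → M} {b : β} (s : Finset α)
    (hs : f ⁻¹' {b} ∩ Function.support c ⊆ s) :
    push f c b = ∑ a ∈ s, if f a = b then c a else 0 := by
  rw [push, finsum_mem_eq_sum_of_inter_support_eq (t := s.filter (fun a => f a = b)),
    Finset.sum_filter]
  ext a
  simp only [mem_inter_iff, mem_preimage, mem_singleton_iff, Function.mem_support,
    Finset.coe_filter, mem_ofPred_eq]
  exact ⟨fun h => ⟨⟨hs h, h.1⟩, h.2⟩, fun h => ⟨h.1.2, h.2⟩⟩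

lemma push_add {f : α → β} {c d : α → M} (hc : FiniteFibres f c) (hd : FiniteFibres f d) :
    push f (c + d) = push f c + push f d := by
  funext b
  exact finsum_mem_add_distrib' (hc b) (hd b)

@[simp] lemma push_zero {f : α → β} : push f (0 : α → M) = 0 := by
  funext b
  simp [push]

lemma push_neg {f : α → β} {c : α → M} : push f (-c) = -push f c := by
  funext b
  simp [push, finsum_neg_distrib]

lemma FiniteFibres.zero {f : α → β} : FiniteFibres f (0 : α → M) := fun b => by simp

lemma FiniteFibres.neg {f : α → β} {c : α → M} (h : FiniteFibres f c) : FiniteFibres f (-c) :=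
  fun b => by simpa using h b

lemma FiniteFibres.add {f : α → β} {c d : α → M} (hc : FiniteFibres f c)
    (hd : FiniteFibres f d) : FiniteFibres f (c + d) := fun b =>
  ((hc b).union (hd b)).subset fun a ha => by
    by_cases h : c a = 0
    · right
      refine ⟨ha.1, fun h' => ha.2 ?_⟩
      simp [h, h']
    · exact Or.inl ⟨ha.1, h⟩

lemma FiniteFibres.zsmul {f : α → β} {c : α → M} (h : FiniteFibres f c) (r : ℤ) :
    FiniteFibres f (r • c) := fun b =>
  (h b).subset fun a ha => ⟨ha.1, fun h' => ha.2 (by simp [h'])⟩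

lemma FiniteFibres.sum {ι : Type*} {f : α → β} (s : Finset ι) {c : ι → α → M}
    (h : ∀ i ∈ s, FiniteFibres f (c i)) : FiniteFibres f (∑ i ∈ s, c i) := by
  classical
  induction s using Finset.induction_on with
  | empty => simpa using FiniteFibres.zero
  | insert i s hi ih =>
    rw [Finset.sum_insert hi]
    exact (h i (by simp)).add (ih fun j hj => h j (by simp [hj]))

lemma push_zsmul {f : α → β} {c : α → M} (h : FiniteFibres f c) (r : ℤ) :
    push f (r • c) = r • push f c := by
  classical
  funext b
  have hs : f ⁻¹' {b} ∩ Function.support c ⊆ (h b).toFinset := by simp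
  have hs' : f ⁻¹' {b} ∩ Function.support (r • c) ⊆ (h b).toFinset := fun a ha => by
    rw [Finite.coe_toFinset]
    exact ⟨ha.1, fun h' => ha.2 (by simp [h'])⟩
  rw [push_eq_sum _ hs', Pi.smul_apply, push_eq_sum _ hs, Finset.smul_sum]
  exact Finset.sum_congr rfl fun a _ => by split_ifs <;> simp

lemma push_sum {ι : Type*} {f : α → β} (s : Finset ι) {c : ι → α → M}
    (h : ∀ i ∈ s, FiniteFibres f (c i)) : push f (∑ i ∈ s, c i) = ∑ i ∈ s, push f (c i) := by
  classical
  induction s using Finset.induction_on with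
  | empty => simp
  | insert i s hi ih =>
    rw [Finset.sum_insert hi, Finset.sum_insert hi, push_add (h i (by simp))
      (FiniteFibres.sum s fun j hj => h j (by simp [hj])), ih fun j hj => h j (by simp [hj])]

lemma exists_of_push_ne_zero {f : α → β} {c : α → M} {b : β} (h : push f c b ≠ 0) :
    ∃ a, f a = b ∧ c a ≠ 0 := by
  by_contra! hcon
  exact h (finsum_mem_eq_zero_of_forall_eq_zero fun a ha => hcon a ha)

lemma push_push {f : α → β} {g : β → γ} {c : α → M} (h : FiniteFibres (g ∘ f) c) :
    push g (push f c) = push (g ∘ f) c := by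
  classical
  funext d
  set s := (h d).toFinset with hs
  have hs1 : (g ∘ f) ⁻¹' {d} ∩ Function.support c ⊆ s := by simp [hs]
  have hs2 : g ⁻¹' {d} ∩ Function.support (push f c) ⊆ (s.image f : Finset β) := by
    rintro b ⟨hb, hb'⟩
    obtain ⟨a, rfl, ha⟩ := exists_of_push_ne_zero hb'
    exact Finset.mem_coe.2 (Finset.mem_image_of_mem f (hs1 ⟨hb, ha⟩))
  rw [push_eq_sum _ hs1, push_eq_sum _ hs2]
  have hb : ∀ b ∈ s.image f, (if g b = d then push f c b else 0) =
      ∑ a ∈ s, if f a = b then (if g b = d then c a else 0) else 0 := by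
    intro b _
    split_ifs with hgb
    · exact push_eq_sum _ fun a ha => hs1 ⟨by
        have := ha.1
        simp only [mem_preimage, mem_singleton_iff] at this
        simp [this, hgb], ha.2⟩
    · simp
  rw [Finset.sum_congr rfl hb, Finset.sum_comm]
  refine Finset.sum_congr rfl fun a ha => ?_
  rw [Finset.sum_ite_eq, if_pos (Finset.mem_image_of_mem f ha)]
  rfl

lemma FiniteFibres.of_comp {f : α → β} {g : β → γ} {c : α → M} (h : FiniteFibres (g ∘ f) c) :
    FiniteFibres f c := fun b => (h (g b)).subset fun a ha => ⟨by
  have := ha.1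
  simp only [mem_preimage, mem_singleton_iff] at this
  simp [this], ha.2⟩

/-- Projection formula: an additive operation depending on the target can be pulled back. -/
lemma push_apply_hom {f : α → β} {c : α → M} (h : FiniteFibres f c) (L : β → M →+ N) :
    (fun b => L b (push f c b)) = push f (fun a => L (f a) (c a)) := by
  classical
  funext b
  have hs : f ⁻¹' {b} ∩ Function.support c ⊆ (h b).toFinset := by simp
  have hs' : f ⁻¹' {b} ∩ Function.support (fun a => L (f a) (c a)) ⊆ (h b).toFinset :=
    fun a ha => by
      rw [Finite.coe_toFinset]
      exact ⟨ha.1, fun h' => ha.2 (by simp [h'])⟩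
  rw [push_eq_sum _ hs', push_eq_sum _ hs, map_sum]
  refine Finset.sum_congr rfl fun a _ => ?_
  split_ifs with h1
  · rw [h1]
  · simp

end Push

/-! ### Coarse chains -/

section Chains

variable {X : Type u} {Y : Type v} {M : Type w} [AddCommGroup M]

/-- `c` is a coarse `m`-chain, where the formal sum `∑ m_x x` is encoded as the function
`x ↦ m_x` on `X^{m+1}`. -/
def IsCoarseChain (𝓔 : CoarseStructure X) {m : ℕ} (c : (Fin (m + 1) → X) → M) : Prop :=
  (∃ E ∈ (𝓔.power (Fin (m + 1))).entourages,
    Function.support c ⊆ penumbra E (multidiagonal (Fin (m + 1)) X)) ∧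
  ∀ K, (𝓔.power (Fin (m + 1))).IsBounded K → (Function.support c ∩ K).Finite

/-- A set of tuples is contained in a penumbra of the multidiagonal iff any two coordinates are
related by a fixed entourage. -/
lemma subset_penumbra_iff {𝓔 : CoarseStructure X} {m : ℕ} {S : Set (Fin (m + 1) → X)} :
    (∃ E ∈ (𝓔.power (Fin (m + 1))).entourages, S ⊆ penumbra E (multidiagonal (Fin (m + 1)) X)) ↔
      ∃ E ∈ 𝓔.entourages, ∀ x ∈ S, ∀ i j, (x i, x j) ∈ E := by
  constructor
  · rintro ⟨G, ⟨E, hE, hG⟩, hS⟩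
    refine ⟨_, 𝓔.comp_mem hE (𝓔.inv_mem hE), fun x hx i j => ?_⟩
    obtain ⟨_, ⟨p, rfl⟩, hp⟩ := hS hx
    exact ⟨p, hG _ hp i, hG _ hp j⟩
  · rintro ⟨E, hE, h⟩
    refine ⟨{p | ∀ i, (p.1 i, p.2 i) ∈ E}, ⟨E, hE, fun p hp i => hp i⟩, fun x hx => ?_⟩
    exact ⟨fun _ => x 0, ⟨x 0, rfl⟩, fun i => h x hx i 0⟩

variable (M) in
/-- The group `CX_m(X; M)` of coarse `m`-chains. -/
def coarseChains (𝓔 : CoarseStructure X) (m : ℕ) : AddSubgroup ((Fin (m + 1) → X) → M) where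
  carrier := {c | IsCoarseChain 𝓔 c}
  zero_mem' := by
    refine ⟨⟨_, (𝓔.power _).diagonal_mem, ?_⟩, fun K _ => ?_⟩ <;> simp
  add_mem' := by
    rintro c d ⟨⟨E, hE, hc⟩, hc'⟩ ⟨⟨F, hF, hd⟩, hd'⟩
    have hsub := Function.support_add c d
    refine ⟨⟨E ∪ F, (𝓔.power _).union_mem hE hF, fun x hx => ?_⟩, fun K hK => ?_⟩
    · rcases hsub hx with h | h
      · obtain ⟨y, hy, hxy⟩ := hc h
        exact ⟨y, hy, Or.inl hxy⟩
      · obtain ⟨y, hy, hxy⟩ := hd h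
        exact ⟨y, hy, Or.inr hxy⟩
    · refine ((hc' K hK).union (hd' K hK)).subset fun x hx => ?_
      exact (hsub hx.1).elim (fun h => Or.inl ⟨h, hx.2⟩) (fun h => Or.inr ⟨h, hx.2⟩)
  neg_mem' := by
    rintro c ⟨h, h'⟩
    refine ⟨?_, ?_⟩ <;> rwa [Function.support_neg]

/-- A map between sets of tuples which is controlled and proper on the support of a coarse chain
can be applied to this chain. -/
lemma isCoarseChain_push {𝓕 : CoarseStructure Y} {m p : ℕ}
    {c : (Fin (m + 1) → X) → M} {F : (Fin (m + 1) → X) → (Fin (p + 1) → Y)}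
    (h1 : ∃ E ∈ 𝓕.entourages, ∀ x ∈ Function.support c, ∀ i j, (F x i, F x j) ∈ E)
    (h2 : ∀ K, (𝓕.power (Fin (p + 1))).IsBounded K → (F ⁻¹' K ∩ Function.support c).Finite) :
    IsCoarseChain 𝓕 (push F c) := by
  refine ⟨subset_penumbra_iff.2 ?_, fun K hK => ?_⟩
  · obtain ⟨E, hE, h⟩ := h1
    refine ⟨E, hE, fun y hy i j => ?_⟩
    obtain ⟨x, rfl, hx⟩ := exists_of_push_ne_zero hy
    exact h x hx i j
  · refine ((h2 K hK).image F).subset ?_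
    rintro y ⟨hy, hyK⟩
    obtain ⟨x, rfl, hx⟩ := exists_of_push_ne_zero hy
    exact ⟨x, ⟨hyK, hx⟩, rfl⟩

lemma isBounded_singleton {𝓔 : CoarseStructure X} (x : X) : 𝓔.IsBounded {x} :=
  𝓔.subset_mem 𝓔.diagonal_mem (by
    rintro ⟨a, b⟩ ⟨ha, hb⟩
    simp only [mem_singleton_iff] at ha hb
    simp [ha, hb])

lemma finiteFibres_of_proper {𝓕 : CoarseStructure Y} {α : Type*} {p : ℕ}
    {c : α → M} {F : α → (Fin (p + 1) → Y)}
    (h2 : ∀ K, (𝓕.power (Fin (p + 1))).IsBounded K → (F ⁻¹' K ∩ Function.support c).Finite) :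
    FiniteFibres F c := fun _ => h2 _ (isBounded_singleton _)

/-- Reindexing tuples along any map of finite nonempty index sets is proper on the support of a
coarse chain, also after applying a coarse map to the coordinates. -/
lemma proper_reindex {𝓔 : CoarseStructure X} {𝓕 : CoarseStructure Y} {m p : ℕ} {f : X → Y}
    (hf : 𝓔.IsCoarse 𝓕 f) {c : (Fin (m + 1) → X) → M} (hc : IsCoarseChain 𝓔 c)
    (α : Fin (p + 1) → Fin (m + 1)) (K : Set (Fin (p + 1) → Y))
    (hK : (𝓕.power (Fin (p + 1))).IsBounded K) :
    ((fun x : Fin (m + 1) → X => f ∘ x ∘ α) ⁻¹' K ∩ Function.support c).Finite := by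
  obtain ⟨E, hE, hcE⟩ := subset_penumbra_iff.1 hc.1
  have hB := (hf.2 _ (CoarseStructure.isBounded_power_iff.1 hK 0)).penumbra hE
  refine (hc.2 ({x | ∀ i, x i ∈ penumbra E (f ⁻¹' ((fun x => x 0) '' K))}) ?_).subset ?_
  · refine CoarseStructure.isBounded_power_iff.2 fun i => hB.subset ?_
    rintro _ ⟨x, hx, rfl⟩
    exact hx i
  · rintro x ⟨hx, hxc⟩
    exact ⟨hxc, fun i => ⟨x (α 0), ⟨_, hx, rfl⟩, hcE x hxc i (α 0)⟩⟩

lemma controlled_reindex {𝓔 : CoarseStructure X} {𝓕 : CoarseStructure Y} {m p : ℕ} {f : X → Y}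
    (hf : 𝓔.IsControlled 𝓕 f) {c : (Fin (m + 1) → X) → M} (hc : IsCoarseChain 𝓔 c)
    (α : Fin (p + 1) → Fin (m + 1)) :
    ∃ E ∈ 𝓕.entourages, ∀ x ∈ Function.support c, ∀ i j, ((f ∘ x ∘ α) i, (f ∘ x ∘ α) j) ∈ E := by
  obtain ⟨E, hE, hcE⟩ := subset_penumbra_iff.1 hc.1
  exact ⟨_, hf E hE, fun x hx i j => ⟨(x (α i), x (α j)), hcE x hx _ _, rfl⟩⟩

lemma isCoarse_id (𝓔 : CoarseStructure X) : 𝓔.IsCoarse 𝓔 id :=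
  ⟨fun E hE => by simpa using hE, fun K hK => hK⟩

/-- `(x_0, …, x_{m+1}) ↦ (x_0, …, x_{i-1}, x_{i+1}, …, x_{m+1})` -/
def face {m : ℕ} (i : Fin (m + 2)) (x : Fin (m + 2) → X) : Fin (m + 1) → X := x ∘ i.succAbove

lemma face_proper {𝓔 : CoarseStructure X} {m : ℕ} {c : (Fin (m + 2) → X) → M}
    (hc : IsCoarseChain 𝓔 c) (i : Fin (m + 2)) (K : Set (Fin (m + 1) → X))
    (hK : (𝓔.power (Fin (m + 1))).IsBounded K) : (face i ⁻¹' K ∩ Function.support c).Finite :=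
  proper_reindex (isCoarse_id 𝓔) hc i.succAbove K hK

lemma face_finiteFibres {𝓔 : CoarseStructure X} {m : ℕ} {c : (Fin (m + 2) → X) → M}
    (hc : IsCoarseChain 𝓔 c) (i : Fin (m + 2)) : FiniteFibres (face i) c :=
  finiteFibres_of_proper (face_proper hc i)

lemma isCoarseChain_face {𝓔 : CoarseStructure X} {m : ℕ} {c : (Fin (m + 2) → X) → M}
    (hc : IsCoarseChain 𝓔 c) (i : Fin (m + 2)) : IsCoarseChain 𝓔 (push (face i) c) :=
  isCoarseChain_push (controlled_reindex (isCoarse_id 𝓔).1 hc i.succAbove) (face_proper hc i)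

/-- The boundary map `∂ : CX_{m+1}(X; M) → CX_m(X; M)`, the alternating sum of the faces. -/
def boundary (𝓔 : CoarseStructure X) (m : ℕ) : coarseChains M 𝓔 (m + 1) →+ coarseChains M 𝓔 m where
  toFun c := ⟨∑ i : Fin (m + 2), (-1 : ℤ) ^ (i : ℕ) • push (face i) c.1,
    sum_mem fun i _ => zsmul_mem (show _ ∈ coarseChains M 𝓔 m from isCoarseChain_face c.2 i) _⟩
  map_zero' := by
    ext1
    simp
  map_add' c d := by
    ext1
    simp only [AddSubgroup.coe_add]
    rw [← Finset.sum_add_distrib]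
    exact Finset.sum_congr rfl fun i _ => by
      rw [push_add (face_finiteFibres c.2 i) (face_finiteFibres d.2 i), smul_add]

lemma boundary_coe {𝓔 : CoarseStructure X} {m : ℕ} (c : coarseChains M 𝓔 (m + 1)) :
    (boundary 𝓔 m c).1 = ∑ i : Fin (m + 2), (-1 : ℤ) ^ (i : ℕ) • push (face i) c.1 := rfl

/-- `∂ ∘ ∂ = 0` -/
lemma boundary_boundary {𝓔 : CoarseStructure X} {m : ℕ} (c : coarseChains M 𝓔 (m + 2)) :
    boundary 𝓔 m (boundary 𝓔 (m + 1) c) = 0 := by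
  ext1
  have hff : ∀ (i : Fin (m + 2)) (j : Fin (m + 3)), FiniteFibres (face (X := X) i ∘ face j) c.1 :=
    fun i j => finiteFibres_of_proper
      (proper_reindex (isCoarse_id 𝓔) c.2 (j.succAbove ∘ i.succAbove))
  have h1 : ∀ i : Fin (m + 2), push (face i)
      (∑ j : Fin (m + 3), (-1 : ℤ) ^ (j : ℕ) • push (face j) c.1) =
      ∑ j : Fin (m + 3), (-1 : ℤ) ^ (j : ℕ) • push (face i ∘ face j) c.1 := fun i => by
    have hf : ∀ j : Fin (m + 3), FiniteFibres (face i) (push (face j) c.1) := fun j =>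
      face_finiteFibres (isCoarseChain_face c.2 j) i
    rw [push_sum _ fun j _ => (hf j).zsmul _]
    exact Finset.sum_congr rfl fun j _ => by rw [push_zsmul (hf j), push_push (hff i j)]
  simp only [boundary_coe, h1, Finset.smul_sum, smul_smul, AddSubgroup.coe_zero]
  rw [← Finset.sum_product']
  refine Finset.sum_involution (fun p _ => (p.1.predAbove p.2, p.2.succAbove p.1)) ?_ ?_ ?_ ?_
  · rintro ⟨i, j⟩ -
    have hfun : face (X := X) (i.predAbove j) ∘ face (j.succAbove i) = face i ∘ face j := by
      funext x l
      simp only [face, Function.comp, Fin.succAbove_succAbove_succAbove_predAbove]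
    dsimp only
    rw [hfun, ← add_smul, ← pow_add, ← pow_add, add_comm (i.predAbove j : ℕ),
      Fin.neg_one_pow_succAbove_add_predAbove, add_comm (i : ℕ), add_neg_cancel, zero_smul]
  · rintro ⟨i, j⟩ - - h
    exact Fin.succAbove_ne j i (congrArg Prod.snd h)
  · intro p _
    exact Finset.mem_univ _
  · rintro ⟨i, j⟩ -
    simp only [Fin.succAbove_succAbove_predAbove, Fin.predAbove_predAbove_succAbove]

end Chains

/-! ### Ordinary coarse homology -/

section Homology

variable {X : Type u} {Y : Type v} {M : Type w} [AddCommGroup M]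

variable (M) in
/-- The subgroup `CX_m(A; M)` of `CX_m(X; M)` for a subspace `A ⊆ X`. -/
def chainsIn (𝓔 : CoarseStructure X) (A : Set X) (m : ℕ) : AddSubgroup (coarseChains M 𝓔 m) where
  carrier := {c | ∀ x, c.1 x ≠ 0 → ∀ i, x i ∈ A}
  zero_mem' := fun x h => (h rfl).elim
  add_mem' := by
    intro c d hc hd x hx
    by_cases h : c.1 x = 0
    · refine hd x fun h' => hx ?_
      simp [h, h']
    · exact hc x h
  neg_mem' := by
    intro c hc x hx
    exact hc x fun h => hx (by simp [h])

/-- Relative cycles of a subcomplex `T` of `CX_*(X; M)` modulo a subcomplex `S`: chains in `T`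
with boundary in `S`. -/
def relCycles {𝓔 : CoarseStructure X} (T S : ∀ m, AddSubgroup (coarseChains M 𝓔 m)) :
    ∀ m, AddSubgroup (coarseChains M 𝓔 m)
  | 0 => T 0
  | m + 1 => T (m + 1) ⊓ (S m).comap (boundary 𝓔 m)

/-- Relative boundaries of `T` modulo `S`: sums of boundaries of chains in `T` and chains
in `S`. -/
def relBoundaries {𝓔 : CoarseStructure X} (T S : ∀ m, AddSubgroup (coarseChains M 𝓔 m)) (m : ℕ) :
    AddSubgroup (coarseChains M 𝓔 m) :=
  (T (m + 1)).map (boundary 𝓔 m) ⊔ S m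

/-- The homology `H_m(T / S)`. -/
def RelHomology {𝓔 : CoarseStructure X} (T S : ∀ m, AddSubgroup (coarseChains M 𝓔 m)) (m : ℕ) :
    Type _ :=
  relCycles T S m ⧸ (relBoundaries T S m).addSubgroupOf (relCycles T S m)

instance {𝓔 : CoarseStructure X} (T S : ∀ m, AddSubgroup (coarseChains M 𝓔 m)) (m : ℕ) :
    AddCommGroup (RelHomology T S m) :=
  inferInstanceAs (AddCommGroup
    (relCycles T S m ⧸ (relBoundaries T S m).addSubgroupOf (relCycles T S m)))

lemma mem_relBoundaries {𝓔 : CoarseStructure X} {T S : ∀ m, AddSubgroup (coarseChains M 𝓔 m)}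
    {m : ℕ} {c : coarseChains M 𝓔 m} :
    c ∈ relBoundaries T S m ↔ ∃ e ∈ T (m + 1), ∃ s ∈ S m, boundary 𝓔 m e + s = c := by
  rw [relBoundaries, AddSubgroup.mem_sup]
  constructor
  · rintro ⟨_, ⟨e, he, rfl⟩, s, hs, h⟩
    exact ⟨e, he, s, hs, h⟩
  · rintro ⟨e, he, s, hs, h⟩
    exact ⟨_, ⟨e, he, rfl⟩, s, hs, h⟩

/-- The class of a relative cycle. -/
def homologyClass {𝓔 : CoarseStructure X} (T S : ∀ m, AddSubgroup (coarseChains M 𝓔 m)) (m : ℕ) :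
    relCycles T S m →+ RelHomology T S m := QuotientAddGroup.mk' _

variable (M) in
/-- `HX_m(Y, A; M)` for subspaces `A ⊆ Y` of the coarse space `X`. In particular, `HX_m(X, A; M)`
is the case `Y = univ`. -/
abbrev HX (𝓔 : CoarseStructure X) (Y A : Set X) (m : ℕ) : Type _ :=
  RelHomology (chainsIn M 𝓔 Y) (chainsIn M 𝓔 A) m

variable (M) in
/-- The subcomplex `CX_*(A; M) + CX_*(B; M)`. -/
def chainsSum (𝓔 : CoarseStructure X) (A B : Set X) (m : ℕ) : AddSubgroup (coarseChains M 𝓔 m) :=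
  chainsIn M 𝓔 A m ⊔ chainsIn M 𝓔 B m

variable (M) in
/-- `HX_m(X, A + B; M)`: the homology of the quotient of `CX_*(X; M)` by
`CX_*(A; M) + CX_*(B; M)`. -/
abbrev HXsum (𝓔 : CoarseStructure X) (A B : Set X) (m : ℕ) : Type _ :=
  RelHomology (chainsIn M 𝓔 univ) (chainsSum M 𝓔 A B) m

lemma chainsIn_mono {𝓔 : CoarseStructure X} {A B : Set X} (h : A ⊆ B) (m : ℕ) :
    chainsIn M 𝓔 A m ≤ chainsIn M 𝓔 B m := fun _ hc x hx i => h (hc x hx i)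

lemma chainsSum_le {𝓔 : CoarseStructure X} {A B : Set X} (m : ℕ) :
    chainsSum M 𝓔 A B m ≤ chainsIn M 𝓔 (A ∪ B) m :=
  sup_le (chainsIn_mono subset_union_left m) (chainsIn_mono subset_union_right m)

lemma homologyClass_eq_zero_iff {𝓔 : CoarseStructure X}
    {T S : ∀ m, AddSubgroup (coarseChains M 𝓔 m)} {m : ℕ} (c : relCycles T S m) :
    homologyClass T S m c = 0 ↔ c.1 ∈ relBoundaries T S m :=
  (QuotientAddGroup.eq_zero_iff c).trans AddSubgroup.mem_addSubgroupOf

/-- A homomorphism out of relative homology, induced by a homomorphism on relative cycles. -/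
def RelHomology.lift {𝓔 : CoarseStructure X} {T S : ∀ m, AddSubgroup (coarseChains M 𝓔 m)} {m : ℕ}
    {G : Type*} [AddCommGroup G] (F : relCycles T S m →+ G)
    (h : ∀ c : relCycles T S m, c.1 ∈ relBoundaries T S m → F c = 0) : RelHomology T S m →+ G :=
  QuotientAddGroup.lift _ F fun c hc => h c (AddSubgroup.mem_addSubgroupOf.1 hc)

/-- The map on relative homology induced by a chain map. -/
def RelHomology.map {𝓔 : CoarseStructure X} {𝓕 : CoarseStructure Y}
    {T S : ∀ m, AddSubgroup (coarseChains M 𝓔 m)} {T' S' : ∀ m, AddSubgroup (coarseChains M 𝓕 m)}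
    (F : ∀ m, coarseChains M 𝓔 m →+ coarseChains M 𝓕 m)
    (hF : ∀ m c, F m (boundary 𝓔 m c) = boundary 𝓕 m (F (m + 1) c))
    (hT : ∀ m, T m ≤ (T' m).comap (F m)) (hS : ∀ m, S m ≤ (S' m).comap (F m)) (m : ℕ) :
    RelHomology T S m →+ RelHomology T' S' m :=
  QuotientAddGroup.map _ _ (((F m).comp (relCycles T S m).subtype).codRestrict (relCycles T' S' m)
    (by
      rintro ⟨c, hc⟩
      cases m with
      | zero => exact hT 0 hc
      | succ m =>
        refine ⟨hT _ hc.1, ?_⟩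
        have := hS m hc.2
        rw [AddSubgroup.mem_comap, hF] at this
        exact this))
    (by
      rintro ⟨c, hc⟩ h
      obtain ⟨e, he, s, hs, hes⟩ := mem_relBoundaries.1 (AddSubgroup.mem_addSubgroupOf.1 h)
      refine AddSubgroup.mem_comap.2 (AddSubgroup.mem_addSubgroupOf.2 (mem_relBoundaries.2
        ⟨F _ e, hT _ he, F m s, hS _ hs, ?_⟩))
      rw [← hF, ← map_add, hes]
      rfl)

/-- The connecting homomorphism `H_{m+1}(T / S) → H_m(S / R)` of a triple of subcomplexes
`R ⊆ S ⊆ T`, sending the class of `c` to the class of `∂c`. -/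
def connecting {𝓔 : CoarseStructure X} (T S R : ∀ m, AddSubgroup (coarseChains M 𝓔 m)) (m : ℕ) :
    RelHomology T S (m + 1) →+ RelHomology S R m :=
  QuotientAddGroup.map _ _ (((boundary 𝓔 m).comp (relCycles T S (m + 1)).subtype).codRestrict
    (relCycles S R m)
    (by
      rintro ⟨c, hc⟩
      cases m with
      | zero => exact hc.2
      | succ m =>
        refine ⟨hc.2, ?_⟩
        simp [boundary_boundary]))
    (by
      rintro ⟨c, hc⟩ h
      obtain ⟨e, he, s, hs, hes⟩ := mem_relBoundaries.1 (AddSubgroup.mem_addSubgroupOf.1 h)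
      refine AddSubgroup.mem_comap.2 (AddSubgroup.mem_addSubgroupOf.2 (mem_relBoundaries.2
        ⟨s, hs, 0, zero_mem _, ?_⟩))
      have h2 := congrArg (boundary 𝓔 m) hes
      rw [map_add, boundary_boundary, zero_add] at h2
      rw [add_zero, h2]
      rfl)

/-- The chain map `f_* : CX_m(X; M) → CX_m(Y; M)` induced by a coarse map `f : X → Y`. -/
def chainMap {𝓔 : CoarseStructure X} {𝓕 : CoarseStructure Y} {f : X → Y} (hf : 𝓔.IsCoarse 𝓕 f)
    (m : ℕ) : coarseChains M 𝓔 m →+ coarseChains M 𝓕 m where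
  toFun c := ⟨push (fun x => f ∘ x) c.1, isCoarseChain_push
    (controlled_reindex hf.1 c.2 id) (proper_reindex hf c.2 id)⟩
  map_zero' := by
    ext1
    simp
  map_add' c d := by
    ext1
    exact push_add (finiteFibres_of_proper (proper_reindex hf c.2 id))
      (finiteFibres_of_proper (proper_reindex hf d.2 id))

lemma chainMap_boundary {𝓔 : CoarseStructure X} {𝓕 : CoarseStructure Y} {f : X → Y}
    (hf : 𝓔.IsCoarse 𝓕 f) (m : ℕ) (c : coarseChains M 𝓔 (m + 1)) :
    chainMap hf m (boundary 𝓔 m c) = boundary 𝓕 m (chainMap hf (m + 1) c) := by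
  ext1
  have hff : ∀ i : Fin (m + 2), FiniteFibres ((fun x => f ∘ x) ∘ face i) c.1 := fun i =>
    finiteFibres_of_proper (proper_reindex hf c.2 i.succAbove)
  have h1 : ∀ i : Fin (m + 2), FiniteFibres (fun x => f ∘ x) (push (face i) c.1) := fun i =>
    finiteFibres_of_proper (proper_reindex hf (isCoarseChain_face c.2 i) id)
  change push _ (∑ i : Fin (m + 2), (-1 : ℤ) ^ (i : ℕ) • push (face i) c.1) =
    ∑ i : Fin (m + 2), (-1 : ℤ) ^ (i : ℕ) • push (face i) (push (fun x => f ∘ x) c.1)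
  rw [push_sum _ fun i _ => (h1 i).zsmul _]
  refine Finset.sum_congr rfl fun i _ => ?_
  rw [push_zsmul (h1 i), push_push (hff i), push_push]
  · rfl
  · exact hff i

lemma chainsIn_le_comap {𝓔 : CoarseStructure X} {𝓕 : CoarseStructure Y} {f : X → Y}
    (hf : 𝓔.IsCoarse 𝓕 f) {A : Set X} {B : Set Y} (h : ∀ x ∈ A, f x ∈ B) (m : ℕ) :
    chainsIn M 𝓔 A m ≤ (chainsIn M 𝓕 B m).comap (chainMap hf m) := by
  intro c hc y hy i
  obtain ⟨x, rfl, hx⟩ := exists_of_push_ne_zero hy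
  exact h _ (hc x hx i)

/-- The homomorphism `f_* : HX_m(Z, C; M) → HX_m(W, D; M)` induced by a coarse map `f : X → Y`
with `f(Z) ⊆ W` and `f(C) ⊆ D`. -/
def HX.map {𝓔 : CoarseStructure X} {𝓕 : CoarseStructure Y} {f : X → Y} (hf : 𝓔.IsCoarse 𝓕 f)
    {Z C : Set X} {W D : Set Y} (hZ : ∀ x ∈ Z, f x ∈ W) (hC : ∀ x ∈ C, f x ∈ D) (m : ℕ) :
    HX M 𝓔 Z C m →+ HX M 𝓕 W D m :=
  RelHomology.map (chainMap hf) (fun m c => chainMap_boundary hf m c) (chainsIn_le_comap hf hZ)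
    (chainsIn_le_comap hf hC) m

variable (M) in
/-- The canonical homomorphism `HX_m(X, A + B; M) → HX_m(X, A ∪ B; M)`. -/
def HXsum.toUnion (𝓔 : CoarseStructure X) (A B : Set X) (m : ℕ) :
    HXsum M 𝓔 A B m →+ HX M 𝓔 univ (A ∪ B) m :=
  RelHomology.map (T := chainsIn M 𝓔 univ) (T' := chainsIn M 𝓔 univ) (S := chainsSum M 𝓔 A B)
    (S' := chainsIn M 𝓔 (A ∪ B)) (fun _ => AddMonoidHom.id _) (fun _ _ => rfl) (fun _ => le_rfl)
    (fun m => chainsSum_le m) m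

end Homology

/-! ### Ordinary coarse cohomology -/

section Cohomology

variable {X : Type u} {M : Type w} [AddCommGroup M]

/-- `φ : X^{n+1} → M` is a coarse cochain: its support meets each penumbra of the multidiagonal
in a precompact subset. -/
def IsCoarseCochain (𝓔 : CoarseStructure X) {n : ℕ} (φ : (Fin (n + 1) → X) → M) : Prop :=
  ∀ E ∈ (𝓔.power (Fin (n + 1))).entourages, (𝓔.power (Fin (n + 1))).IsPrecompact
    (Function.support φ ∩ penumbra E (multidiagonal (Fin (n + 1)) X))

lemma CoarseStructure.IsPrecompact.subset {𝓔 : CoarseStructure X} {S T : Set X}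
    (hS : 𝓔.IsPrecompact S) (h : T ⊆ S) : 𝓔.IsPrecompact T := by
  obtain ⟨F, hF, hb, rfl⟩ := hS
  refine ⟨(fun K => K ∩ T) '' F, hF.image _, ?_, ?_⟩
  · rintro _ ⟨K, hK, rfl⟩
    exact (hb K hK).subset inter_subset_left
  · ext x
    simp only [mem_sUnion, mem_image, exists_exists_and_eq_and, mem_inter_iff]
    constructor
    · intro hx
      obtain ⟨K, hK, hxK⟩ := h hx
      exact ⟨K, hK, hxK, hx⟩
    · rintro ⟨K, _, _, hx⟩
      exact hx

lemma CoarseStructure.IsPrecompact.union {𝓔 : CoarseStructure X} {S T : Set X}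
    (hS : 𝓔.IsPrecompact S) (hT : 𝓔.IsPrecompact T) : 𝓔.IsPrecompact (S ∪ T) := by
  obtain ⟨F, hF, hb, rfl⟩ := hS
  obtain ⟨G, hG, hb', rfl⟩ := hT
  exact ⟨F ∪ G, hF.union hG, fun K hK => hK.elim (hb K) (hb' K), (sUnion_union F G).symm⟩

variable (M) in
/-- The group `CX^n(X, A; M)` of coarse `n`-cochains which vanish on `A^{n+1}`. -/
def coarseCochains (𝓔 : CoarseStructure X) (A : Set X) (n : ℕ) :
    AddSubgroup ((Fin (n + 1) → X) → M) where
  carrier := {φ | IsCoarseCochain 𝓔 φ ∧ ∀ x, (∀ i, x i ∈ A) → φ x = 0}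
  zero_mem' := ⟨fun E _ => ⟨∅, finite_empty, by simp, by simp⟩, fun _ _ => rfl⟩
  add_mem' := by
    rintro φ ψ ⟨h1, h2⟩ ⟨h3, h4⟩
    refine ⟨fun E hE => ((h1 E hE).union (h3 E hE)).subset ?_, fun x hx => ?_⟩
    · rw [← union_inter_distrib_right]
      exact inter_subset_inter_left _ (Function.support_add φ ψ)
    · simp [h2 x hx, h4 x hx]
  neg_mem' := by
    rintro φ ⟨h1, h2⟩
    refine ⟨fun E hE => ?_, fun x hx => by simp [h2 x hx]⟩
    rw [Function.support_neg]
    exact h1 E hE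

variable (X M) in
/-- The Alexander–Spanier coboundary map
`(δφ)(x_0, …, x_{n+1}) = ∑ᵢ (-1)ⁱ φ(x_0, …, x_{i-1}, x_{i+1}, …, x_{n+1})`. -/
def coboundary (n : ℕ) : ((Fin (n + 1) → X) → M) →+ ((Fin (n + 2) → X) → M) where
  toFun φ := fun x => ∑ i : Fin (n + 2), (-1 : ℤ) ^ (i : ℕ) • φ (face i x)
  map_zero' := by
    funext x
    simp
  map_add' φ ψ := by
    funext x
    simp [Finset.sum_add_distrib]

variable (M) in
/-- The cocycles in `CX^n(X, A; M)`. -/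
def coarseCocycles (𝓔 : CoarseStructure X) (A : Set X) (n : ℕ) :
    AddSubgroup ((Fin (n + 1) → X) → M) :=
  coarseCochains M 𝓔 A n ⊓ (coboundary X M n).ker

variable (M) in
/-- The coboundaries in `CX^n(X, A; M)`. -/
def coarseCoboundaries (𝓔 : CoarseStructure X) (A : Set X) :
    ∀ n, AddSubgroup ((Fin (n + 1) → X) → M)
  | 0 => ⊥
  | n + 1 => (coarseCochains M 𝓔 A n).map (coboundary X M n)

variable (M) in
/-- The ordinary coarse cohomology `HX^n(X, A; M)`. -/
def HXcoh (𝓔 : CoarseStructure X) (A : Set X) (n : ℕ) : Type _ :=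
  coarseCocycles M 𝓔 A n ⧸ (coarseCoboundaries M 𝓔 A n).addSubgroupOf (coarseCocycles M 𝓔 A n)

instance (𝓔 : CoarseStructure X) (A : Set X) (n : ℕ) : AddCommGroup (HXcoh M 𝓔 A n) :=
  inferInstanceAs (AddCommGroup
    (coarseCocycles M 𝓔 A n ⧸
      (coarseCoboundaries M 𝓔 A n).addSubgroupOf (coarseCocycles M 𝓔 A n)))

variable (M) in
/-- The class of a cocycle. -/
def cohomologyClass (𝓔 : CoarseStructure X) (A : Set X) (n : ℕ) :
    coarseCocycles M 𝓔 A n →+ HXcoh M 𝓔 A n := QuotientAddGroup.mk' _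

/-- A homomorphism out of cohomology, induced by a homomorphism on cocycles. -/
def HXcoh.lift {𝓔 : CoarseStructure X} {A : Set X} {n : ℕ} {G : Type*} [AddCommGroup G]
    (F : coarseCocycles M 𝓔 A n →+ G)
    (h : ∀ φ : coarseCocycles M 𝓔 A n, φ.1 ∈ coarseCoboundaries M 𝓔 A n → F φ = 0) :
    HXcoh M 𝓔 A n →+ G :=
  QuotientAddGroup.lift _ F fun φ hφ => h φ (AddSubgroup.mem_addSubgroupOf.1 hφ)

lemma HXcoh.lift_class {𝓔 : CoarseStructure X} {A : Set X} {n : ℕ} {G : Type*} [AddCommGroup G]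
    (F : coarseCocycles M 𝓔 A n →+ G)
    (h : ∀ φ : coarseCocycles M 𝓔 A n, φ.1 ∈ coarseCoboundaries M 𝓔 A n → F φ = 0)
    (φ : coarseCocycles M 𝓔 A n) : HXcoh.lift F h (cohomologyClass M 𝓔 A n φ) = F φ := rfl

lemma HXcoh.hom_ext {𝓔 : CoarseStructure X} {A : Set X} {n : ℕ} {G : Type*} [AddCommGroup G]
    {F F' : HXcoh M 𝓔 A n →+ G}
    (h : ∀ φ, F (cohomologyClass M 𝓔 A n φ) = F' (cohomologyClass M 𝓔 A n φ)) : F = F' := by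
  refine AddMonoidHom.ext fun y => ?_
  obtain ⟨φ, rfl⟩ := QuotientAddGroup.mk'_surjective _ y
  exact h φ

end Cohomology

/-! ### The slant product -/

section Slant

variable {X : Type u} {Y : Type v} {M₁ M₂ M₃ : Type*} [AddCommGroup M₁] [AddCommGroup M₂]
  [AddCommGroup M₃]

/-- The indices `0, …, k` of the front part of a tuple `(z_0, …, z_N)`, where `N = k + n`. -/
def frontIdx {N k n : ℕ} (h : N = k + n) (i : Fin (k + 1)) : Fin (N + 1) := ⟨i, by omega⟩

/-- The indices `N, N - 1, …, N - n` of the reversed back part of a tuple `(z_0, …, z_N)`, where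
`N = k + n`. -/
def backIdx {N k n : ℕ} (h : N = k + n) (j : Fin (n + 1)) : Fin (N + 1) := ⟨N - j, by omega⟩

/-- For maps of index sets `α, β`, the linear extension of
`m · ((x_0, y_0), …, (x_N, y_N)) ↦ (m · φ(y_{β(0)}, …, y_{β(n)})) (x_{α(0)}, …, x_{α(k)})`. -/
def slantAux (μ : M₁ →+ M₂ →+ M₃) {N k n : ℕ} (α : Fin (k + 1) → Fin (N + 1))
    (β : Fin (n + 1) → Fin (N + 1)) (c : (Fin (N + 1) → X × Y) → M₁)
    (φ : (Fin (n + 1) → Y) → M₂) : (Fin (k + 1) → X) → M₃ :=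
  push (fun z i => (z (α i)).1) (fun z => μ (c z) (φ fun j => (z (β j)).2))

/-- The slant product on the level of chains and cochains, the linear extension of
`(m · ((x_0, y_0), …, (x_N, y_N))) / φ = (m · φ(y_N, …, y_{N-n})) (x_0, …, x_{N-n})`. -/
def slantRaw (μ : M₁ →+ M₂ →+ M₃) {N k n : ℕ} (h : N = k + n) (c : (Fin (N + 1) → X × Y) → M₁)
    (φ : (Fin (n + 1) → Y) → M₂) : (Fin (k + 1) → X) → M₃ :=
  slantAux μ (frontIdx h) (backIdx h) c φ

lemma slantAux_proper (μ : M₁ →+ M₂ →+ M₃) {𝓔 : CoarseStructure X} {𝓕 : CoarseStructure Y}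
    {N k n : ℕ} (α : Fin (k + 1) → Fin (N + 1)) (β : Fin (n + 1) → Fin (N + 1))
    {c : (Fin (N + 1) → X × Y) → M₁} (hc : IsCoarseChain (𝓔.prod 𝓕) c)
    {φ : (Fin (n + 1) → Y) → M₂} (hφ : IsCoarseCochain 𝓕 φ) (K : Set (Fin (k + 1) → X))
    (hK : (𝓔.power (Fin (k + 1))).IsBounded K) :
    ((fun (z : Fin (N + 1) → X × Y) i => (z (α i)).1) ⁻¹' K ∩
      Function.support (fun z => μ (c z) (φ fun j => (z (β j)).2))).Finite := by
  obtain ⟨G, ⟨E, hE, F, hF, hG⟩, hcG⟩ := subset_penumbra_iff.1 hc.1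
  obtain ⟨P, hP, hsub⟩ := (subset_penumbra_iff (𝓔 := 𝓕) (m := n)
    (S := {y | ∀ i j, (y i, y j) ∈ F})).2 ⟨F, hF, fun y hy => hy⟩
  obtain ⟨L, hL, hLb, hLeq⟩ := hφ P hP
  have hB1 := (CoarseStructure.isBounded_power_iff.1 hK 0).penumbra hE
  have hfin : ∀ l ∈ L, (Function.support c ∩ {z | ∀ i, (z i).1 ∈ penumbra E ((fun x => x 0) '' K) ∧
      (z i).2 ∈ penumbra F ((fun x => x 0) '' l)}).Finite := by
    intro l hl
    have hB2 := (CoarseStructure.isBounded_power_iff.1 (hLb l hl) 0).penumbra hF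
    refine hc.2 _ (CoarseStructure.isBounded_power_iff.2 fun i =>
      CoarseStructure.isBounded_prod_iff.2 ⟨hB1.subset ?_, hB2.subset ?_⟩)
    · rintro _ ⟨_, ⟨z, hz, rfl⟩, rfl⟩
      exact (hz i).1
    · rintro _ ⟨_, ⟨z, hz, rfl⟩, rfl⟩
      exact (hz i).2
  refine (hL.biUnion hfin).subset ?_
  rintro z ⟨hzK, hz⟩
  have hcz : c z ≠ 0 := fun h => hz (by simp [h])
  have hφz : (φ fun j => (z (β j)).2) ≠ 0 := fun h => hz (by simp [h])
  have hmem : (fun j => (z (β j)).2) ∈ ⋃₀ L := by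
    rw [← hLeq]
    exact ⟨hφz, hsub fun i j => (hG _ (hcG z hcz (β i) (β j))).2⟩
  obtain ⟨l, hl, hzl⟩ := hmem
  refine mem_biUnion hl ⟨hcz, fun i => ⟨⟨_, ⟨_, hzK, rfl⟩, (hG _ (hcG z hcz i (α 0))).1⟩,
    ⟨_, ⟨_, hzl, rfl⟩, (hG _ (hcG z hcz i (β 0))).2⟩⟩⟩

lemma slantAux_finiteFibres (μ : M₁ →+ M₂ →+ M₃) {𝓔 : CoarseStructure X} {𝓕 : CoarseStructure Y}
    {N k n : ℕ} (α : Fin (k + 1) → Fin (N + 1)) (β : Fin (n + 1) → Fin (N + 1))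
    {c : (Fin (N + 1) → X × Y) → M₁} (hc : IsCoarseChain (𝓔.prod 𝓕) c)
    {φ : (Fin (n + 1) → Y) → M₂} (hφ : IsCoarseCochain 𝓕 φ) :
    FiniteFibres (fun (z : Fin (N + 1) → X × Y) i => (z (α i)).1)
      (fun z => μ (c z) (φ fun j => (z (β j)).2)) :=
  finiteFibres_of_proper (slantAux_proper μ α β hc hφ)

lemma isCoarseChain_slantAux (μ : M₁ →+ M₂ →+ M₃) {𝓔 : CoarseStructure X} {𝓕 : CoarseStructure Y}
    {N k n : ℕ} (α : Fin (k + 1) → Fin (N + 1)) (β : Fin (n + 1) → Fin (N + 1))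
    {c : (Fin (N + 1) → X × Y) → M₁} (hc : IsCoarseChain (𝓔.prod 𝓕) c)
    {φ : (Fin (n + 1) → Y) → M₂} (hφ : IsCoarseCochain 𝓕 φ) :
    IsCoarseChain 𝓔 (slantAux μ α β c φ) := by
  refine isCoarseChain_push ?_ (slantAux_proper μ α β hc hφ)
  obtain ⟨G, ⟨E, hE, F, hF, hG⟩, hcG⟩ := subset_penumbra_iff.1 hc.1
  refine ⟨E, hE, fun z hz i j => ?_⟩
  have hcz : c z ≠ 0 := fun h => hz (by simp [h])
  exact (hG _ (hcG z hcz _ _)).1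

/-- The slant product as a biadditive map on coarse chains and cochains. -/
def slantChain (μ : M₁ →+ M₂ →+ M₃) (𝓔 : CoarseStructure X) (𝓕 : CoarseStructure Y) (B : Set Y)
    {N k n : ℕ} (h : N = k + n) :
    coarseChains M₁ (𝓔.prod 𝓕) N →+ coarseCochains M₂ 𝓕 B n →+ coarseChains M₃ 𝓔 k :=
  AddMonoidHom.mk' (fun c => AddMonoidHom.mk'
      (fun φ => ⟨slantRaw μ h c.1 φ.1, isCoarseChain_slantAux μ _ _ c.2 φ.2.1⟩)
      (fun φ ψ => by
        ext1
        change push _ _ = push _ _ + push _ _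
        rw [← push_add (slantAux_finiteFibres μ _ _ c.2 φ.2.1)
          (slantAux_finiteFibres μ _ _ c.2 ψ.2.1)]
        congr 1
        funext z
        simp))
    (fun c d => by
      ext φ : 2
      change push _ _ = push _ _ + push _ _
      rw [← push_add (slantAux_finiteFibres μ _ _ c.2 φ.2.1)
        (slantAux_finiteFibres μ _ _ d.2 φ.2.1)]
      congr 1
      funext z
      simp)

/-- `(∂c)/φ = ∂(c/φ) + (-1)^{N+1} c/(δφ)` for chains `c` of degree `N + 1`. -/
lemma slant_boundary (μ : M₁ →+ M₂ →+ M₃) {𝓔 : CoarseStructure X} {𝓕 : CoarseStructure Y}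
    {B : Set Y} {N k n : ℕ} (h : N = k + n) (h' : N + 1 = (k + 1) + n) (h'' : N + 1 = k + (n + 1))
    (c : coarseChains M₁ (𝓔.prod 𝓕) (N + 1)) (φ : coarseCochains M₂ 𝓕 B n) :
    (slantChain μ 𝓔 𝓕 B h (boundary _ N c) φ).1 =
      (boundary 𝓔 k (slantChain μ 𝓔 𝓕 B h' c φ)).1 +
        (-1 : ℤ) ^ (N + 1) • slantRaw μ h'' c.1 (coboundary Y M₂ n φ.1) := by
  set S : (Fin (k + 1) → Fin (N + 2)) → (Fin (n + 1) → Fin (N + 2)) → ((Fin (k + 1) → X) → M₃) :=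
    fun α β => slantAux μ α β c.1 φ.1 with hS
  have e1 : (slantChain μ 𝓔 𝓕 B h (boundary _ N c) φ).1 =
      ∑ i : Fin (N + 2), (-1 : ℤ) ^ (i : ℕ) •
        S (i.succAbove ∘ frontIdx h) (i.succAbove ∘ backIdx h) := by
    have hterm : ∀ i : Fin (N + 2),
        (fun z : Fin (N + 1) → X × Y =>
          μ (push (face i) c.1 z) (φ.1 fun j => (z (backIdx h j)).2)) =
        push (face i) (fun z => μ (c.1 z) (φ.1 fun j => (z (i.succAbove (backIdx h j))).2)) :=
      fun i => push_apply_hom (face_finiteFibres c.2 i)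
        (fun z => μ.flip (φ.1 fun j => (z (backIdx h j)).2))
    have hcomp : ∀ i : Fin (N + 2), FiniteFibres
        ((fun (z : Fin (N + 1) → X × Y) (l : Fin (k + 1)) => (z (frontIdx h l)).1) ∘ face i)
        (fun z => μ (c.1 z) (φ.1 fun j => (z (i.succAbove (backIdx h j))).2)) := fun i =>
      slantAux_finiteFibres μ (i.succAbove ∘ frontIdx h) (i.succAbove ∘ backIdx h) c.2 φ.2.1
    change push (fun z i => (z (frontIdx h i)).1) (fun z => μ ((∑ i : Fin (N + 2),
      (-1 : ℤ) ^ (i : ℕ) • push (face i) c.1) z) (φ.1 fun j => (z (backIdx h j)).2)) = _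
    have hsum : (fun z : Fin (N + 1) → X × Y => μ ((∑ i : Fin (N + 2),
        (-1 : ℤ) ^ (i : ℕ) • push (face i) c.1) z) (φ.1 fun j => (z (backIdx h j)).2)) =
        ∑ i : Fin (N + 2), (-1 : ℤ) ^ (i : ℕ) •
          push (face i) (fun z => μ (c.1 z) (φ.1 fun j => (z (i.succAbove (backIdx h j))).2)) := by
      funext z
      simp only [Finset.sum_apply, Pi.smul_apply, map_sum, map_zsmul, AddMonoidHom.finsetSum_apply,
        AddMonoidHom.coe_smul, ← hterm]
    have hf2 : ∀ i : Fin (N + 2), FiniteFibres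
        (fun (z : Fin (N + 1) → X × Y) (l : Fin (k + 1)) => (z (frontIdx h l)).1)
        (push (face i) (fun z => μ (c.1 z) (φ.1 fun j => (z (i.succAbove (backIdx h j))).2))) := by
      intro i
      rw [← hterm]
      exact slantAux_finiteFibres μ _ _ (isCoarseChain_face c.2 i) φ.2.1
    rw [hsum, push_sum _ fun i _ => (hf2 i).zsmul _]
    refine Finset.sum_congr rfl fun i _ => ?_
    rw [push_zsmul (hf2 i), push_push (hcomp i)]
    rfl
  have e2 : (boundary 𝓔 k (slantChain μ 𝓔 𝓕 B h' c φ)).1 =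
      ∑ i : Fin (k + 2), (-1 : ℤ) ^ (i : ℕ) • S (frontIdx h' ∘ i.succAbove) (backIdx h') := by
    rw [boundary_coe]
    refine Finset.sum_congr rfl fun i _ => ?_
    congr 1
    exact push_push (slantAux_finiteFibres μ (frontIdx h' ∘ i.succAbove) (backIdx h') c.2 φ.2.1)
  have e3 : slantRaw μ h'' c.1 (coboundary Y M₂ n φ.1) =
      ∑ j : Fin (n + 2), (-1 : ℤ) ^ (j : ℕ) • S (frontIdx h'') (backIdx h'' ∘ j.succAbove) := by
    have hf : ∀ j : Fin (n + 2), FiniteFibres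
        (fun (z : Fin (N + 2) → X × Y) (l : Fin (k + 1)) => (z (frontIdx h'' l)).1)
        (fun z => μ (c.1 z) (φ.1 fun l => (z (backIdx h'' (j.succAbove l))).2)) := fun j =>
      slantAux_finiteFibres μ (frontIdx h'') (backIdx h'' ∘ j.succAbove) c.2 φ.2.1
    have hsum : (fun z : Fin (N + 2) → X × Y => μ (c.1 z) (coboundary Y M₂ n φ.1
        fun j => (z (backIdx h'' j)).2)) = ∑ j : Fin (n + 2), (-1 : ℤ) ^ (j : ℕ) •
        (fun z => μ (c.1 z) (φ.1 fun l => (z (backIdx h'' (j.succAbove l))).2)) := by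
      funext z
      simp only [coboundary, AddMonoidHom.coe_mk, ZeroHom.coe_mk, map_sum, map_zsmul,
        Finset.sum_apply, Pi.smul_apply]
      rfl
    rw [slantRaw, slantAux, hsum, push_sum _ fun j _ => (hf j).zsmul _]
    refine Finset.sum_congr rfl fun j _ => ?_
    rw [push_zsmul (hf j)]
    rfl
  rw [e1, e2, e3]
  clear_value S
  clear e1 e2 e3 hS
  subst h
  have hN : (k + 1) + (n + 1) = k + n + 2 := by omega
  have g1 : ∀ i : Fin (k + 1), (-1 : ℤ) ^ ((Fin.cast hN
      (Fin.castAdd (n + 1) i) : Fin (k + n + 2)) : ℕ) •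
      S ((Fin.cast hN (Fin.castAdd (n + 1) i) : Fin (k + n + 2)).succAbove ∘ frontIdx rfl)
        ((Fin.cast hN (Fin.castAdd (n + 1) i) : Fin (k + n + 2)).succAbove ∘ backIdx rfl) =
      (-1 : ℤ) ^ (i.castSucc : ℕ) • S (frontIdx h' ∘ i.castSucc.succAbove) (backIdx h') := by
    intro i
    congr 2
    · funext l
      ext
      simp only [Function.comp, Fin.succAbove, frontIdx, Fin.lt_def]
      simp only [Fin.val_castSucc, Fin.val_cast, Fin.val_castAdd]
      split_ifs <;> simp
    · funext l
      ext
      simp only [Function.comp, Fin.succAbove, backIdx, Fin.lt_def]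
      simp only [Fin.val_castSucc, Fin.val_cast, Fin.val_castAdd]
      split_ifs <;> simp <;> omega
  have g2 : ∀ j : Fin (n + 1), (-1 : ℤ) ^ ((Fin.cast hN
      (Fin.natAdd (k + 1) (Fin.rev j)) : Fin (k + n + 2)) : ℕ) •
      S ((Fin.cast hN (Fin.natAdd (k + 1) (Fin.rev j)) : Fin (k + n + 2)).succAbove ∘ frontIdx rfl)
        ((Fin.cast hN (Fin.natAdd (k + 1) (Fin.rev j)) : Fin (k + n + 2)).succAbove ∘
          backIdx rfl) =
      (-1 : ℤ) ^ (k + n + 1) • (-1 : ℤ) ^ (j.castSucc : ℕ) •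
        S (frontIdx h'') (backIdx h'' ∘ j.castSucc.succAbove) := by
    intro j
    have hj := j.2
    rw [smul_smul, ← pow_add]
    congr 1
    · have hval : ((Fin.cast hN (Fin.natAdd (k + 1) (Fin.rev j)) : Fin (k + n + 2)) : ℕ) + 2 * j =
          k + n + 1 + j := by
        simp only [Fin.val_cast, Fin.val_natAdd, Fin.val_rev]
        omega
      rw [Fin.val_castSucc, ← hval, pow_add, pow_mul]
      simp
    · congr 1
      · funext l
        ext
        simp only [Function.comp, Fin.succAbove, frontIdx, Fin.lt_def]
        simp only [Fin.val_castSucc, Fin.val_cast, Fin.val_natAdd, Fin.val_rev]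
        split_ifs <;> simp <;> omega
      · funext l
        ext
        simp only [Function.comp, Fin.succAbove, backIdx, Fin.lt_def]
        simp only [Fin.val_castSucc, Fin.val_cast, Fin.val_natAdd, Fin.val_rev]
        split_ifs <;> simp <;> omega
  have g3 : S (frontIdx h' ∘ (Fin.last (k + 1)).succAbove) (backIdx h') =
      S (frontIdx h'') (backIdx h'' ∘ (Fin.last (n + 1)).succAbove) := by
    congr 1
    · funext l
      ext
      simp [frontIdx]
    · funext l
      ext
      simp [backIdx]
  have g4 : (-1 : ℤ) ^ (k + n + 1) * (-1 : ℤ) ^ (n + 1) = -(-1 : ℤ) ^ (k + 1) := by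
    rw [← pow_add, show k + n + 1 + (n + 1) = (k + 1) + 1 + 2 * n by ring, pow_add, pow_mul,
      pow_succ]
    simp
  rw [← Fin.sum_congr' _ hN, Fin.sum_univ_add, Fin.sum_univ_castSucc (n := k + 1),
    Fin.sum_univ_castSucc (n := n + 1), Finset.sum_congr rfl fun i _ => g1 i,
    ← Equiv.sum_comp Fin.revPerm (fun j : Fin (n + 1) => _ • S (_ ∘ frontIdx rfl) _)]
  simp only [Fin.revPerm_apply]
  rw [Finset.sum_congr rfl fun j _ => g2 j, g3, smul_add, Finset.smul_sum, Fin.val_last,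
    Fin.val_last, smul_smul, g4, neg_smul]
  abel

lemma slantChain_mem_chainsIn (μ : M₁ →+ M₂ →+ M₃) {𝓔 : CoarseStructure X}
    {𝓕 : CoarseStructure Y} {A : Set X} {B : Set Y} {N k n : ℕ} (h : N = k + n)
    {c : coarseChains M₁ (𝓔.prod 𝓕) N} (hc : c ∈ chainsSum M₁ (𝓔.prod 𝓕) (A ×ˢ univ) (univ ×ˢ B) N)
    (φ : coarseCochains M₂ 𝓕 B n) : slantChain μ 𝓔 𝓕 B h c φ ∈ chainsIn M₃ 𝓔 A k := by
  obtain ⟨α, hα, β, hβ, rfl⟩ := AddSubgroup.mem_sup.1 hc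
  rw [map_add]
  refine add_mem ?_ ?_
  · intro x hx i
    obtain ⟨z, rfl, hz⟩ := exists_of_push_ne_zero hx
    have hcz : α.1 z ≠ 0 := fun h => hz (by simp [h])
    exact (hα z hcz _).1
  · intro x hx i
    obtain ⟨z, rfl, hz⟩ := exists_of_push_ne_zero hx
    have hcz : β.1 z ≠ 0 := fun h => hz (by simp [h])
    refine (hz ?_).elim
    rw [φ.2.2 _ fun j => (hβ z hcz _).2, map_zero]

lemma mem_chainsIn_univ {𝓔 : CoarseStructure X} {m : ℕ} (c : coarseChains M₁ 𝓔 m) :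
    c ∈ chainsIn M₁ 𝓔 univ m := fun _ _ _ => mem_univ _

lemma slantRaw_zero (μ : M₁ →+ M₂ →+ M₃) {N k n : ℕ} (h : N = k + n)
    (c : (Fin (N + 1) → X × Y) → M₁) : slantRaw μ h c 0 = 0 := by
  have : (fun z => μ (c z) ((0 : (Fin (n + 1) → Y) → M₂) fun j => (z (backIdx h j)).2)) = 0 := by
    funext z
    simp
  rw [slantRaw, slantAux, this, push_zero]

/-- The slant product of a relative cycle with a cocycle is a relative cycle. -/
lemma slantChain_mem_relCycles (μ : M₁ →+ M₂ →+ M₃) {𝓔 : CoarseStructure X}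
    {𝓕 : CoarseStructure Y} {A : Set X} {B : Set Y} {N k n : ℕ} (h : N = k + n)
    (c : relCycles (chainsIn M₁ (𝓔.prod 𝓕) univ) (chainsSum M₁ (𝓔.prod 𝓕) (A ×ˢ univ) (univ ×ˢ B)) N)
    (φ : coarseCocycles M₂ 𝓕 B n) :
    slantChain μ 𝓔 𝓕 B h c.1 ⟨φ.1, φ.2.1⟩ ∈ relCycles (chainsIn M₃ 𝓔 univ) (chainsIn M₃ 𝓔 A) k := by
  cases k with
  | zero => exact mem_chainsIn_univ _
  | succ k =>
    obtain ⟨c, hc⟩ := c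
    obtain ⟨N, rfl⟩ : ∃ N', N = N' + 1 := ⟨k + n, by omega⟩
    refine ⟨mem_chainsIn_univ _, ?_⟩
    have key := slant_boundary μ (show N = k + n by omega) h (by omega) c ⟨φ.1, φ.2.1⟩
    have hδ : coboundary Y M₂ n φ.1 = 0 := φ.2.2
    rw [hδ, slantRaw_zero, smul_zero, add_zero] at key
    have h2 := slantChain_mem_chainsIn μ (show N = k + n by omega) hc.2
      (⟨φ.1, φ.2.1⟩ : coarseCochains M₂ 𝓕 B n)
    rw [Subtype.ext key] at h2
    exact h2

lemma slantChain_mem_relBoundaries_left (μ : M₁ →+ M₂ →+ M₃) {𝓔 : CoarseStructure X}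
    {𝓕 : CoarseStructure Y} {A : Set X} {B : Set Y} {N k n : ℕ} (h : N = k + n)
    {c : coarseChains M₁ (𝓔.prod 𝓕) N} (hc : c ∈ relBoundaries (chainsIn M₁ (𝓔.prod 𝓕) univ)
      (chainsSum M₁ (𝓔.prod 𝓕) (A ×ˢ univ) (univ ×ˢ B)) N)
    (φ : coarseCocycles M₂ 𝓕 B n) :
    slantChain μ 𝓔 𝓕 B h c ⟨φ.1, φ.2.1⟩ ∈
      relBoundaries (chainsIn M₃ 𝓔 univ) (chainsIn M₃ 𝓔 A) k := by
  obtain ⟨e, -, s, hs, rfl⟩ := mem_relBoundaries.1 hc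
  refine mem_relBoundaries.2 ⟨slantChain μ 𝓔 𝓕 B (show N + 1 = (k + 1) + n by omega) e
    ⟨φ.1, φ.2.1⟩, mem_chainsIn_univ _, slantChain μ 𝓔 𝓕 B h s ⟨φ.1, φ.2.1⟩,
    slantChain_mem_chainsIn μ h hs _, ?_⟩
  have key := slant_boundary μ h (show N + 1 = (k + 1) + n by omega) (by omega) e ⟨φ.1, φ.2.1⟩
  have hδ : coboundary Y M₂ n φ.1 = 0 := φ.2.2
  rw [hδ, slantRaw_zero, smul_zero, add_zero] at key
  rw [map_add, AddMonoidHom.add_apply, Subtype.ext key]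

lemma slantChain_mem_relBoundaries_right (μ : M₁ →+ M₂ →+ M₃) {𝓔 : CoarseStructure X}
    {𝓕 : CoarseStructure Y} {A : Set X} {B : Set Y} {N k n : ℕ} (h : N = k + n)
    (c : relCycles (chainsIn M₁ (𝓔.prod 𝓕) univ) (chainsSum M₁ (𝓔.prod 𝓕) (A ×ˢ univ) (univ ×ˢ B)) N)
    (φ : coarseCocycles M₂ 𝓕 B n) (hφ : φ.1 ∈ coarseCoboundaries M₂ 𝓕 B n) :
    slantChain μ 𝓔 𝓕 B h c.1 ⟨φ.1, φ.2.1⟩ ∈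
      relBoundaries (chainsIn M₃ 𝓔 univ) (chainsIn M₃ 𝓔 A) k := by
  obtain ⟨c, hc⟩ := c
  obtain ⟨φ, hφ'⟩ := φ
  cases n with
  | zero =>
    have hφ0 : φ = 0 := hφ
    subst hφ0
    have : (⟨0, hφ'.1⟩ : coarseCochains M₂ 𝓕 B 0) = 0 := rfl
    rw [this, map_zero]
    exact zero_mem _
  | succ n =>
    obtain ⟨ψ, hψ, rfl⟩ := hφ
    obtain ⟨N, rfl⟩ : ∃ N', N = N' + 1 := ⟨k + n, by omega⟩
    have key := slant_boundary μ (show N = k + n by omega) (show N + 1 = (k + 1) + n by omega) h c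
      ⟨ψ, hψ⟩
    refine mem_relBoundaries.2 ⟨-((-1 : ℤ) ^ (N + 1) • slantChain μ 𝓔 𝓕 B
      (show N + 1 = (k + 1) + n by omega) c ⟨ψ, hψ⟩), mem_chainsIn_univ _,
      (-1 : ℤ) ^ (N + 1) • slantChain μ 𝓔 𝓕 B (show N = k + n by omega) (boundary _ N c) ⟨ψ, hψ⟩,
      zsmul_mem (slantChain_mem_chainsIn μ _ hc.2 _) _, ?_⟩
    rw [map_neg, map_zsmul, neg_add_eq_sub, ← smul_sub]
    have h3 : slantChain μ 𝓔 𝓕 B (show N = k + n by omega) (boundary _ N c) ⟨ψ, hψ⟩ -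
        boundary 𝓔 k (slantChain μ 𝓔 𝓕 B (show N + 1 = (k + 1) + n by omega) c ⟨ψ, hψ⟩) =
        (-1 : ℤ) ^ (N + 1) • slantChain μ 𝓔 𝓕 B h c ⟨coboundary Y M₂ n ψ, hφ'.1⟩ := by
      ext1
      rw [AddSubgroup.coe_sub, key, add_sub_cancel_left]
      rfl
    rw [h3, smul_smul, ← mul_pow]
    simp

/-- The class of the slant product of a relative cycle with a cocycle. -/
def slantCocycle (μ : M₁ →+ M₂ →+ M₃) (𝓔 : CoarseStructure X) (𝓕 : CoarseStructure Y) (A : Set X)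
    (B : Set Y) {N k n : ℕ} (h : N = k + n) (c : relCycles (chainsIn M₁ (𝓔.prod 𝓕) univ)
      (chainsSum M₁ (𝓔.prod 𝓕) (A ×ˢ univ) (univ ×ˢ B)) N) :
    coarseCocycles M₂ 𝓕 B n →+ HX M₃ 𝓔 univ A k :=
  (homologyClass (chainsIn M₃ 𝓔 univ) (chainsIn M₃ 𝓔 A) k).comp
    (AddMonoidHom.mk' (fun φ => ⟨slantChain μ 𝓔 𝓕 B h c.1 ⟨φ.1, φ.2.1⟩,
        slantChain_mem_relCycles μ h c φ⟩) (fun φ ψ => by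
      ext1
      exact map_add (slantChain μ 𝓔 𝓕 B h c.1) ⟨φ.1, φ.2.1⟩ ⟨ψ.1, ψ.2.1⟩))

lemma slantCocycle_apply (μ : M₁ →+ M₂ →+ M₃) {𝓔 : CoarseStructure X} {𝓕 : CoarseStructure Y}
    {A : Set X} {B : Set Y} {N k n : ℕ} (h : N = k + n) (c : relCycles (chainsIn M₁ (𝓔.prod 𝓕) univ)
      (chainsSum M₁ (𝓔.prod 𝓕) (A ×ˢ univ) (univ ×ˢ B)) N) (φ : coarseCocycles M₂ 𝓕 B n) :
    slantCocycle μ 𝓔 𝓕 A B h c φ = homologyClass (chainsIn M₃ 𝓔 univ) (chainsIn M₃ 𝓔 A) k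
      ⟨slantChain μ 𝓔 𝓕 B h c.1 ⟨φ.1, φ.2.1⟩, slantChain_mem_relCycles μ h c φ⟩ := rfl

lemma slantCocycle_add (μ : M₁ →+ M₂ →+ M₃) {𝓔 : CoarseStructure X} {𝓕 : CoarseStructure Y}
    {A : Set X} {B : Set Y} {N k n : ℕ} (h : N = k + n)
    (c d : relCycles (chainsIn M₁ (𝓔.prod 𝓕) univ)
      (chainsSum M₁ (𝓔.prod 𝓕) (A ×ˢ univ) (univ ×ˢ B)) N) (φ : coarseCocycles M₂ 𝓕 B n) :
    slantCocycle μ 𝓔 𝓕 A B h (c + d) φ =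
      slantCocycle μ 𝓔 𝓕 A B h c φ + slantCocycle μ 𝓔 𝓕 A B h d φ := by
  rw [slantCocycle_apply, slantCocycle_apply, slantCocycle_apply, ← map_add]
  congr 1
  ext1
  exact DFunLike.congr_fun (map_add (slantChain μ 𝓔 𝓕 B h) c.1 d.1) ⟨φ.1, φ.2.1⟩

lemma slantCocycle_eq_zero_left (μ : M₁ →+ M₂ →+ M₃) {𝓔 : CoarseStructure X}
    {𝓕 : CoarseStructure Y} {A : Set X} {B : Set Y} {N k n : ℕ} (h : N = k + n)
    (c : relCycles (chainsIn M₁ (𝓔.prod 𝓕) univ)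
      (chainsSum M₁ (𝓔.prod 𝓕) (A ×ˢ univ) (univ ×ˢ B)) N)
    (hc : c.1 ∈ relBoundaries (chainsIn M₁ (𝓔.prod 𝓕) univ)
      (chainsSum M₁ (𝓔.prod 𝓕) (A ×ˢ univ) (univ ×ˢ B)) N)
    (φ : coarseCocycles M₂ 𝓕 B n) : slantCocycle μ 𝓔 𝓕 A B h c φ = 0 := by
  rw [slantCocycle_apply]
  exact (homologyClass_eq_zero_iff _).2 (slantChain_mem_relBoundaries_left μ h hc φ)

lemma slantCocycle_eq_zero_right (μ : M₁ →+ M₂ →+ M₃) {𝓔 : CoarseStructure X}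
    {𝓕 : CoarseStructure Y} {A : Set X} {B : Set Y} {N k n : ℕ} (h : N = k + n)
    (c : relCycles (chainsIn M₁ (𝓔.prod 𝓕) univ)
      (chainsSum M₁ (𝓔.prod 𝓕) (A ×ˢ univ) (univ ×ˢ B)) N)
    (φ : coarseCocycles M₂ 𝓕 B n) (hφ : φ.1 ∈ coarseCoboundaries M₂ 𝓕 B n) :
    slantCocycle μ 𝓔 𝓕 A B h c φ = 0 := by
  rw [slantCocycle_apply]
  exact (homologyClass_eq_zero_iff _).2 (slantChain_mem_relBoundaries_right μ h c φ hφ)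

/-- The slant product of a relative cycle with a cohomology class. -/
def slantCohomology (μ : M₁ →+ M₂ →+ M₃) (𝓔 : CoarseStructure X) (𝓕 : CoarseStructure Y)
    (A : Set X) (B : Set Y) {N k n : ℕ} (h : N = k + n) :
    relCycles (chainsIn M₁ (𝓔.prod 𝓕) univ)
      (chainsSum M₁ (𝓔.prod 𝓕) (A ×ˢ univ) (univ ×ˢ B)) N →+
      HXcoh M₂ 𝓕 B n →+ HX M₃ 𝓔 univ A k :=
  AddMonoidHom.mk' (fun c => HXcoh.lift (slantCocycle μ 𝓔 𝓕 A B h c)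
    (slantCocycle_eq_zero_right μ h c)) (fun c d => HXcoh.hom_ext (slantCocycle_add μ h c d))

/-- The slant product
`HX_N(X × Y, A × Y + X × B; M₁) ⊗ HX^n(Y, B; M₂) → HX_{N-n}(X, A; M₃)`, where `N = k + n`. -/
def slant (μ : M₁ →+ M₂ →+ M₃) (𝓔 : CoarseStructure X) (𝓕 : CoarseStructure Y) (A : Set X)
    (B : Set Y) {N k n : ℕ} (h : N = k + n) :
    HXsum M₁ (𝓔.prod 𝓕) (A ×ˢ univ) (univ ×ˢ B) N →+ HXcoh M₂ 𝓕 B n →+ HX M₃ 𝓔 univ A k :=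
  RelHomology.lift (slantCohomology μ 𝓔 𝓕 A B h)
    (fun c hc => HXcoh.hom_ext (slantCocycle_eq_zero_left μ h c hc))

end Slant

/-! ### Suspension and the secondary cap product -/

section Suspension

variable {X : Type u}

namespace CoarseStructure

lemma isControlled_warped_fst {K : Type*} [TopologicalSpace K] (𝓔 : CoarseStructure X)
    (U : X → Set (K × K)) : (𝓔.warped U).IsControlled 𝓔 Prod.fst := by
  refine isControlled_generate ?_
  rintro _ (⟨E, hE, rfl⟩ | rfl)
  · refine 𝓔.subset_mem hE ?_
    rintro _ ⟨p, hp, rfl⟩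
    exact hp.1
  · refine 𝓔.subset_mem 𝓔.diagonal_mem ?_
    rintro _ ⟨p, hp, rfl⟩
    exact hp.1

lemma IsControlled.isBounded_image {Y : Type*} {𝓔 : CoarseStructure X} {𝓕 : CoarseStructure Y}
    {f : X → Y} (hf : 𝓔.IsControlled 𝓕 f) {K : Set X} (hK : 𝓔.IsBounded K) :
    𝓕.IsBounded (f '' K) := by
  refine 𝓕.subset_mem (hf _ hK) ?_
  rintro ⟨_, _⟩ ⟨⟨x, hx, rfl⟩, ⟨y, hy, rfl⟩⟩
  exact ⟨(x, y), ⟨hx, hy⟩, rfl⟩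

lemma horizontal_mem_warped {K : Type*} (𝓔 : CoarseStructure X) (U : X → Set (K × K))
    {E : Set (X × X)} (hE : E ∈ 𝓔.entourages) :
    {p : (X × K) × (X × K) | (p.1.1, p.2.1) ∈ E ∧ p.1.2 = p.2.2} ∈ (𝓔.warped U).entourages :=
  .basic _ (Or.inl ⟨E, hE, rfl⟩)

lemma vertical_mem_warped {K : Type*} (𝓔 : CoarseStructure X) (U : X → Set (K × K)) :
    {p : (X × K) × (X × K) | p.1.1 = p.2.1 ∧ (p.1.2, p.2.2) ∈ U p.1.1} ∈
      (𝓔.warped U).entourages :=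
  .basic _ (Or.inr rfl)

/-- Each fibre `{x} × [a, b]` of a warped product is bounded. -/
lemma isBounded_fibre {a b : ℝ} (𝓔 : CoarseStructure X) {U : X → Set (Icc a b × Icc a b)}
    (hU : IsNhdFamily U) (x : X) :
    (𝓔.warped U).IsBounded ({x} ×ˢ (univ : Set (Icc a b))) := by
  have hUx := hU x
  rw [nhdsSet_diagonal_eq_uniformity, Metric.mem_uniformity_dist] at hUx
  obtain ⟨ε, hε, hεU⟩ := hUx
  have key : ∀ N : ℕ, {p : (X × Icc a b) × (X × Icc a b) | p.1.1 = x ∧ p.2.1 = x ∧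
      |(p.1.2 : ℝ) - p.2.2| < ε * (1 / 2) * (N + 1)} ∈ (𝓔.warped U).entourages := by
    intro N
    induction N with
    | zero =>
      refine (𝓔.warped U).subset_mem (𝓔.vertical_mem_warped U) ?_
      rintro ⟨⟨y, s⟩, ⟨z, t⟩⟩ ⟨hy, hz, h⟩
      obtain rfl : y = x := hy
      obtain rfl : z = y := hz
      refine ⟨rfl, hεU ?_⟩
      rw [Subtype.dist_eq, Real.dist_eq]
      simp only [Nat.cast_zero] at h
      linarith
    | succ N ih =>
      refine (𝓔.warped U).subset_mem ((𝓔.warped U).comp_mem (𝓔.vertical_mem_warped U) ih) ?_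
      rintro ⟨⟨y, s⟩, ⟨z, t⟩⟩ ⟨hy, hz, h⟩
      obtain rfl : y = x := hy
      obtain rfl : z = y := hz
      push_cast at h
      have hs := s.2
      have ht := t.2
      obtain ⟨r, hr, hr1, hr2⟩ : ∃ r ∈ Icc a b, |(s : ℝ) - r| < ε ∧
          |r - (t : ℝ)| < ε * (1 / 2) * (N + 1) := by
        have hN : (0 : ℝ) < ε * (1 / 2) * (N + 1) := by positivity
        rcases lt_or_ge |(s : ℝ) - t| (ε * (1 / 2) * (N + 1)) with h1 | h1
        · exact ⟨s, hs, by simpa using hε, h1⟩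
        · rw [abs_lt] at h
          rcases le_total (s : ℝ) t with hst | hst
          · rw [abs_of_nonpos (by linarith)] at h1
            by_cases hc : (s : ℝ) + ε / 2 ≤ t
            · refine ⟨s + ε / 2, ⟨by linarith [hs.1], by linarith [ht.2]⟩, ?_, ?_⟩
              · rw [abs_lt]; constructor <;> linarith
              · rw [abs_lt]; constructor <;> nlinarith
            · refine ⟨t, ht, ?_, by simpa using hN⟩
              rw [abs_lt]; constructor <;> linarith
          · rw [abs_of_nonneg (by linarith)] at h1
            by_cases hc : (t : ℝ) ≤ s - ε / 2
            · refine ⟨s - ε / 2, ⟨by linarith [ht.1], by linarith [hs.2]⟩, ?_, ?_⟩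
              · rw [abs_lt]; constructor <;> linarith
              · rw [abs_lt]; constructor <;> nlinarith
            · refine ⟨t, ht, ?_, by simpa using hN⟩
              rw [abs_lt]; constructor <;> linarith
      refine ⟨(z, ⟨r, hr⟩), ⟨rfl, hεU ?_⟩, rfl, rfl, hr2⟩
      rwa [Subtype.dist_eq, Real.dist_eq]
  obtain ⟨N, hN⟩ := exists_nat_gt ((b - a) / (ε * (1 / 2)))
  refine (𝓔.warped U).subset_mem (key N) ?_
  rintro ⟨⟨y, s⟩, ⟨z, t⟩⟩ ⟨⟨hy, -⟩, ⟨hz, -⟩⟩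
  refine ⟨hy, hz, ?_⟩
  rw [div_lt_iff₀ (by positivity)] at hN
  have hs := s.2
  have ht := t.2
  simp only
  rw [abs_lt]
  constructor <;> nlinarith [hs.1, hs.2, ht.1, ht.2]

lemma isBounded_warped {a b : ℝ} (𝓔 : CoarseStructure X) {U : X → Set (Icc a b × Icc a b)}
    (hU : IsNhdFamily U) {K : Set X} (hK : 𝓔.IsBounded K) :
    (𝓔.warped U).IsBounded (K ×ˢ (univ : Set (Icc a b))) := by
  rcases K.eq_empty_or_nonempty with rfl | ⟨x, hx⟩
  · rw [empty_prod]
    exact (𝓔.warped U).subset_mem (𝓔.warped U).diagonal_mem (by simp)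
  · refine ((isBounded_fibre 𝓔 hU x).penumbra (𝓔.horizontal_mem_warped U hK)).subset ?_
    rintro ⟨y, t⟩ ⟨hy, -⟩
    exact ⟨(x, t), ⟨rfl, mem_univ _⟩, ⟨hy, hx⟩, rfl⟩

/-- The inclusion of `X` as a slice `X × {t}` into a warped product is a coarse map. -/
lemma isCoarse_slice {K : Type*} [TopologicalSpace K] (𝓔 : CoarseStructure X)
    (U : X → Set (K × K)) (t : K) : 𝓔.IsCoarse (𝓔.warped U) (fun x => (x, t)) := by
  constructor
  · intro E hE
    refine (𝓔.warped U).subset_mem (𝓔.horizontal_mem_warped U hE) ?_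
    rintro _ ⟨p, hp, rfl⟩
    exact ⟨hp, rfl⟩
  · intro K hK
    refine ((isControlled_warped_fst 𝓔 U).isBounded_image hK).subset ?_
    intro x hx
    exact ⟨_, hx, rfl⟩

/-- Passing from a refinement to a coarser family is a coarse map on warped products. -/
lemma isCoarse_refinement {a b : ℝ} (𝓔 : CoarseStructure X) {U V : X → Set (Icc a b × Icc a b)}
    (hV : IsNhdFamily V) (h : ∀ x, V x ⊆ U x) : (𝓔.warped V).IsCoarse (𝓔.warped U) id := by
  constructor
  · refine isControlled_generate ?_
    rintro _ (⟨E, hE, rfl⟩ | rfl)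
    · simpa using 𝓔.horizontal_mem_warped U hE
    · refine (𝓔.warped U).subset_mem (𝓔.vertical_mem_warped U) ?_
      rintro _ ⟨p, hp, rfl⟩
      exact ⟨hp.1, h _ hp.2⟩
  · intro K hK
    refine (isBounded_warped 𝓔 hV ((isControlled_warped_fst 𝓔 U).isBounded_image hK)).subset ?_
    intro p hp
    exact ⟨⟨p, hp, rfl⟩, mem_univ _⟩

end CoarseStructure

/-- The family of neighbourhoods `{(s, t) | |s - t| < ε_x}`. -/
def metricFamily (a b : ℝ) (ε : X → ℝ) (x : X) : Set (Icc a b × Icc a b) :=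
  {p | |(p.1 : ℝ) - p.2| < ε x}

lemma isNhdFamily_metricFamily (a b : ℝ) {ε : X → ℝ} (hε : ∀ x, 0 < ε x) :
    CoarseStructure.IsNhdFamily (metricFamily a b ε) := by
  intro x
  rw [nhdsSet_diagonal_eq_uniformity]
  exact Metric.dist_mem_uniformity (hε x)

/-- The interval `I = [-1, 1]`. -/
abbrev I : Type := Icc (-1 : ℝ) 1

/-- The lower endpoint of `I`. -/
def lower : I := ⟨-1, by norm_num, by norm_num⟩

/-- The upper endpoint of `I`. -/
def upper : I := ⟨1, by norm_num, by norm_num⟩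

/-- The subspace `X × ∂I ∪ A × I` of `X × I`. -/
def suspBoundary (A : Set X) : Set (X × I) := {p | p.2 = lower ∨ p.2 = upper ∨ p.1 ∈ A}

/-- The subspace `X × {1} ∪ A × I` of `X × I`. -/
def suspUpper (A : Set X) : Set (X × I) := {p | p.2 = upper ∨ p.1 ∈ A}

variable {M : Type w} [AddCommGroup M]

/-- `ζ ∈ HX_{m+1}((X, A) ×_U (I, ∂I); M)` is the image of `x ∈ HX_m(X, A; M)` under the
suspension homomorphism `σ_*`: there is a refinement of `U` of the form `{|s - t| < ε_x}` such
that `ζ` comes from a class of the warped product with respect to this refinement which is mapped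
to `x` by
`HX_{m+1}((X, A) × (I, ∂I)) → HX_m(X × ∂I ∪ A × I, X × {1} ∪ A × I) ≅ HX_m(X, A)`,
the connecting homomorphism of the triple followed by the inverse of the excision isomorphism
induced by `x ↦ (x, -1)`. -/
def IsSuspension (𝓔 : CoarseStructure X) (A : Set X) (U : X → Set (I × I)) {m : ℕ}
    (x : HX M 𝓔 univ A m) (ζ : HX M (𝓔.warped U) univ (suspBoundary A) (m + 1)) : Prop :=
  ∃ (ε : X → ℝ) (hε : ∀ x, 0 < ε x) (hU : ∀ x, metricFamily (-1) 1 ε x ⊆ U x)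
    (ζ' : HX M (𝓔.warped (metricFamily (-1) 1 ε)) univ (suspBoundary A) (m + 1)),
    connecting (chainsIn M _ univ) (chainsIn M _ (suspBoundary A)) (chainsIn M _ (suspUpper A)) m
        ζ' =
      HX.map (𝓔.isCoarse_slice (metricFamily (-1) 1 ε) lower) (W := suspBoundary A)
        (D := suspUpper A) (fun _ _ => Or.inl rfl) (fun _ h => Or.inr h) m x ∧
    HX.map (𝓔.isCoarse_refinement (isNhdFamily_metricFamily (-1) 1 hε) hU) (fun _ h => h)
      (fun _ h => h) (m + 1) ζ' = ζ

/-- The map `Γ : X × I → X × X`,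
`(x, t) ↦ (H^A(x, t⁻), H^B(x, t⁺))` with `t⁻ = max(-t, 0)` and `t⁺ = max(t, 0)`. -/
def Gamma (HA HB : X × Icc (0 : ℝ) 1 → X) (p : X × I) : X × X :=
  (HA (p.1, projIcc 0 1 zero_le_one (-(p.2 : ℝ))), HB (p.1, projIcc 0 1 zero_le_one (p.2 : ℝ)))

lemma Gamma_mem {𝓔 : CoarseStructure X} {A B : Set X} {HA HB : X × Icc (0 : ℝ) 1 → X}
    (hA : 𝓔.IsDeformation A HA) (hB : 𝓔.IsDeformation B HB) :
    ∀ p ∈ suspBoundary (A ∪ B), Gamma HA HB p ∈ A ×ˢ univ ∪ univ ×ˢ B := by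
  rintro ⟨x, t⟩ (h | h | h | h)
  · left
    refine ⟨?_, mem_univ _⟩
    have ht : projIcc (0 : ℝ) 1 zero_le_one (-(t : ℝ)) = 1 := by
      simp only at h
      rw [h]
      exact projIcc_of_right_le _ (by simp [lower])
    simp only [Gamma, ht]
    exact hA.2.2.1 x
  · right
    refine ⟨mem_univ _, ?_⟩
    have ht : projIcc (0 : ℝ) 1 zero_le_one (t : ℝ) = 1 := by
      simp only at h
      rw [h]
      exact projIcc_of_right_le _ (by simp [upper])
    simp only [Gamma, ht]
    exact hB.2.2.1 x
  · exact Or.inl ⟨hA.2.2.2 x h _, mem_univ _⟩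
  · exact Or.inr ⟨mem_univ _, hB.2.2.2 x h _⟩

variable {M₁ M₂ M₃ : Type*} [AddCommGroup M₁] [AddCommGroup M₂] [AddCommGroup M₃]

/-- `w ∈ HX_k(X, A; M₃)`, where `k = m - n + 1`, is a value of the secondary cap product of
`x ∈ HX_m(X, A ∪ B; M₁)` and `y ∈ HX^n(X, B; M₂)`: for some choice of deformations `H^A`, `H^B`
and of a family `U ∈ 𝒩^σ(X, A ∪ B; I)` supporting `Γ`, it is `(-1)^{m+1}` times the image of
`x ⊗ y` under
`HX_m(X, A ∪ B) ⊗ HX^n(X, B) → HX_{m+1}((X, A ∪ B) ×_U (I, ∂I)) ⊗ HX^n(X, B)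
  → HX_{m+1}((X, A) × (X, B)) ⊗ HX^n(X, B) ≅ HX_{m+1}(X × X, A × X + X × B) ⊗ HX^n(X, B)
  → HX_{m-n+1}(X, A)`,
the composition of suspension, `Γ_*` and the slant product. -/
def IsSecondaryCap (μ : M₁ →+ M₂ →+ M₃) (𝓔 : CoarseStructure X) (A B : Set X) {m n k : ℕ}
    (h : m + 1 = k + n) (x : HX M₁ 𝓔 univ (A ∪ B) m) (y : HXcoh M₂ 𝓔 B n)
    (w : HX M₃ 𝓔 univ A k) : Prop :=
  ∃ (HA HB : X × Icc (0 : ℝ) 1 → X) (hA : 𝓔.IsDeformation A HA) (hB : 𝓔.IsDeformation B HB)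
    (U : X → Set (I × I)) (_ : 𝓔.IsSuspensionFamily (A ∪ B) U)
    (hΓ : (𝓔.warped U).IsCoarse (𝓔.prod 𝓔) (Gamma HA HB))
    (ζ : HX M₁ (𝓔.warped U) univ (suspBoundary (A ∪ B)) (m + 1))
    (θ : HXsum M₁ (𝓔.prod 𝓔) (A ×ˢ univ) (univ ×ˢ B) (m + 1)),
    IsSuspension 𝓔 (A ∪ B) U x ζ ∧
    HXsum.toUnion M₁ (𝓔.prod 𝓔) (A ×ˢ univ) (univ ×ˢ B) (m + 1) θ =
      HX.map hΓ (fun _ _ => mem_univ _) (Gamma_mem hA hB) (m + 1) ζ ∧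
    w = (-1 : ℤ) ^ (m + 1) • slant μ 𝓔 𝓔 A B h θ y

/-! ### The Roe secondary cap product -/

/-- `r_o c`, the linear extension of `(x_0, …, x_m) ↦ (o, x_0, …, x_m)`. -/
def coneRaw {m : ℕ} (o : X) (c : (Fin (m + 1) → X) → M) : (Fin (m + 2) → X) → M :=
  push (fun x => (Fin.cons o x : Fin (m + 2) → X)) c

/-- `(s_o φ)(x_1, …, x_n) = φ(o, x_1, …, x_n)` -/
def contractRaw {n : ℕ} (o : X) (φ : (Fin (n + 2) → X) → M) : (Fin (n + 1) → X) → M :=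
  fun x => φ (Fin.cons o x)

/-- The cap product `c ∩ φ`, the linear extension of
`(m · (x_0, …, x_m)) ∩ φ = (m · φ(x_m, …, x_{m-n})) (x_0, …, x_{m-n})`. -/
def capRaw (μ : M₁ →+ M₂ →+ M₃) {m k n : ℕ} (h : m = k + n) (c : (Fin (m + 1) → X) → M₁)
    (φ : (Fin (n + 1) → X) → M₂) : (Fin (k + 1) → X) → M₃ :=
  push (fun x i => x (frontIdx h i)) (fun x => μ (c x) (φ fun j => x (backIdx h j)))

/-- `r_a (c ∩ φ)` in degree `k = m - n + 1`; this vanishes for `n > m`. -/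
def roeFirst (μ : M₁ →+ M₂ →+ M₃) (a : X) : ∀ {m n k : ℕ}, m + 1 = k + n →
    ((Fin (m + 1) → X) → M₁) → ((Fin (n + 1) → X) → M₂) → (Fin (k + 1) → X) → M₃
  | _, _, 0, _, _, _ => 0
  | m, n, k + 1, h, c, φ => coneRaw a (capRaw μ (show m = k + n by omega) c φ)

/-- `c ∩ (s_b φ)` in degree `k = m - n + 1`; for `n = 0` the cochain `s_b φ` has degree `-1` and
vanishes. -/
def roeSecond (μ : M₁ →+ M₂ →+ M₃) (b : X) : ∀ {m n k : ℕ}, m + 1 = k + n →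
    ((Fin (m + 1) → X) → M₁) → ((Fin (n + 1) → X) → M₂) → (Fin (k + 1) → X) → M₃
  | _, 0, _, _, _, _ => 0
  | m, n + 1, k, h, c, φ => capRaw μ (show m = k + n by omega) c (contractRaw b φ)

/-- The Roe secondary cap product `- r_a (c ∩ φ) - (-1)^m c ∩ (s_b φ)` of a chain `c` and a
cochain `φ`. -/
def roeCapRaw (μ : M₁ →+ M₂ →+ M₃) (a b : X) {m n k : ℕ} (h : m + 1 = k + n)
    (c : (Fin (m + 1) → X) → M₁) (φ : (Fin (n + 1) → X) → M₂) : (Fin (k + 1) → X) → M₃ :=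
  -roeFirst μ a h c φ - (-1 : ℤ) ^ m • roeSecond μ b h c φ

/-- `w ∈ HX_k(X, A; M₃)`, where `k = m - n + 1`, is a value of the Roe secondary cap product of
`x ∈ HX_m(X, A ∪ B; M₁)` and `y ∈ HX^n(X, B; M₂)` with respect to the base-points `a`, `b`: it is
represented by the Roe secondary cap product, which is required to be a coarse cycle, of a coarse
cycle in `CX_m(X, A + B; M₁)` representing `x` and a coarse cocycle in `CX^n(X, B; M₂)`
representing `y`. -/
def IsRoeSecondaryCap (μ : M₁ →+ M₂ →+ M₃) (𝓔 : CoarseStructure X) (A B : Set X) (a b : X)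
    {m n k : ℕ} (h : m + 1 = k + n) (x : HX M₁ 𝓔 univ (A ∪ B) m) (y : HXcoh M₂ 𝓔 B n)
    (w : HX M₃ 𝓔 univ A k) : Prop :=
  ∃ (c : relCycles (chainsIn M₁ 𝓔 univ) (chainsSum M₁ 𝓔 A B) m) (φ : coarseCocycles M₂ 𝓔 B n)
    (d : relCycles (chainsIn M₃ 𝓔 univ) (chainsIn M₃ 𝓔 A) k),
    HXsum.toUnion M₁ 𝓔 A B m (homologyClass _ _ m c) = x ∧
    cohomologyClass M₂ 𝓔 B n φ = y ∧
    d.1.1 = roeCapRaw μ a b h c.1.1 φ.1 ∧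
    w = homologyClass _ _ k d

end Suspension

end

end CoarseCap

/-!
The suspension, the map `Γ` and the slant product are carried out on the level of chains, and the
outcome is the Roe secondary cap product up to a relative boundary.

The (co)homology groups are compared by prism operators. A coarse chain is moved along a homotopy by
breaking the homotopy into steps. Since the neighbourhoods in `X ×_𝒰 I` depend on the point of `X`,
the number of steps must be allowed to vary from vertex to vertex of a simplex, with no bound. A
`SteppedHomotopy` therefore lets each point jump at its own times, and the prism operator has one
simplex for each jump of each vertex; `SteppedHomotopy.boundary_prism` is the homotopy formula.
Instances are maps which are close to the identity, and the `staircase`, in which a point over `x`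
is raised from one height to another in steps shorter than `ε x`. The staircase is controlled
however wildly `ε` varies, because at each time all heights are raised to nearly the same level.

*Excision.* If `(X; A, B)` is excisive, the map which moves a penumbra of `A ∩ B` into `A ∩ B` and
fixes all other points is close to the identity. It moves any given chain in `A ∪ B` into `CX_*(A) +
CX_*(B)`, whence `toUnion_surjective` and `toUnion_injective`: all classes have representatives as
in the definition of the Roe secondary cap product, and the canonical map whose inverse enters the
slant product is an isomorphism.

*Suspension.* The staircase contracts `X × I` to `X × {1}`, so that the connecting homomorphism is
injective (`connecting_injective`). Let `c` be a relative cycle of `(X, A + B)`. It sweeps out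
chains `z₁` and `z₂` over `[-1, 0]` and `[0, 1]` (`exists_sweep`), and the class of `-(z₁ + z₂)` is
mapped to that of the slice `c × {-1}`. Hence it is the only suspension of the class of `c`.

*Lower half.* Over `[-1, 0]`, the second component of `Γ` is the projection to `X`. The slant
product of `Γ_* z₁` with the cocycle `φ` is therefore a finite chain, hence homologous to the cone
with vertex `a ∈ A` over its boundary. At height `0` the map `Γ` is the diagonal, so that this
boundary is `c ∩ φ` up to a chain in `A`. The lower half contributes `r_a (c ∩ φ)` (`slant_lower`).

*Upper half.* Over `[0, 1]`, the first component of `Γ` is the projection to `X`, and the slant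
product of `Γ_* z₂` with any cochain whatsoever is locally finite. As `φ = δ s_b φ`, the boundary
formula for `s_b φ` shows that the upper half contributes `(-1)^m c ∩ s_b φ` (`slant_upper`).

In both halves, finiteness is expressed by giving the factor to which `Γ` does not project the
`indiscrete` coarse structure, whose coarse chains are the finite chains and for which every cochain
is coarse: `Γ` remains a coarse map on that half.

In sum, `Γ_*(σ x) / y` is represented by `- r_a (c ∩ φ) - (-1)^m c ∩ s_b φ` for all representatives,
base-points, deformations and families of neighbourhoods (`exists_slant_eq`). The left-hand side
does not involve the representatives and base-points, nor the right-hand side the deformations and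
the family, and so neither depends on any of the choices. A family for which `Γ` is coarse is built
from those belonging to the two deformations (`exists_family`).
-/

namespace CoarseCap
universe u w
noncomputable section

/-! ### The prism identity -/

section Prism

variable {S : Type*} {Y : Type*}

lemma val_succAbove {n : ℕ} (i : Fin (n + 1)) (j : Fin n) :
    (i.succAbove j : ℕ) = if (j : ℕ) < i then (j : ℕ) else j + 1 := by
  simp only [Fin.succAbove, Fin.lt_def, Fin.val_castSucc]
  split_ifs <;> simp

lemma val_predAbove {n : ℕ} (i : Fin n) (j : Fin (n + 1)) :
    (i.predAbove j : ℕ) = if (i : ℕ) < j then (j : ℕ) - 1 else j := by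
  simp only [Fin.predAbove, Fin.lt_def, Fin.val_castSucc]
  split_ifs <;> simp

/-- The `i`-th simplex `(f x_0, …, f x_i, g x_i, …, g x_m)` of the prism over `x`. -/
def prismTuple {m : ℕ} (f g : S → Y) (i : Fin (m + 1)) (x : Fin (m + 1) → S) : Fin (m + 2) → Y :=
  fun k => if k ≤ i.castSucc then f (x (i.predAbove k)) else g (x (i.predAbove k))

/-- The common face `(f x_0, …, f x_{i-1}, g x_i, …, g x_m)` of two consecutive simplices of the prism
over `x`, from `g ∘ x` for `i = 0` to `f ∘ x` for `i = m + 1`. -/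
def stage {m : ℕ} (f g : S → Y) (i : Fin (m + 2)) (x : Fin (m + 1) → S) : Fin (m + 1) → Y :=
  fun k => if k.castSucc < i then f (x k) else g (x k)

lemma face_castSucc_prismTuple {m : ℕ} (f g : S → Y) (i : Fin (m + 1)) (x : Fin (m + 1) → S) :
    face i.castSucc (prismTuple f g i x) = stage f g i.castSucc x := by
  funext k
  have hidx : i.predAbove (i.castSucc.succAbove k) = k := by
    ext
    simp only [val_predAbove, val_succAbove, Fin.val_castSucc]
    split_ifs <;> omega
  have hcond : i.castSucc.succAbove k ≤ i.castSucc ↔ k.castSucc < i.castSucc := by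
    simp only [Fin.le_def, Fin.lt_def, val_succAbove, Fin.val_castSucc]
    split_ifs <;> omega
  simp only [face, prismTuple, stage, Function.comp, hidx, hcond]

lemma face_succ_prismTuple {m : ℕ} (f g : S → Y) (i : Fin (m + 1)) (x : Fin (m + 1) → S) :
    face i.succ (prismTuple f g i x) = stage f g i.succ x := by
  funext k
  have hidx : i.predAbove (i.succ.succAbove k) = k := by
    ext
    simp only [val_predAbove, val_succAbove, Fin.val_succ]
    split_ifs <;> omega
  have hcond : i.succ.succAbove k ≤ i.castSucc ↔ k.castSucc < i.succ := by
    simp only [Fin.le_def, Fin.lt_def, val_succAbove, Fin.val_castSucc, Fin.val_succ]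
    split_ifs <;> omega
  simp only [face, prismTuple, stage, Function.comp, hidx, hcond]

/-- The faces of a prism simplex other than the two which are stages belong to the prisms over the
faces of `x`. -/
lemma face_prismTuple {m : ℕ} (f g : S → Y) (i : Fin (m + 2)) (j : Fin (m + 1))
    (x : Fin (m + 2) → S) :
    face (i.castSucc.succAbove (i.succAbove j)) (prismTuple f g i x) =
      prismTuple f g (j.predAbove i) (face (i.succAbove j) x) := by
  funext k
  have hidx : i.predAbove ((i.castSucc.succAbove (i.succAbove j)).succAbove k) =
      (i.succAbove j).succAbove ((j.predAbove i).predAbove k) := by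
    ext
    simp only [val_predAbove, val_succAbove, Fin.val_castSucc]
    grind
  have hcond : ((i.castSucc.succAbove (i.succAbove j)).succAbove k ≤ i.castSucc) ↔
      k ≤ (j.predAbove i).castSucc := by
    simp only [Fin.le_def, val_predAbove, val_succAbove, Fin.val_castSucc]
    grind
  simp only [face, prismTuple, Function.comp, hidx, hcond]

/-- The stages telescope. Steps of vertices outside `D` may be left out, since they do not move. -/
lemma sum_stage {G : Type*} [AddCommGroup G] {m : ℕ} (f g : S → Y) (x : Fin (m + 1) → S)
    (D : Fin (m + 1) → Prop) [DecidablePred D] (hD : ∀ i, ¬ D i → f (x i) = g (x i))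
    (Ψ : (Fin (m + 1) → Y) → G) :
    (∑ i : Fin (m + 1), if D i then Ψ (stage f g i.castSucc x) - Ψ (stage f g i.succ x) else 0) =
      Ψ (g ∘ x) - Ψ (f ∘ x) := by
  have h1 : ∀ i : Fin (m + 1), (if D i then
      Ψ (stage f g i.castSucc x) - Ψ (stage f g i.succ x) else 0) =
      Ψ (stage f g i.castSucc x) - Ψ (stage f g i.succ x) := by
    intro i
    split_ifs with h
    · rfl
    · rw [eq_comm, sub_eq_zero]
      congr 1
      funext k
      simp only [stage, Fin.castSucc_lt_castSucc_iff, Fin.castSucc_lt_succ_iff]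
      rcases lt_trichotomy k i with hk | rfl | hk
      · simp [hk, hk.le]
      · simp [hD k h]
      · simp [not_lt.2 hk.le, not_le.2 hk]
  have h0 : stage f g 0 x = g ∘ x := by
    funext k
    simp [stage]
  have hl : stage f g (Fin.last _) x = f ∘ x := by
    funext k
    simp [stage, Fin.castSucc_lt_last]
  rw [Finset.sum_congr rfl fun i _ => h1 i, Finset.sum_sub_distrib, ← h0, ← hl,
    sub_eq_sub_iff_add_eq_add, ← Fin.sum_univ_castSucc (f := fun i => Ψ (stage f g i x)),
    Fin.sum_univ_succ]

/-- The faces of the prism over a simplex, where only the vertices in `D` are moved: the interior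
faces cancel, and the faces belonging to the sides of the prism are singled out. -/
lemma sum_face_prismTuple {G : Type*} [AddCommGroup G] {m : ℕ} (f g : S → Y)
    (x : Fin (m + 1) → S) (D : Fin (m + 1) → Prop) [DecidablePred D]
    (hD : ∀ i, ¬ D i → f (x i) = g (x i)) (Ψ : (Fin (m + 1) → Y) → G) :
    (∑ j : Fin (m + 2), (-1 : ℤ) ^ (j : ℕ) • ∑ i : Fin (m + 1), (-1 : ℤ) ^ (i : ℕ) •
      if D i then Ψ (face j (prismTuple f g i x)) else 0) =
      Ψ (g ∘ x) - Ψ (f ∘ x) + ∑ i : Fin (m + 1), ∑ j : Fin m,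
        (-1 : ℤ) ^ ((i : ℕ) + (i.castSucc.succAbove (i.succAbove j) : ℕ)) • if D i then
        Ψ (face (i.castSucc.succAbove (i.succAbove j)) (prismTuple f g i x)) else 0 := by
  rw [← sum_stage f g x D hD Ψ, ← Finset.sum_add_distrib]
  simp only [Finset.smul_sum, smul_smul, ← pow_add]
  rw [Finset.sum_comm]
  refine Finset.sum_congr rfl fun i _ => ?_
  rw [Fin.sum_univ_succAbove _ i.castSucc, Fin.sum_univ_succAbove _ i, ← add_assoc]
  congr 1
  · rw [Fin.succAbove_castSucc_self, face_castSucc_prismTuple, face_succ_prismTuple]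
    split_ifs
    · rw [Fin.val_castSucc, Even.neg_one_pow ⟨_, rfl⟩, Fin.val_succ,
        show (i : ℕ) + 1 + i = (i + i) + 1 by ring, pow_succ, Even.neg_one_pow ⟨_, rfl⟩]
      simp [sub_eq_add_neg]
    · simp
  · exact Finset.sum_congr rfl fun j _ => by rw [add_comm (i : ℕ)]

/-- The prism identity in positive degrees: the sides of the prism over a simplex are the prisms
over its faces. -/
lemma sum_face_prismTuple_add {G : Type*} [AddCommGroup G] {m : ℕ} (f g : S → Y)
    (x : Fin (m + 2) → S) (D : Fin (m + 2) → Prop) [DecidablePred D]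
    (hD : ∀ i, ¬ D i → f (x i) = g (x i)) (Ψ : (Fin (m + 2) → Y) → G) :
    (∑ j : Fin (m + 3), (-1 : ℤ) ^ (j : ℕ) • ∑ i : Fin (m + 2), (-1 : ℤ) ^ (i : ℕ) •
      if D i then Ψ (face j (prismTuple f g i x)) else 0) +
    (∑ j : Fin (m + 2), (-1 : ℤ) ^ (j : ℕ) • ∑ i : Fin (m + 1), (-1 : ℤ) ^ (i : ℕ) •
      if D (j.succAbove i) then Ψ (prismTuple f g i (face j x)) else 0) =
      Ψ (g ∘ x) - Ψ (f ∘ x) := by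
  rw [sum_face_prismTuple f g x D hD, add_assoc, add_eq_left, add_eq_zero_iff_eq_neg]
  simp only [Finset.smul_sum, smul_smul, ← pow_add]
  rw [← Finset.sum_neg_distrib]
  simp only [← Finset.sum_neg_distrib]
  rw [← Finset.sum_product', ← Finset.sum_product']
  refine Finset.sum_bij' (fun p _ => (p.1.succAbove p.2, p.2.predAbove p.1))
    (fun p _ => (p.1.succAbove p.2, p.2.predAbove p.1)) (by simp) (by simp) ?_ ?_ ?_
  · rintro ⟨i, j⟩ -
    simp [Fin.succAbove_succAbove_predAbove, Fin.predAbove_predAbove_succAbove]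
  · rintro ⟨i, j⟩ -
    simp [Fin.succAbove_succAbove_predAbove, Fin.predAbove_predAbove_succAbove]
  · rintro ⟨i, j⟩ -
    dsimp only
    rw [Fin.succAbove_succAbove_predAbove, face_prismTuple, ← neg_smul]
    congr 1
    have hi := i.2
    have hj := j.2
    have hpar : ((i.succAbove j : ℕ) + (j.predAbove i : ℕ) + 1 =
        (i : ℕ) + (i.castSucc.succAbove (i.succAbove j) : ℕ)) ∨
        ((i.succAbove j : ℕ) + (j.predAbove i : ℕ) =
        (i : ℕ) + (i.castSucc.succAbove (i.succAbove j) : ℕ) + 1) := by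
      simp only [val_predAbove, val_succAbove, Fin.val_castSucc]
      grind
    rcases hpar with h | h
    · rw [← h, pow_succ]; ring
    · rw [h, pow_succ]; ring

end Prism

/-! ### Locally finite chains -/

section Local

variable {S : Type*} {Y : Type*} {M N : Type*} [AddCommGroup M] [AddCommGroup N]

lemma IsCoarseChain.mono {𝓔 : CoarseStructure S} {m : ℕ} {c d : (Fin (m + 1) → S) → M}
    (hc : IsCoarseChain 𝓔 c) (h : ∀ x, d x ≠ 0 → c x ≠ 0) : IsCoarseChain 𝓔 d := by
  obtain ⟨⟨E, hE, hcE⟩, hfin⟩ := hc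
  exact ⟨⟨E, hE, fun x hx => hcE (h x hx)⟩, fun K hK => (hfin K hK).subset
    fun x hx => ⟨h x hx.1, hx.2⟩⟩

/-- Only finitely many simplices of a coarse chain have a vertex in a given bounded set. -/
lemma IsCoarseChain.finite_touching {𝓔 : CoarseStructure S} {m : ℕ} {c : (Fin (m + 1) → S) → M}
    (hc : IsCoarseChain 𝓔 c) {K : Set S} (hK : 𝓔.IsBounded K) :
    {x | c x ≠ 0 ∧ ∃ i, x i ∈ K}.Finite := by
  obtain ⟨E, hE, hcE⟩ := subset_penumbra_iff.1 hc.1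
  refine (hc.2 {x | ∀ i, x i ∈ penumbra E K} (CoarseStructure.isBounded_power_iff.2 fun i =>
    (hK.penumbra hE).subset ?_)).subset ?_
  · rintro _ ⟨x, hx, rfl⟩
    exact hx i
  · rintro x ⟨hx, j, hj⟩
    exact ⟨hx, fun i => ⟨x j, hj, hcE x hx i j⟩⟩

lemma FiniteFibres.of_finite {α β : Type*} {f : α → β} {c : α → M}
    (h : (Function.support c).Finite) : FiniteFibres f c := fun _ => h.subset inter_subset_right

open Classical in
/-- The formal sum `r · a`. -/
def single {α : Type*} (a : α) (r : M) : α → M := fun b => if b = a then r else 0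

lemma single_apply_ne {α : Type*} {a b : α} {r : M} (h : single a r b ≠ 0) : b = a := by
  by_contra hne
  exact h (if_neg hne)

@[simp] lemma single_self {α : Type*} (a : α) (r : M) : single a r a = r := if_pos rfl

lemma single_of_ne {α : Type*} {a b : α} (h : b ≠ a) (r : M) : single a r b = 0 := if_neg h

lemma finite_support_single {α : Type*} (a : α) (r : M) :
    (Function.support (single a r)).Finite :=
  (finite_singleton a).subset fun _ h => single_apply_ne h

lemma finite_support_sum {ι α : Type*} (s : Finset ι) {c : ι → α → M}
    (h : ∀ i ∈ s, (Function.support (c i)).Finite) :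
    (Function.support (∑ i ∈ s, c i)).Finite := by
  refine (s.finite_toSet.biUnion h).subset fun x hx => ?_
  rw [Function.mem_support, Finset.sum_apply] at hx
  obtain ⟨i, hi, hne⟩ := Finset.exists_ne_zero_of_sum_ne_zero hx
  exact mem_biUnion hi hne

lemma push_single {α β : Type*} (f : α → β) (a : α) (r : M) :
    push f (single a r) = single (f a) r := by
  classical
  funext b
  rw [push_eq_sum {a} (fun x hx => by simpa using single_apply_ne hx.2), Finset.sum_singleton,
    single_self]
  split_ifs with h
  · rw [← h, single_self]
  · rw [single_of_ne (Ne.symm h)]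

lemma push_sum_single {ι α β : Type*} (f : α → β) (s : Finset ι) (a : ι → α) (r : ι → M) :
    push f (∑ i ∈ s, single (a i) (r i)) = ∑ i ∈ s, single (f (a i)) (r i) := by
  rw [push_sum _ fun i _ => .of_finite (finite_support_single _ _)]
  exact Finset.sum_congr rfl fun i _ => push_single f _ _

lemma push_congr {α β : Type*} {f g : α → β} {c : α → M} (h : ∀ a, c a ≠ 0 → f a = g a) :
    push f c = push g c := by
  funext b
  refine finsum_congr fun a => ?_
  by_cases ha : c a = 0
  · simp [ha]
  · simp only [mem_preimage, h a ha]

@[simp] lemma push_id {α : Type*} (c : α → M) : push id c = c := by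
  funext b
  simp [push]

/-- A homomorphism on coarse chains which is local, in the sense that the coefficient at any simplex
depends only on simplices which meet a certain bounded set, vanishes if it does so on single
simplices. -/
lemma eq_zero_of_local {𝓔 : CoarseStructure S} {𝓕 : CoarseStructure Y} {m p : ℕ}
    (F : coarseChains M 𝓔 m →+ coarseChains N 𝓕 p) (K : (Fin (p + 1) → Y) → Set S)
    (hK : ∀ y, 𝓔.IsBounded (K y))
    (hF : ∀ c y, (F c).1 y ≠ 0 → ∃ x, c.1 x ≠ 0 ∧ ∃ i, x i ∈ K y)
    (h : ∀ (x : Fin (m + 1) → S) (r : M) (hr : IsCoarseChain 𝓔 (single x r)),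
      F ⟨single x r, hr⟩ = 0) : F = 0 := by
  classical
  ext c y
  by_contra hne
  have hfin := c.2.finite_touching (hK y)
  set W := hfin.toFinset with hW
  have hs : ∀ x, IsCoarseChain 𝓔 (single x (c.1 x)) := fun x => c.2.mono fun x' hx' => by
    obtain rfl := single_apply_ne hx'
    simpa using hx'
  set d : coarseChains M 𝓔 m := c - ∑ x ∈ W, ⟨single x (c.1 x), hs x⟩ with hd
  have hdF : F d = F c := by
    rw [hd, map_sub, map_sum, Finset.sum_eq_zero fun x _ => h x _ (hs x), sub_zero]
  obtain ⟨x, hx, i, hi⟩ := hF d y (by rw [hdF]; exact hne)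
  have hdx : d.1 x = c.1 x - ∑ x' ∈ W, single x' (c.1 x') x := by
    rw [hd, AddSubgroup.coe_sub, Pi.sub_apply, AddSubgroup.val_finsetSum, Finset.sum_apply]
  by_cases hcx : c.1 x = 0
  · refine hx ?_
    rw [hdx, hcx, Finset.sum_eq_zero, sub_zero]
    intro x' _
    by_contra hx'
    obtain rfl := single_apply_ne hx'
    exact hx' (by simp [hcx])
  · have hxW : x ∈ W := by
      rw [hW, Finite.mem_toFinset]
      exact ⟨hcx, i, hi⟩
    refine hx ?_
    rw [hdx, Finset.sum_eq_single_of_mem x hxW fun x' _ hne => single_of_ne hne.symm _,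
      single_self, sub_self]

lemma exists_face_of_boundary_ne_zero {𝓔 : CoarseStructure S} {m : ℕ}
    {c : coarseChains M 𝓔 (m + 1)} {y : Fin (m + 1) → S} (h : (boundary 𝓔 m c).1 y ≠ 0) :
    ∃ x j, c.1 x ≠ 0 ∧ face j x = y := by
  rw [boundary_coe, Finset.sum_apply] at h
  obtain ⟨j, -, hj⟩ := Finset.exists_ne_zero_of_sum_ne_zero h
  obtain ⟨x, hx, hcx⟩ := exists_of_push_ne_zero (fun h' => hj (by simp [h']) :
    push (face j) c.1 y ≠ 0)
  exact ⟨x, j, hcx, hx⟩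

lemma boundary_mem_chainsIn {𝓔 : CoarseStructure S} {A : Set S} {m : ℕ}
    {c : coarseChains M 𝓔 (m + 1)} (hc : c ∈ chainsIn M 𝓔 A (m + 1)) :
    boundary 𝓔 m c ∈ chainsIn M 𝓔 A m := by
  intro y hy i
  obtain ⟨x, j, hx, rfl⟩ := exists_face_of_boundary_ne_zero hy
  exact hc x hx _

end Local

/-! ### Stepped homotopies and their prism operators -/

section SteppedHomotopy

variable {S : Type*} {Y : Type*} {T : Type*} {M : Type*} [AddCommGroup M]

/-- A homotopy from `f` to `g` in finitely many steps for each point: at each time `q ∈ jumps s`, the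
image of `s` jumps from `before q s` to `after q s`. The times of the jumps and their number may
depend on `s`, but at all times the images of close points are uniformly close. The order of the times
is encoded in `telescope`: for finitely many points, the jumps at the successive times `t l` lead from
`f` to `g` through the positions `σ l`. -/
structure SteppedHomotopy (𝓔 : CoarseStructure S) (𝓕 : CoarseStructure Y) (f g : S → Y)
    (T : Type*) where
  before : T → S → Y
  after : T → S → Y
  jumps : S → Finset T
  eq_of_notMem : ∀ q s, q ∉ jumps s → before q s = after q s
  controlled : ∀ E ∈ 𝓔.entourages, ∃ F ∈ 𝓕.entourages, ∀ p ∈ E, ∀ q,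
    (before q p.1, before q p.2) ∈ F ∧ (before q p.1, after q p.2) ∈ F ∧
    (after q p.1, before q p.2) ∈ F ∧ (after q p.1, after q p.2) ∈ F
  proper : ∀ K, 𝓕.IsBounded K →
    𝓔.IsBounded {s | f s ∈ K ∨ g s ∈ K ∨ ∃ q, before q s ∈ K ∨ after q s ∈ K}
  telescope : ∀ {m : ℕ} (x : Fin (m + 1) → S), ∃ (L : ℕ) (t : ℕ → T) (σ : ℕ → Fin (m + 1) → Y),
    InjOn t (Iio L) ∧ (∀ i, ∀ q ∈ jumps (x i), ∃ l < L, t l = q) ∧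
    (∀ l < L, before (t l) ∘ x = σ l ∧ after (t l) ∘ x = σ (l + 1)) ∧ σ 0 = f ∘ x ∧ σ L = g ∘ x

namespace SteppedHomotopy

variable {𝓔 : CoarseStructure S} {𝓕 : CoarseStructure Y} {f g : S → Y}
  (H : SteppedHomotopy 𝓔 𝓕 f g T)

/-- The simplex of the prism over `x` in which the `i`-th vertex jumps at the time `q`. -/
def tuple {m : ℕ} (i : Fin (m + 1)) (p : (Fin (m + 1) → S) × T) : Fin (m + 2) → Y :=
  prismTuple (H.before p.2) (H.after p.2) i p.1

open Classical in
/-- The chain `c`, with each simplex repeated for each jump of its `i`-th vertex. -/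
def spread {m : ℕ} (i : Fin (m + 1)) (c : (Fin (m + 1) → S) → M) (p : (Fin (m + 1) → S) × T) : M :=
  if p.2 ∈ H.jumps (p.1 i) then c p.1 else 0

lemma spread_ne_zero {m : ℕ} {i : Fin (m + 1)} {c : (Fin (m + 1) → S) → M}
    {p : (Fin (m + 1) → S) × T} (h : H.spread i c p ≠ 0) : p.2 ∈ H.jumps (p.1 i) ∧ c p.1 ≠ 0 := by
  unfold spread at h
  split_ifs at h with h1
  · exact ⟨h1, h⟩
  · exact (h rfl).elim

lemma tuple_mem {m : ℕ} (i : Fin (m + 1)) (p : (Fin (m + 1) → S) × T) (k : Fin (m + 2)) :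
    ∃ l, H.tuple i p k = H.before p.2 (p.1 l) ∨ H.tuple i p k = H.after p.2 (p.1 l) := by
  refine ⟨i.predAbove k, ?_⟩
  unfold tuple prismTuple
  split_ifs
  · exact Or.inl rfl
  · exact Or.inr rfl

lemma proper_tuple {m : ℕ} {c : (Fin (m + 1) → S) → M} (hc : IsCoarseChain 𝓔 c) (i : Fin (m + 1))
    (K : Set (Fin (m + 2) → Y)) (hK : (𝓕.power (Fin (m + 2))).IsBounded K) :
    (H.tuple i ⁻¹' K ∩ Function.support (H.spread i c)).Finite := by
  have hfin := hc.finite_touching (H.proper _ (CoarseStructure.isBounded_power_iff.1 hK 0))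
  refine (hfin.biUnion (t := fun x => (fun q => (x, q)) '' (H.jumps (x i) : Set T))
    fun x _ => (Finset.finite_toSet _).image _).subset ?_
  rintro ⟨x, q⟩ ⟨hp, hs⟩
  obtain ⟨hq, hcx⟩ := H.spread_ne_zero hs
  refine mem_biUnion ⟨hcx, ?_⟩ ⟨q, hq, rfl⟩
  obtain ⟨l, hl⟩ := H.tuple_mem i (x, q) 0
  exact ⟨l, Or.inr (Or.inr ⟨q, hl.imp (fun h => ⟨_, hp, h⟩) (fun h => ⟨_, hp, h⟩)⟩)⟩

lemma finiteFibres_tuple {m : ℕ} {c : (Fin (m + 1) → S) → M} (hc : IsCoarseChain 𝓔 c)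
    (i : Fin (m + 1)) : FiniteFibres (H.tuple i) (H.spread i c) :=
  finiteFibres_of_proper (H.proper_tuple hc i)

lemma isCoarseChain_tuple {m : ℕ} {c : (Fin (m + 1) → S) → M} (hc : IsCoarseChain 𝓔 c)
    (i : Fin (m + 1)) : IsCoarseChain 𝓕 (push (H.tuple i) (H.spread i c)) := by
  refine ⟨subset_penumbra_iff.2 ?_, fun K hK => ?_⟩
  · obtain ⟨E, hE, hcE⟩ := subset_penumbra_iff.1 hc.1
    obtain ⟨F, hF, hEF⟩ := H.controlled E hE
    refine ⟨F, hF, fun y hy k k' => ?_⟩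
    obtain ⟨p, rfl, hp⟩ := exists_of_push_ne_zero hy
    obtain ⟨l, hl⟩ := H.tuple_mem i p k
    obtain ⟨l', hl'⟩ := H.tuple_mem i p k'
    obtain ⟨h1, h2, h3, h4⟩ := hEF _ (hcE p.1 (H.spread_ne_zero hp).2 l l') p.2
    rcases hl with hl | hl <;> rcases hl' with hl' | hl' <;> rw [hl, hl'] <;> assumption
  · refine ((H.proper_tuple hc i K hK).image (H.tuple i)).subset ?_
    rintro y ⟨hy, hyK⟩
    obtain ⟨p, rfl, hp⟩ := exists_of_push_ne_zero hy
    exact ⟨p, ⟨hyK, hp⟩, rfl⟩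

/-- The prism operator `P` of a stepped homotopy. -/
def prism (m : ℕ) : coarseChains M 𝓔 m →+ coarseChains M 𝓕 (m + 1) :=
  AddMonoidHom.mk' (fun c => ⟨∑ i : Fin (m + 1), (-1 : ℤ) ^ (i : ℕ) •
      push (H.tuple i) (H.spread i c.1), sum_mem fun i _ => zsmul_mem
        (show _ ∈ coarseChains M 𝓕 (m + 1) from H.isCoarseChain_tuple c.2 i) _⟩) (fun c d => by
    ext1
    simp only [AddSubgroup.coe_add]
    rw [← Finset.sum_add_distrib]
    refine Finset.sum_congr rfl fun i _ => ?_
    rw [← smul_add, ← push_add (H.finiteFibres_tuple c.2 i) (H.finiteFibres_tuple d.2 i)]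
    congr 2
    funext p
    simp only [spread, Pi.add_apply]
    split_ifs <;> simp)

lemma prism_coe {m : ℕ} (c : coarseChains M 𝓔 m) : (H.prism m c).1 =
    ∑ i : Fin (m + 1), (-1 : ℤ) ^ (i : ℕ) • push (H.tuple i) (H.spread i c.1) := rfl

lemma exists_of_prism_ne_zero {m : ℕ} {c : coarseChains M 𝓔 m} {y : Fin (m + 2) → Y}
    (h : (H.prism m c).1 y ≠ 0) : ∃ x, c.1 x ≠ 0 ∧ ∃ i, ∃ q ∈ H.jumps (x i), ∀ k, ∃ l,
      y k = H.before q (x l) ∨ y k = H.after q (x l) := by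
  rw [prism_coe, Finset.sum_apply] at h
  obtain ⟨i, -, hi⟩ := Finset.exists_ne_zero_of_sum_ne_zero h
  obtain ⟨p, rfl, hp⟩ := exists_of_push_ne_zero (fun h' => hi (by simp [h']) :
    push (H.tuple i) (H.spread i c.1) y ≠ 0)
  obtain ⟨h1, h2⟩ := H.spread_ne_zero hp
  exact ⟨p.1, h2, i, p.2, h1, H.tuple_mem i p⟩

lemma prism_mem_chainsIn {m : ℕ} {c : coarseChains M 𝓔 m} {C : Set S} {D : Set Y}
    (hc : c ∈ chainsIn M 𝓔 C m) (h : ∀ s₀ ∈ C, ∀ q ∈ H.jumps s₀, ∀ s ∈ C,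
      H.before q s ∈ D ∧ H.after q s ∈ D) : H.prism m c ∈ chainsIn M 𝓕 D (m + 1) := by
  intro y hy k
  obtain ⟨x, hx, i, q, hq, hk⟩ := H.exists_of_prism_ne_zero hy
  obtain ⟨l, hl | hl⟩ := hk k
  · rw [hl]
    exact (h _ (hc x hx i) q hq _ (hc x hx l)).1
  · rw [hl]
    exact (h _ (hc x hx i) q hq _ (hc x hx l)).2

lemma prism_single {m : ℕ} (x : Fin (m + 1) → S) (r : M) (hr : IsCoarseChain 𝓔 (single x r)) :
    (H.prism m ⟨single x r, hr⟩).1 = ∑ i : Fin (m + 1), (-1 : ℤ) ^ (i : ℕ) •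
      ∑ q ∈ H.jumps (x i), single (prismTuple (H.before q) (H.after q) i x) r := by
  classical
  rw [prism_coe]
  refine Finset.sum_congr rfl fun i _ => ?_
  have hs : H.spread i (single x r) = ∑ q ∈ H.jumps (x i), single (x, q) r := by
    funext p
    rw [Finset.sum_apply]
    by_cases hp : p.2 ∈ H.jumps (x i) ∧ p.1 = x
    · obtain ⟨p1, p2⟩ := p
      obtain ⟨hp1, rfl⟩ := hp
      rw [Finset.sum_eq_single_of_mem p2 hp1 fun q _ hq => single_of_ne (by simp [hq.symm]) _]
      simp [spread, hp1]
    · rw [Finset.sum_eq_zero]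
      · by_contra hne
        obtain ⟨h1, h2⟩ := H.spread_ne_zero hne
        have h3 := single_apply_ne h2
        exact hp ⟨h3 ▸ h1, h3⟩
      · intro q hq
        by_contra hne
        have := single_apply_ne hne
        exact hp (by rw [this]; exact ⟨hq, rfl⟩)
  rw [hs, push_sum_single]
  rfl

lemma push_prism_single {β : Type*} {m : ℕ} (F : (Fin (m + 2) → Y) → β) (x : Fin (m + 1) → S)
    (r : M) (hr : IsCoarseChain 𝓔 (single x r)) :
    push F (H.prism m ⟨single x r, hr⟩).1 = ∑ i : Fin (m + 1), (-1 : ℤ) ^ (i : ℕ) •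
      ∑ q ∈ H.jumps (x i), single (F (prismTuple (H.before q) (H.after q) i x)) r := by
  have hfin : ∀ i : Fin (m + 1), FiniteFibres F
      (∑ q ∈ H.jumps (x i), single (prismTuple (H.before q) (H.after q) i x) r) := fun i =>
    .of_finite (finite_support_sum _ fun _ _ => finite_support_single _ _)
  rw [prism_single, push_sum _ fun i _ => (hfin i).zsmul _]
  exact Finset.sum_congr rfl fun i _ => by rw [push_zsmul (hfin i), push_sum_single]

open Classical in
/-- The total displacement at the jumps of the vertices of a simplex. -/
lemma sum_displacement {G : Type*} [AddCommGroup G] {m : ℕ} (x : Fin (m + 1) → S) :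
    ∃ W : Finset T, (∀ i, H.jumps (x i) ⊆ W) ∧ ∀ Ψ : (Fin (m + 1) → Y) → G,
      ∑ q ∈ W, (Ψ (H.after q ∘ x) - Ψ (H.before q ∘ x)) = Ψ (g ∘ x) - Ψ (f ∘ x) := by
  obtain ⟨L, t, σ, hinj, hcov, hstep, h0, hL⟩ := H.telescope x
  refine ⟨(Finset.range L).image t, fun i q hq => ?_, fun Ψ => ?_⟩
  · obtain ⟨l, hl, rfl⟩ := hcov i q hq
    exact Finset.mem_image_of_mem _ (Finset.mem_range.2 hl)
  · rw [Finset.sum_image (by simpa using hinj), ← h0, ← hL,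
      ← Finset.sum_range_sub (fun l => Ψ (σ l))]
    refine Finset.sum_congr rfl fun l hl => ?_
    obtain ⟨h1, h2⟩ := hstep l (Finset.mem_range.1 hl)
    rw [h1, h2]

lemma sum_jumps_eq {G : Type*} [AddCommGroup G] [DecidableEq T] {W : Finset T} {s : S}
    (h : H.jumps s ⊆ W) (Ψ : T → G) :
    ∑ q ∈ H.jumps s, Ψ q = ∑ q ∈ W, if q ∈ H.jumps s then Ψ q else 0 := by
  rw [← Finset.sum_filter, Finset.filter_mem_eq_inter, Finset.inter_eq_right.2 h]

/-- A simplex `y` of `∂ P c` arises from a simplex of `c` which has a vertex whose path passes through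
`y 0`. By properness of the homotopy, there are only finitely many such simplices. -/
lemma mem_range_of_boundary_prism {m : ℕ} {c : coarseChains M 𝓔 m} {y : Fin (m + 1) → Y}
    (h : (boundary 𝓕 m (H.prism m c)).1 y ≠ 0) : ∃ x, c.1 x ≠ 0 ∧ ∃ i, x i ∈ {s | f s ∈ ({y 0} :
      Set Y) ∨ g s ∈ ({y 0} : Set Y) ∨ ∃ q, H.before q s ∈ ({y 0} : Set Y) ∨
      H.after q s ∈ ({y 0} : Set Y)} := by
  obtain ⟨z, j, hz, rfl⟩ := exists_face_of_boundary_ne_zero h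
  obtain ⟨x, hx, i, q, -, hk⟩ := H.exists_of_prism_ne_zero hz
  obtain ⟨l, hl⟩ := hk (j.succAbove 0)
  exact ⟨x, hx, l, Or.inr (Or.inr ⟨q, hl.imp Eq.symm Eq.symm⟩)⟩

lemma mem_range_of_chainMap {h : S → Y} (hh : 𝓔.IsCoarse 𝓕 h) {m : ℕ} {c : coarseChains M 𝓔 m}
    {y : Fin (m + 1) → Y} (hy : (chainMap hh m c).1 y ≠ 0) : ∃ x, c.1 x ≠ 0 ∧ h (x 0) = y 0 := by
  obtain ⟨x, rfl, hx⟩ := exists_of_push_ne_zero hy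
  exact ⟨x, hx, rfl⟩

lemma chainMap_single {h : S → Y} (hh : 𝓔.IsCoarse 𝓕 h) {m : ℕ} (x : Fin (m + 1) → S) (r : M)
    (hr : IsCoarseChain 𝓔 (single x r)) : (chainMap hh m ⟨single x r, hr⟩).1 =
      single (h ∘ x) r := push_single _ _ _

/-- The homotopy formula in degree zero. -/
theorem boundary_prism_zero (hf : 𝓔.IsCoarse 𝓕 f) (hg : 𝓔.IsCoarse 𝓕 g)
    (c : coarseChains M 𝓔 0) :
    boundary 𝓕 0 (H.prism 0 c) = chainMap hg 0 c - chainMap hf 0 c := by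
  classical
  suffices h : (boundary 𝓕 0).comp (H.prism 0) - (chainMap hg 0 - chainMap hf 0) =
      (0 : coarseChains M 𝓔 0 →+ coarseChains M 𝓕 0) from sub_eq_zero.1 (DFunLike.congr_fun h c)
  refine eq_zero_of_local _ _ (fun y => H.proper _ (isBounded_singleton (y 0))) ?_ ?_
  · intro c y hy
    by_contra hcon
    refine hy ?_
    have h1 : (boundary 𝓕 0 (H.prism 0 c)).1 y = 0 := by
      by_contra hne
      exact hcon (H.mem_range_of_boundary_prism hne)
    have h2 : (chainMap hf 0 c).1 y = 0 := by
      by_contra hne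
      obtain ⟨x, hx, hxy⟩ := mem_range_of_chainMap hf hne
      exact hcon ⟨x, hx, 0, Or.inl hxy⟩
    have h3 : (chainMap hg 0 c).1 y = 0 := by
      by_contra hne
      obtain ⟨x, hx, hxy⟩ := mem_range_of_chainMap hg hne
      exact hcon ⟨x, hx, 0, Or.inr (Or.inl hxy)⟩
    simp [h1, h2, h3]
  · intro x r hr
    rw [AddMonoidHom.sub_apply, AddMonoidHom.sub_apply, AddMonoidHom.comp_apply, sub_eq_zero]
    ext1
    obtain ⟨W, hW, htel⟩ := H.sum_displacement (G := (Fin 1 → Y) → M) x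
    rw [boundary_coe, AddSubgroup.coe_sub, chainMap_single, chainMap_single,
      ← htel fun y => single y r]
    simp only [push_prism_single, H.sum_jumps_eq (hW _)]
    rw [Finset.sum_congr rfl fun q _ => ((sum_face_prismTuple (H.before q) (H.after q) x
      (fun i => q ∈ H.jumps (x i)) (fun i hi => H.eq_of_notMem q _ hi)
      (fun y => single y r)).trans (by simp)).symm]
    simp only [Finset.smul_sum]
    rw [Finset.sum_comm (s := W)]
    refine Finset.sum_congr rfl fun j _ => ?_
    rw [Finset.sum_comm (s := W)]

/-- The homotopy formula in positive degrees. -/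
theorem boundary_prism_succ (hf : 𝓔.IsCoarse 𝓕 f) (hg : 𝓔.IsCoarse 𝓕 g) (m : ℕ)
    (c : coarseChains M 𝓔 (m + 1)) :
    boundary 𝓕 (m + 1) (H.prism (m + 1) c) + H.prism m (boundary 𝓔 m c) =
      chainMap hg (m + 1) c - chainMap hf (m + 1) c := by
  classical
  suffices h : (boundary 𝓕 (m + 1)).comp (H.prism (m + 1)) + (H.prism m).comp (boundary 𝓔 m) -
      (chainMap hg (m + 1) - chainMap hf (m + 1)) =
      (0 : coarseChains M 𝓔 (m + 1) →+ coarseChains M 𝓕 (m + 1)) from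
    sub_eq_zero.1 (DFunLike.congr_fun h c)
  refine eq_zero_of_local _ _ (fun y => H.proper _ (isBounded_singleton (y 0))) ?_ ?_
  · intro c y hy
    by_contra hcon
    refine hy ?_
    have h1 : (boundary 𝓕 (m + 1) (H.prism (m + 1) c)).1 y = 0 := by
      by_contra hne
      exact hcon (H.mem_range_of_boundary_prism hne)
    have h2 : (chainMap hf (m + 1) c).1 y = 0 := by
      by_contra hne
      obtain ⟨x, hx, hxy⟩ := mem_range_of_chainMap hf hne
      exact hcon ⟨x, hx, 0, Or.inl hxy⟩
    have h3 : (chainMap hg (m + 1) c).1 y = 0 := by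
      by_contra hne
      obtain ⟨x, hx, hxy⟩ := mem_range_of_chainMap hg hne
      exact hcon ⟨x, hx, 0, Or.inr (Or.inl hxy)⟩
    have h4 : (H.prism m (boundary 𝓔 m c)).1 y = 0 := by
      by_contra hne
      obtain ⟨z, hz, i, q, -, hk⟩ := H.exists_of_prism_ne_zero hne
      obtain ⟨x, j, hx, rfl⟩ := exists_face_of_boundary_ne_zero hz
      obtain ⟨l, hl⟩ := hk 0
      exact hcon ⟨x, hx, _, Or.inr (Or.inr ⟨q, hl.imp Eq.symm Eq.symm⟩)⟩
    simp [h1, h2, h3, h4]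
  · intro x r hr
    rw [AddMonoidHom.sub_apply, AddMonoidHom.sub_apply, AddMonoidHom.add_apply,
      AddMonoidHom.comp_apply, AddMonoidHom.comp_apply, sub_eq_zero]
    have hfr : ∀ j : Fin (m + 2), IsCoarseChain 𝓔 (single (face j x) r) := fun j => by
      rw [← push_single]
      exact isCoarseChain_face hr j
    have hbd : boundary 𝓔 m ⟨single x r, hr⟩ =
        ∑ j : Fin (m + 2), (-1 : ℤ) ^ (j : ℕ) • ⟨single (face j x) r, hfr j⟩ := by
      ext1
      rw [boundary_coe, AddSubgroup.val_finsetSum]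
      exact Finset.sum_congr rfl fun j _ => by rw [push_single]; rfl
    rw [hbd, map_sum]
    simp only [map_zsmul]
    ext1
    obtain ⟨W, hW, htel⟩ := H.sum_displacement (G := (Fin (m + 2) → Y) → M) x
    have hW' : ∀ (j : Fin (m + 2)) (i : Fin (m + 1)), H.jumps (face j x i) ⊆ W := fun j i => hW _
    rw [AddSubgroup.coe_add, boundary_coe, AddSubgroup.coe_sub, chainMap_single, chainMap_single,
      ← htel fun y => single y r, AddSubgroup.val_finsetSum]
    simp only [push_prism_single]
    simp only [AddSubgroup.coe_zsmul, prism_single, H.sum_jumps_eq (hW _),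
      H.sum_jumps_eq (hW' _ _)]
    rw [Finset.sum_congr rfl fun q _ => (sum_face_prismTuple_add (H.before q) (H.after q) x
      (fun i => q ∈ H.jumps (x i)) (fun i hi => H.eq_of_notMem q _ hi)
      (fun y => single y r)).symm, Finset.sum_add_distrib]
    simp only [Finset.smul_sum]
    congr 1
    · rw [Finset.sum_comm (s := W)]
      refine Finset.sum_congr rfl fun j _ => ?_
      rw [Finset.sum_comm (s := W)]
    · rw [Finset.sum_comm (s := W)]
      refine Finset.sum_congr rfl fun j _ => ?_
      rw [Finset.sum_comm (s := W)]
      rfl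

/-- The part of the homotopy formula which involves the boundary: `P ∘ ∂`, and zero in degree
zero. -/
def prismBoundary : ∀ m, coarseChains M 𝓔 m →+ coarseChains M 𝓕 m
  | 0 => 0
  | m + 1 => (H.prism m).comp (boundary 𝓔 m)

/-- The homotopy formula. -/
theorem boundary_prism (hf : 𝓔.IsCoarse 𝓕 f) (hg : 𝓔.IsCoarse 𝓕 g) (m : ℕ)
    (c : coarseChains M 𝓔 m) :
    boundary 𝓕 m (H.prism m c) + H.prismBoundary m c = chainMap hg m c - chainMap hf m c := by
  cases m with
  | zero => exact (add_zero _).trans (H.boundary_prism_zero hf hg c)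
  | succ m => exact H.boundary_prism_succ hf hg m c

lemma prismBoundary_mem {U R : ∀ m, AddSubgroup (coarseChains M 𝓔 m)}
    {R' : ∀ m, AddSubgroup (coarseChains M 𝓕 m)}
    (h : ∀ m, ∀ c ∈ R m, H.prism m c ∈ R' (m + 1)) {m : ℕ} {c : coarseChains M 𝓔 m}
    (hc : c ∈ relCycles U R m) : H.prismBoundary m c ∈ R' m := by
  cases m with
  | zero => exact zero_mem _
  | succ m => exact h m _ hc.2

end SteppedHomotopy

end SteppedHomotopy

/-! ### Relative homology -/

section RelHomology

variable {X : Type*} {Y : Type*} {M : Type*} [AddCommGroup M]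

lemma homologyClass_surjective {𝓔 : CoarseStructure X}
    (T R : ∀ m, AddSubgroup (coarseChains M 𝓔 m)) (m : ℕ) :
    Function.Surjective (homologyClass T R m) := QuotientAddGroup.mk'_surjective _

lemma homologyClass_eq_iff {𝓔 : CoarseStructure X} {T R : ∀ m, AddSubgroup (coarseChains M 𝓔 m)}
    {m : ℕ} (c d : relCycles T R m) :
    homologyClass T R m c = homologyClass T R m d ↔ c.1 - d.1 ∈ relBoundaries T R m := by
  rw [← sub_eq_zero, ← map_sub, homologyClass_eq_zero_iff, AddSubgroup.coe_sub]

lemma mem_relBoundaries_of_mem {𝓔 : CoarseStructure X}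
    {T R : ∀ m, AddSubgroup (coarseChains M 𝓔 m)} {m : ℕ} {c : coarseChains M 𝓔 m}
    (hc : c ∈ R m) : c ∈ relBoundaries T R m :=
  mem_relBoundaries.2 ⟨0, zero_mem _, c, hc, by rw [map_zero, zero_add]⟩

lemma boundary_mem_relBoundaries {𝓔 : CoarseStructure X}
    {T R : ∀ m, AddSubgroup (coarseChains M 𝓔 m)} {m : ℕ} {e : coarseChains M 𝓔 (m + 1)}
    (he : e ∈ T (m + 1)) : boundary 𝓔 m e ∈ relBoundaries T R m :=
  mem_relBoundaries.2 ⟨e, he, 0, zero_mem _, add_zero _⟩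

/-- Relative boundaries are relative cycles. -/
lemma relBoundaries_le_relCycles {𝓔 : CoarseStructure X} {A : Set X} {m : ℕ} :
    relBoundaries (chainsIn M 𝓔 univ) (chainsIn M 𝓔 A) m ≤
      relCycles (chainsIn M 𝓔 univ) (chainsIn M 𝓔 A) m := by
  intro c hc
  obtain ⟨e, -, s, hs, rfl⟩ := mem_relBoundaries.1 hc
  cases m with
  | zero => exact mem_chainsIn_univ _
  | succ m =>
    refine ⟨mem_chainsIn_univ _, ?_⟩
    change boundary 𝓔 m (boundary 𝓔 (m + 1) e + s) ∈ chainsIn M 𝓔 A m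
    rw [map_add, boundary_boundary, zero_add]
    exact boundary_mem_chainsIn hs

lemma mem_chainsSum_of_forall {𝓔 : CoarseStructure X} {A B : Set X} {m : ℕ}
    {c : coarseChains M 𝓔 m} (h : ∀ x, c.1 x ≠ 0 → (∀ i, x i ∈ A) ∨ ∀ i, x i ∈ B) :
    c ∈ chainsSum M 𝓔 A B m := by
  classical
  let d : coarseChains M 𝓔 m := ⟨fun x => if ∀ i, x i ∈ A then c.1 x else 0,
    c.2.mono fun x hx => by
      by_cases hA : ∀ i, x i ∈ A <;> simp_all⟩
  refine AddSubgroup.mem_sup.2 ⟨d, ?_, c - d, ?_, add_sub_cancel _ _⟩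
  · intro x hx
    by_contra hA
    exact hx (if_neg hA)
  · intro x hx
    by_cases hA : ∀ i, x i ∈ A
    · refine (hx ?_).elim
      change c.1 x - (if ∀ i, x i ∈ A then c.1 x else 0) = 0
      rw [if_pos hA, sub_self]
    · refine (h x fun hc => hx ?_).resolve_left hA
      change c.1 x - (if ∀ i, x i ∈ A then c.1 x else 0) = 0
      rw [if_neg hA, hc, sub_zero]

lemma chainMap_id {𝓔 : CoarseStructure X} {f : X → X} (hf : 𝓔.IsCoarse 𝓔 f) (h : f = id) {m : ℕ}
    (c : coarseChains M 𝓔 m) : chainMap hf m c = c := by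
  subst h
  ext1
  exact push_id c.1

end RelHomology

/-! ### Excision -/

section Excision

variable {X : Type*} {Y : Type*} {M : Type*} [AddCommGroup M]

/-- Maps which are close to the identity are coarse. -/
lemma isCoarse_of_close {𝓔 : CoarseStructure X} {f : X → X} {E : Set (X × X)}
    (hE : E ∈ 𝓔.entourages) (hf : ∀ x, (x, f x) ∈ E) : 𝓔.IsCoarse 𝓔 f := by
  refine ⟨fun F hF => ?_, fun K hK => ?_⟩
  · refine 𝓔.subset_mem (𝓔.comp_mem (𝓔.comp_mem (𝓔.inv_mem hE) hF) hE) ?_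
    rintro _ ⟨p, hp, rfl⟩
    exact ⟨p.2, ⟨p.1, hf p.1, hp⟩, hf p.2⟩
  · exact (hK.penumbra hE).subset fun x hx => ⟨f x, hx, hf x⟩

/-- A map which is close to the identity is homotopic to it in a single step. -/
def closeHomotopy {𝓔 : CoarseStructure X} {f : X → X} {E : Set (X × X)}
    (hE : E ∈ 𝓔.entourages) (hf : ∀ x, (x, f x) ∈ E) : SteppedHomotopy 𝓔 𝓔 id f Unit where
  before _ := id
  after _ := f
  jumps _ := {()}
  eq_of_notMem q s h := (h (by simp)).elim
  controlled F hF := by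
    refine ⟨_, 𝓔.union_mem (𝓔.union_mem hF (𝓔.comp_mem hF hE)) (𝓔.union_mem
      (𝓔.comp_mem (𝓔.inv_mem hE) hF) ((isCoarse_of_close hE hf).1 F hF)), fun p hp _ =>
      ⟨Or.inl (Or.inl hp), Or.inl (Or.inr ⟨p.2, hp, hf p.2⟩),
        Or.inr (Or.inl ⟨p.1, hf p.1, hp⟩), Or.inr (Or.inr ⟨p, hp, rfl⟩)⟩⟩
  proper K hK := by
    refine (hK.penumbra (𝓔.union_mem 𝓔.diagonal_mem hE)).subset ?_
    have h1 : ∀ s, s ∈ K → s ∈ penumbra (diagonal X ∪ E) K := fun s hs => ⟨s, hs, Or.inl rfl⟩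
    have h2 : ∀ s, f s ∈ K → s ∈ penumbra (diagonal X ∪ E) K := fun s hs => ⟨_, hs, Or.inr (hf s)⟩
    rintro s (hs | hs | ⟨-, hs | hs⟩)
    exacts [h1 s hs, h2 s hs, h1 s hs, h2 s hs]
  telescope x := ⟨1, fun _ => (), fun l => if l = 0 then x else f ∘ x, by
    intro a ha b hb _
    simp only [mem_Iio, Nat.lt_one_iff] at ha hb
    rw [ha, hb], fun _ _ _ => ⟨0, one_pos, rfl⟩, fun l hl => by
    obtain rfl : l = 0 := Nat.lt_one_iff.1 hl
    simp, by simp, by simp⟩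

/-- In an excisive triad, any chain in `A ∪ B` is moved into `CX_*(A) + CX_*(B)` by a map which is
close to the identity and preserves both subspaces: it moves a penumbra of `A ∩ B` into `A ∩ B`. -/
lemma exists_close_map {𝓔 : CoarseStructure X} {A B : Set X} (hexc : 𝓔.IsExcisive A B) {m : ℕ}
    {s : coarseChains M 𝓔 m} (hs : s ∈ chainsIn M 𝓔 (A ∪ B) m) :
    ∃ (f : X → X) (E : Set (X × X)) (hE : E ∈ 𝓔.entourages) (hf : ∀ x, (x, f x) ∈ E),
      MapsTo f A A ∧ MapsTo f B B ∧
      chainMap (isCoarse_of_close hE hf) m s ∈ chainsSum M 𝓔 A B m := by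
  classical
  obtain ⟨E, hE, hsE⟩ := subset_penumbra_iff.1 s.2.1
  obtain ⟨F, hF, hEF⟩ := hexc E hE
  have hch : ∀ x : penumbra F (A ∩ B), ∃ y ∈ A ∩ B, (x.1, y) ∈ F := fun x => x.2
  choose r hr hrF using hch
  let f : X → X := fun x => if h : x ∈ penumbra F (A ∩ B) then r ⟨x, h⟩ else x
  have hfin : ∀ x ∈ penumbra F (A ∩ B), f x ∈ A ∩ B := fun x hx => by
    simp only [f, dif_pos hx]
    exact hr _
  have hfe : ∀ x, (x, f x) ∈ diagonal X ∪ F := fun x => by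
    by_cases h : x ∈ penumbra F (A ∩ B)
    · right
      simp only [f, dif_pos h]
      exact hrF ⟨x, h⟩
    · left
      simp [f, dif_neg h]
  have hfA : MapsTo f A A := fun x hx => by
    by_cases h : x ∈ penumbra F (A ∩ B)
    · exact (hfin x h).1
    · simpa only [f, dif_neg h] using hx
  have hfB : MapsTo f B B := fun x hx => by
    by_cases h : x ∈ penumbra F (A ∩ B)
    · exact (hfin x h).2
    · simpa only [f, dif_neg h] using hx
  refine ⟨f, _, 𝓔.union_mem 𝓔.diagonal_mem hF, hfe, hfA, hfB, mem_chainsSum_of_forall ?_⟩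
  intro y hy
  obtain ⟨x, rfl, hx⟩ := exists_of_push_ne_zero hy
  by_cases hxA : ∀ i, x i ∈ A
  · exact Or.inl fun i => hfA (hxA i)
  by_cases hxB : ∀ i, x i ∈ B
  · exact Or.inr fun i => hfB (hxB i)
  push Not at hxA hxB
  obtain ⟨j, hj⟩ := hxA
  obtain ⟨i, hi⟩ := hxB
  exact Or.inl fun k => (hfin _ (hEF ⟨⟨x i, (hs x hx i).resolve_right hi, hsE x hx k i⟩,
    ⟨x j, (hs x hx j).resolve_left hj, hsE x hx k j⟩⟩)).1

lemma closeHomotopy_prism_mem {𝓔 : CoarseStructure X} {f : X → X} {E : Set (X × X)}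
    (hE : E ∈ 𝓔.entourages) (hf : ∀ x, (x, f x) ∈ E) {A : Set X} (hfA : MapsTo f A A) {m : ℕ}
    {c : coarseChains M 𝓔 m} (hc : c ∈ chainsIn M 𝓔 A m) :
    (closeHomotopy hE hf).prism m c ∈ chainsIn M 𝓔 A (m + 1) :=
  SteppedHomotopy.prism_mem_chainsIn _ hc fun _ _ _ _ _ hs => ⟨hs, hfA hs⟩

/-- Excision, surjectivity: a relative cycle is homologous to its image under a close map which moves
its boundary into `CX_*(A) + CX_*(B)`. -/
theorem toUnion_surjective {𝓔 : CoarseStructure X} {A B : Set X} (hexc : 𝓔.IsExcisive A B)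
    (m : ℕ) : Function.Surjective (HXsum.toUnion M 𝓔 A B m) := by
  intro x
  obtain ⟨⟨c, hc⟩, rfl⟩ := homologyClass_surjective _ _ _ x
  cases m with
  | zero => exact ⟨homologyClass _ _ 0 ⟨c, hc⟩, rfl⟩
  | succ m =>
    obtain ⟨f, E, hE, hf, hfA, hfB, hfs⟩ := exists_close_map hexc hc.2
    have hcoarse := isCoarse_of_close hE hf
    refine ⟨homologyClass _ _ (m + 1) ⟨chainMap hcoarse (m + 1) c, mem_chainsIn_univ _, ?_⟩, ?_⟩
    · change boundary 𝓔 m _ ∈ chainsSum M 𝓔 A B m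
      rwa [← chainMap_boundary]
    · refine (homologyClass_eq_iff _ _).2 ?_
      have h := (closeHomotopy hE hf).boundary_prism (isCoarse_id 𝓔) hcoarse (m + 1) c
      rw [chainMap_id _ rfl] at h
      exact mem_relBoundaries.2 ⟨_, mem_chainsIn_univ _, _, SteppedHomotopy.prismBoundary_mem _
        (fun _ _ hc => closeHomotopy_prism_mem hE hf (hfA.union_union hfB) hc) hc, h⟩

/-- Excision, injectivity: the part in `A ∪ B` of a relative null-homology is moved into
`CX_*(A) + CX_*(B)` by a close map. -/
theorem toUnion_injective {𝓔 : CoarseStructure X} {A B : Set X} (hexc : 𝓔.IsExcisive A B)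
    (m : ℕ) : Function.Injective (HXsum.toUnion M 𝓔 A B m) := by
  rw [injective_iff_map_eq_zero]
  intro x hx
  obtain ⟨⟨c, hc⟩, rfl⟩ := homologyClass_surjective _ _ _ x
  obtain ⟨e, -, s, hs, hes⟩ := mem_relBoundaries.1 ((homologyClass_eq_zero_iff _).1 hx)
  obtain ⟨f, E, hE, hf, hfA, hfB, hfs⟩ := exists_close_map hexc hs
  have hcoarse := isCoarse_of_close hE hf
  have h := (closeHomotopy hE hf).boundary_prism (isCoarse_id 𝓔) hcoarse m c
  have hside : (closeHomotopy hE hf).prismBoundary m c ∈ chainsSum M 𝓔 A B m := by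
    refine SteppedHomotopy.prismBoundary_mem _ (fun m c hc => ?_) hc
    obtain ⟨α, hα, β, hβ, rfl⟩ := AddSubgroup.mem_sup.1 hc
    rw [map_add]
    exact AddSubgroup.add_mem_sup (closeHomotopy_prism_mem hE hf hfA hα)
      (closeHomotopy_prism_mem hE hf hfB hβ)
  have hes' : boundary 𝓔 m e + s = c := hes
  refine (homologyClass_eq_zero_iff _).2 (mem_relBoundaries.2
    ⟨chainMap hcoarse (m + 1) e - (closeHomotopy hE hf).prism m c, mem_chainsIn_univ _,
      chainMap hcoarse m s - (closeHomotopy hE hf).prismBoundary m c, sub_mem hfs hside, ?_⟩)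
  have h2 := congrArg (chainMap hcoarse m) hes'
  rw [map_add, chainMap_boundary] at h2
  rw [chainMap_id _ rfl] at h
  rw [map_sub, sub_add_sub_comm, h2, h, sub_sub_cancel]

/-- The triad `(X × Y; A × Y, X × B)` is always excisive. -/
lemma isExcisive_prod (𝓔 : CoarseStructure X) (𝓕 : CoarseStructure Y) (A : Set X) (B : Set Y) :
    (𝓔.prod 𝓕).IsExcisive (A ×ˢ univ) (univ ×ˢ B) := by
  rintro G ⟨E, hE, F, hF, hG⟩
  refine ⟨_, ⟨E, hE, F, hF, fun p hp => hp⟩, ?_⟩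
  rintro p ⟨⟨q, hq, hpq⟩, ⟨r, hr, hpr⟩⟩
  exact ⟨(q.1, r.2), ⟨⟨hq.1, mem_univ _⟩, ⟨mem_univ _, hr.2⟩⟩, (hG _ hpq).1, (hG _ hpr).2⟩

end Excision

/-! ### Raising the height in a warped product -/

section Raise

variable {X : Type*}

/-- The points of `X × I` are raised to the height `r`, unless they are already higher. -/
def raise (r : ℝ) (p : X × I) : X × I := (p.1, max p.2 (projIcc (-1) 1 (by norm_num) r))

lemma abs_raise_sub_raise_le (r r' : ℝ) (p : X × I) :
    |((raise r p).2 : ℝ) - (raise r' p).2| ≤ |r - r'| := by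
  have h : ∀ t : ℝ, ((raise t p).2 : ℝ) = max (p.2 : ℝ) (max (-1) (min 1 t)) := fun t => rfl
  rw [h, h]
  refine (abs_max_sub_max_le_max _ _ _ _).trans ?_
  rw [sub_self, abs_zero, max_eq_right (abs_nonneg _)]
  refine (abs_max_sub_max_le_max _ _ _ _).trans ?_
  rw [sub_self, abs_zero, max_eq_right (abs_nonneg _)]
  refine (abs_min_sub_min_le_max _ _ _ _).trans ?_
  rw [sub_self, abs_zero, max_eq_right (abs_nonneg _)]

lemma raise_of_le {r : ℝ} {p : X × I} (h : r ≤ p.2) : raise r p = p := by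
  refine Prod.ext rfl (Subtype.ext ?_)
  change max (p.2 : ℝ) (max (-1) (min 1 r)) = p.2
  exact max_eq_left (max_le p.2.2.1 ((min_le_right _ _).trans h))

lemma raise_of_ge {t : I} {p : X × I} (h : p.2 ≤ t) : raise (t : ℝ) p = (p.1, t) := by
  refine Prod.ext rfl ?_
  change max p.2 (projIcc (-1 : ℝ) 1 _ (t : ℝ)) = t
  rw [projIcc_val, max_eq_right h]

lemma le_raise (r : ℝ) (p : X × I) : p.2 ≤ (raise r p).2 := le_max_left _ _

lemma raise_le {r : ℝ} {p : X × I} {t : I} (hp : p.2 ≤ t) (hr : r ≤ t) : (raise r p).2 ≤ t :=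
  max_le hp (max_le t.2.1 ((min_le_right _ _).trans hr))

/-- Raising the heights of close points to the same level is controlled, uniformly in the level. -/
lemma raise_mem_warped (𝓔 : CoarseStructure X) (ε : X → ℝ) {G : Set ((X × I) × (X × I))}
    (hG : G ∈ (𝓔.warped (metricFamily (-1) 1 ε)).entourages) :
    {p | ∃ r, ∃ q ∈ G, p = (raise r q.1, raise r q.2)} ∈
      (𝓔.warped (metricFamily (-1) 1 ε)).entourages := by
  set 𝓦 := 𝓔.warped (metricFamily (-1) 1 ε) with h𝓦
  induction hG with
  | basic G hG =>
    rcases hG with ⟨E, hE, rfl⟩ | rfl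
    · refine 𝓦.subset_mem (𝓔.horizontal_mem_warped _ hE) ?_
      rintro _ ⟨r, q, hq, rfl⟩
      refine ⟨hq.1, ?_⟩
      change max _ _ = max _ _
      rw [hq.2]
    · refine 𝓦.subset_mem (𝓔.vertical_mem_warped _) ?_
      rintro _ ⟨r, ⟨⟨x, s⟩, ⟨y, t⟩⟩, hq, rfl⟩
      refine ⟨hq.1, ?_⟩
      change |max (s : ℝ) _ - max (t : ℝ) _| < ε x
      exact (abs_max_sub_max_le_abs _ _ _).trans_lt hq.2
  | diagonal =>
    refine 𝓦.subset_mem 𝓦.diagonal_mem ?_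
    rintro _ ⟨r, q, hq, rfl⟩
    exact congrArg (raise r) hq
  | subset E F _ hs ih =>
    refine 𝓦.subset_mem ih ?_
    rintro _ ⟨r, q, hq, rfl⟩
    exact ⟨r, q, hs hq, rfl⟩
  | union E F _ _ ihE ihF =>
    refine 𝓦.subset_mem (𝓦.union_mem ihE ihF) ?_
    rintro _ ⟨r, q, hq, rfl⟩
    exact hq.imp (fun h => ⟨r, q, h, rfl⟩) (fun h => ⟨r, q, h, rfl⟩)
  | inv E _ ih =>
    refine 𝓦.subset_mem (𝓦.inv_mem ih) ?_
    rintro _ ⟨r, q, hq, rfl⟩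
    exact ⟨r, (q.2, q.1), hq, rfl⟩
  | comp E F _ _ ihE ihF =>
    refine 𝓦.subset_mem (𝓦.comp_mem ihE ihF) ?_
    rintro _ ⟨r, q, ⟨z, hz, hz'⟩, rfl⟩
    exact ⟨raise r z, ⟨r, (q.1, z), hz, rfl⟩, ⟨r, (z, q.2), hz', rfl⟩⟩

/-- Nearly simultaneous raising of close points is controlled. -/
lemma exists_raise_controlled (𝓔 : CoarseStructure X) (ε : X → ℝ) {G : Set ((X × I) × (X × I))}
    (hG : G ∈ (𝓔.warped (metricFamily (-1) 1 ε)).entourages) :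
    ∃ F ∈ (𝓔.warped (metricFamily (-1) 1 ε)).entourages, ∀ p ∈ G, ∀ r r₁ r₂ : ℝ,
      |r₁ - r| < ε p.1.1 → |r - r₂| < ε p.2.1 → (raise r₁ p.1, raise r₂ p.2) ∈ F := by
  set 𝓦 := 𝓔.warped (metricFamily (-1) 1 ε)
  refine ⟨_, 𝓦.comp_mem (𝓔.vertical_mem_warped _) (𝓦.comp_mem (raise_mem_warped 𝓔 ε hG)
    (𝓔.vertical_mem_warped _)), fun p hp r r₁ r₂ h1 h2 => ?_⟩
  exact ⟨raise r p.1, ⟨rfl, (abs_raise_sub_raise_le _ _ _).trans_lt h1⟩, raise r p.2,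
    ⟨r, p, hp, rfl⟩, ⟨rfl, (abs_raise_sub_raise_le _ _ _).trans_lt h2⟩⟩

lemma isCoarse_raise (𝓔 : CoarseStructure X) {ε : X → ℝ} (hε : ∀ x, 0 < ε x) (r : ℝ) :
    (𝓔.warped (metricFamily (-1) 1 ε)).IsCoarse (𝓔.warped (metricFamily (-1) 1 ε))
      (raise (X := X) r) := by
  refine ⟨fun E hE => CoarseStructure.subset_mem _ (raise_mem_warped 𝓔 ε hE) ?_, fun K hK => ?_⟩
  · rintro _ ⟨q, hq, rfl⟩
    exact ⟨r, q, hq, rfl⟩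
  · refine (𝓔.isBounded_warped (isNhdFamily_metricFamily (-1) 1 hε)
      ((𝓔.isControlled_warped_fst _).isBounded_image hK)).subset ?_
    intro p hp
    exact ⟨⟨_, hp, rfl⟩, mem_univ _⟩

/-! ### Steps of variable length -/

/-- The times `j / N` with `0 ≤ j < N`. -/
def stepTimes (N : ℕ) : Finset ℝ := by
  classical exact (Finset.range N).image fun j : ℕ => (j : ℝ) / N

lemma mem_stepTimes {N : ℕ} {q : ℝ} : q ∈ stepTimes N ↔ ∃ j < N, (j : ℝ) / N = q := by
  classical
  simp [stepTimes]

/-- The number of steps of a staircase with `N` steps before the time `q`. -/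
def stepsBefore (N : ℕ) (q : ℝ) : ℤ := ⌈q * N⌉

open Classical in
/-- The number of steps of a staircase with `N` steps up to the time `q`. -/
def stepsAfter (N : ℕ) (q : ℝ) : ℤ := if q ∈ stepTimes N then ⌈q * N⌉ + 1 else ⌈q * N⌉

lemma stepsAfter_of_mem {N : ℕ} {q : ℝ} (h : q ∈ stepTimes N) :
    stepsAfter N q = stepsBefore N q + 1 := if_pos h

lemma stepsAfter_of_notMem {N : ℕ} {q : ℝ} (h : q ∉ stepTimes N) :
    stepsAfter N q = stepsBefore N q := if_neg h

/-- At the time `q`, the staircase is within one step of the height `q`. -/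
lemma abs_stepsBefore_sub_le {N : ℕ} (hN : 0 < N) (q : ℝ) :
    |(stepsBefore N q : ℝ) / N - q| ≤ 1 / N := by
  have hN' : (0 : ℝ) < N := by exact_mod_cast hN
  have h1 := Int.le_ceil (q * N)
  have h2 := Int.ceil_lt_add_one (q * N)
  rw [stepsBefore, div_sub' hN'.ne', abs_div, abs_of_pos hN', div_le_div_iff_of_pos_right hN',
    abs_le]
  constructor <;> linarith

lemma stepsBefore_of_eq {N j : ℕ} (hN : 0 < N) : stepsBefore N ((j : ℝ) / N) = j := by
  have hN' : (0 : ℝ) < N := by exact_mod_cast hN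
  rw [stepsBefore, div_mul_cancel₀ _ hN'.ne', Int.ceil_natCast]

lemma abs_stepsAfter_sub_le {N : ℕ} (hN : 0 < N) (q : ℝ) :
    |(stepsAfter N q : ℝ) / N - q| ≤ 1 / N := by
  by_cases h : q ∈ stepTimes N
  · have hN' : (0 : ℝ) < N := by exact_mod_cast hN
    obtain ⟨j, -, rfl⟩ := mem_stepTimes.1 h
    rw [stepsAfter_of_mem h, stepsBefore_of_eq hN, ← sub_div]
    push_cast
    rw [add_sub_cancel_left, abs_of_pos (by positivity)]
  · rw [stepsAfter_of_notMem h]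
    exact abs_stepsBefore_sub_le hN q

lemma stepsBefore_mem_Icc {N N' : ℕ} {q : ℝ} (hq : q ∈ stepTimes N') :
    stepsBefore N q ∈ Icc (0 : ℤ) N := by
  obtain ⟨j, hj, rfl⟩ := mem_stepTimes.1 hq
  have hN' : (0 : ℝ) < N' := by exact_mod_cast (Nat.zero_le j).trans_lt hj
  have h1 : (j : ℝ) / N' ≤ 1 := by
    rw [div_le_one hN']
    exact_mod_cast hj.le
  refine ⟨Int.ceil_nonneg (by positivity), Int.ceil_le.2 ?_⟩
  push_cast
  exact mul_le_of_le_one_left (by positivity) h1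

lemma stepsAfter_mem_Icc {N N' : ℕ} {q : ℝ} (hq : q ∈ stepTimes N') :
    stepsAfter N q ∈ Icc (0 : ℤ) N := by
  by_cases h : q ∈ stepTimes N
  · obtain ⟨j, hj, rfl⟩ := mem_stepTimes.1 h
    rw [stepsAfter_of_mem h, stepsBefore_of_eq ((Nat.zero_le j).trans_lt hj)]
    exact ⟨by omega, by omega⟩
  · rw [stepsAfter_of_notMem h]
    exact stepsBefore_mem_Icc hq

/-- On a common refinement of the times, the number of steps does not change between the end of one
time and the beginning of the next. -/
lemma stepsAfter_eq_stepsBefore {N D l : ℕ} (hN : 0 < N) (hD : 0 < D) (hl : l < N * D) :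
    stepsAfter N ((l : ℝ) / (N * D : ℕ)) = stepsBefore N (((l + 1 : ℕ) : ℝ) / (N * D : ℕ)) := by
  have hN' : (0 : ℝ) < N := by exact_mod_cast hN
  have hD' : (0 : ℝ) < D := by exact_mod_cast hD
  have hmul : ∀ k : ℕ, (k : ℝ) / (N * D : ℕ) * N = k / D := fun k => by
    push_cast
    field_simp
  have hdiv := Nat.div_add_mod l D
  have hmod := Nat.mod_lt l hD
  set a := l / D
  set b := l % D
  have hlr : (l : ℝ) = D * a + b := by exact_mod_cast hdiv.symm
  have hR : stepsBefore N (((l + 1 : ℕ) : ℝ) / (N * D : ℕ)) = a + 1 := by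
    have hb : ((b : ℝ) + 1) ≤ D := by exact_mod_cast hmod
    rw [stepsBefore, hmul, Int.ceil_eq_iff]
    push_cast
    rw [hlr, lt_div_iff₀ hD', div_le_iff₀ hD']
    constructor <;> nlinarith
  rw [hR]
  by_cases hb : b = 0
  · have haN : a < N := by
      by_contra hcon
      have := Nat.mul_le_mul_left D (not_lt.1 hcon)
      rw [mul_comm D N] at this
      omega
    have hlN : (l : ℝ) / (N * D : ℕ) = (a : ℝ) / N := by
      rw [hlr, hb]
      push_cast
      field_simp
      ring
    have hmem : (l : ℝ) / (N * D : ℕ) ∈ stepTimes N := mem_stepTimes.2 ⟨a, haN, hlN.symm⟩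
    rw [stepsAfter_of_mem hmem, hlN, stepsBefore_of_eq hN]
  · have hnot : (l : ℝ) / (N * D : ℕ) ∉ stepTimes N := by
      intro hmem
      obtain ⟨j, -, hj⟩ := mem_stepTimes.1 hmem
      push_cast at hj
      have h1 : (j : ℝ) * D = l := by
        field_simp at hj
        linarith
      have h2 : j * D = l := by exact_mod_cast h1
      exact hb (Nat.mod_eq_zero_of_dvd ⟨j, by rw [← h2, mul_comm]⟩)
    rw [stepsAfter_of_notMem hnot, stepsBefore, hmul, Int.ceil_eq_iff]
    have hb1 : (1 : ℝ) ≤ b := by exact_mod_cast Nat.one_le_iff_ne_zero.2 hb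
    have hb2 : (b : ℝ) ≤ D := by exact_mod_cast hmod.le
    push_cast
    rw [hlr, lt_div_iff₀ hD', div_le_iff₀ hD']
    constructor <;> nlinarith

/-! ### The staircase homotopy -/

/-- The staircase homotopy on a warped product, from raising to the height `lo` to raising to the
height `hi`, with `N x` steps of equal length over the point `x`. It is controlled as soon as the
steps over `x` are smaller than `ε x`, without any relation between the values of `ε`: at each time,
all heights are raised to nearly the same level. -/
def staircase (𝓔 : CoarseStructure X) {ε : X → ℝ} (hε : ∀ x, 0 < ε x) {lo hi : ℝ} (h : lo ≤ hi)
    (N : X → ℕ) (hN : ∀ x, 0 < N x) (hNε : ∀ x, (hi - lo) * (1 / N x) < ε x) :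
    SteppedHomotopy (𝓔.warped (metricFamily (-1) 1 ε)) (𝓔.warped (metricFamily (-1) 1 ε))
      (raise lo) (raise hi) ℝ where
  before q p := raise (lo + (hi - lo) * ((stepsBefore (N p.1) q : ℝ) / N p.1)) p
  after q p := raise (lo + (hi - lo) * ((stepsAfter (N p.1) q : ℝ) / N p.1)) p
  jumps p := stepTimes (N p.1)
  eq_of_notMem q p hq := by rw [stepsAfter_of_notMem hq]
  controlled G hG := by
    obtain ⟨F, hF, hGF⟩ := exists_raise_controlled 𝓔 ε hG
    have key : ∀ (x : X) (z : ℤ) (q : ℝ), |(z : ℝ) / N x - q| ≤ 1 / N x →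
        |lo + (hi - lo) * ((z : ℝ) / N x) - (lo + (hi - lo) * q)| < ε x := by
      intro x z q hz
      rw [add_sub_add_left_eq_sub, ← mul_sub, abs_mul, abs_of_nonneg (sub_nonneg.2 h)]
      exact (mul_le_mul_of_nonneg_left hz (sub_nonneg.2 h)).trans_lt (hNε x)
    have hb := fun x q => key x _ q (abs_stepsBefore_sub_le (hN x) q)
    have ha := fun x q => key x _ q (abs_stepsAfter_sub_le (hN x) q)
    have hb' := fun x q => (abs_sub_comm _ _).trans_lt (hb x q)
    have ha' := fun x q => (abs_sub_comm _ _).trans_lt (ha x q)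
    exact ⟨F, hF, fun p hp q => ⟨hGF p hp _ _ _ (hb _ q) (hb' _ q), hGF p hp _ _ _ (hb _ q) (ha' _ q),
      hGF p hp _ _ _ (ha _ q) (hb' _ q), hGF p hp _ _ _ (ha _ q) (ha' _ q)⟩⟩
  proper K hK := by
    refine (𝓔.isBounded_warped (isNhdFamily_metricFamily (-1) 1 hε)
      ((𝓔.isControlled_warped_fst _).isBounded_image hK)).subset ?_
    rintro p (hp | hp | ⟨q, hp | hp⟩) <;> exact ⟨⟨_, hp, rfl⟩, mem_univ _⟩
  telescope {m} x := by
    have hL : 0 < ∏ i, N (x i).1 := Finset.prod_pos fun i _ => hN _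
    have hL' : ((∏ i, N (x i).1 : ℕ) : ℝ) ≠ 0 := by exact_mod_cast hL.ne'
    have hdvd : ∀ i, ∃ D, 0 < D ∧ ∏ i, N (x i).1 = N (x i).1 * D := fun i => by
      obtain ⟨D, hD⟩ := Finset.dvd_prod_of_mem (fun i => N (x i).1) (Finset.mem_univ i)
      exact ⟨D, Nat.pos_of_ne_zero fun h0 => hL.ne' (by rw [hD, h0, mul_zero]), hD⟩
    refine ⟨∏ i, N (x i).1, fun l => (l : ℝ) / (∏ i, N (x i).1 : ℕ), fun l i =>
      raise (lo + (hi - lo) * ((stepsBefore (N (x i).1) ((l : ℝ) / (∏ i, N (x i).1 : ℕ)) : ℝ) /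
        N (x i).1)) (x i), ?_, ?_, ?_, ?_, ?_⟩
    · intro a _ b _ hab
      exact_mod_cast (div_left_inj' hL').1 hab
    · intro i q hq
      obtain ⟨j, hj, rfl⟩ := mem_stepTimes.1 hq
      obtain ⟨D, hD, hLD⟩ := hdvd i
      refine ⟨j * D, by rw [hLD]; exact Nat.mul_lt_mul_of_pos_right hj hD, ?_⟩
      rw [hLD]
      push_cast
      rw [mul_div_mul_right]
      exact_mod_cast hD.ne'
    · refine fun l hl => ⟨rfl, funext fun i => ?_⟩
      obtain ⟨D, hD, hLD⟩ := hdvd i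
      simp only [Function.comp]
      rw [hLD, stepsAfter_eq_stepsBefore (hN _) hD (hLD ▸ hl)]
    · funext i
      simp [stepsBefore]
    · funext i
      have hNi : (N (x i).1 : ℝ) ≠ 0 := by exact_mod_cast (hN _).ne'
      simp only [Function.comp, stepsBefore]
      rw [div_self hL', one_mul, Int.ceil_natCast, Int.cast_natCast, div_self hNi, mul_one,
        add_sub_cancel]

end Raise

/-! ### The suspension isomorphism -/

section SuspensionIso

variable {X : Type u} {M : Type w} [AddCommGroup M]

lemma exists_steps {ε : X → ℝ} (hε : ∀ x, 0 < ε x) (lo hi : ℝ) :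
    ∃ N : X → ℕ, (∀ x, 0 < N x) ∧ ∀ x, (hi - lo) * (1 / N x) < ε x := by
  have h : ∀ x, ∃ N : ℕ, 0 < N ∧ (hi - lo) * (1 / N) < ε x := fun x => by
    obtain ⟨N, hN⟩ := exists_nat_gt ((hi - lo) / ε x)
    refine ⟨N + 1, N.succ_pos, ?_⟩
    rw [div_lt_iff₀ (hε x)] at hN
    rw [mul_one_div, div_lt_iff₀ (by positivity)]
    push_cast
    nlinarith [hε x]
  choose N hN using h
  exact ⟨N, fun x => (hN x).1, fun x => (hN x).2⟩

/-- The points over `A` at heights between `s` and `t`. -/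
def band (A : Set X) (s t : I) : Set (X × I) := {p | p.1 ∈ A ∧ s ≤ p.2 ∧ p.2 ≤ t}

lemma staircase_mem_band {𝓔 : CoarseStructure X} {ε : X → ℝ} (hε : ∀ x, 0 < ε x) {s t : I}
    (h : (s : ℝ) ≤ t) {N : X → ℕ} (hN : ∀ x, 0 < N x)
    (hNε : ∀ x, ((t : ℝ) - s) * (1 / N x) < ε x) {A : Set X} {m : ℕ}
    {c : coarseChains M (𝓔.warped (metricFamily (-1) 1 ε)) m}
    (hc : c ∈ chainsIn M _ (band A s t) m) :
    (staircase 𝓔 hε h N hN hNε).prism m c ∈ chainsIn M _ (band A s t) (m + 1) := by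
  refine SteppedHomotopy.prism_mem_chainsIn _ hc fun p₀ _ q hq p hp => ?_
  have key : ∀ z ∈ Icc (0 : ℤ) (N p.1), raise (s + (t - s) * ((z : ℝ) / N p.1)) p ∈ band A s t := by
    intro z hz
    have hNp : (0 : ℝ) < N p.1 := by exact_mod_cast hN p.1
    have h1 : (z : ℝ) / N p.1 ≤ 1 := by
      rw [div_le_one hNp]
      exact_mod_cast hz.2
    refine ⟨hp.1, hp.2.1.trans (le_raise _ _), raise_le hp.2.2 ?_⟩
    nlinarith
  exact ⟨key _ (stepsBefore_mem_Icc hq), key _ (stepsAfter_mem_Icc hq)⟩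

lemma raise_mem_suspUpper {C : Set X} (r : ℝ) {p : X × I} (hp : p ∈ suspUpper C) :
    raise r p ∈ suspUpper C := by
  refine hp.imp (fun h => ?_) (fun h => h)
  change max _ _ = _
  rw [h]
  exact max_eq_left (projIcc (-1 : ℝ) 1 _ r).2.2

/-- The connecting homomorphism of the suspension is injective: the staircase homotopy contracts
`X × I` to the subspace `X × {1}`. -/
theorem connecting_injective (𝓔 : CoarseStructure X) {ε : X → ℝ} (hε : ∀ x, 0 < ε x) (C : Set X)
    (m : ℕ) : Function.Injective (connecting (chainsIn M (𝓔.warped (metricFamily (-1) 1 ε)) univ)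
      (chainsIn M _ (suspBoundary C)) (chainsIn M _ (suspUpper C)) m) := by
  rw [injective_iff_map_eq_zero]
  intro ζ hζ
  obtain ⟨⟨z, hz⟩, rfl⟩ := homologyClass_surjective _ _ _ ζ
  obtain ⟨e, he, s, hs, hes⟩ := mem_relBoundaries.1 ((homologyClass_eq_zero_iff _).1 hζ)
  have hes' : boundary _ m e + s = boundary _ m z := hes
  obtain ⟨N, hN, hNε⟩ := exists_steps hε (-1) 1
  set H := staircase 𝓔 hε (by norm_num : (-1 : ℝ) ≤ 1) N hN hNε
  -- The homotopy formula is applied to `z - e`, whose boundary `s` lies in `suspUpper C`, a subspace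
  -- preserved by the staircase. The prism over the boundary of `z` itself need not lie in
  -- `suspBoundary C`.
  have hU : ∀ {k : ℕ}, ∀ c ∈ chainsIn M (𝓔.warped (metricFamily (-1) 1 ε)) (suspUpper C) k,
      H.prism k c ∈ chainsIn M _ (suspUpper C) (k + 1) := fun c hc =>
    SteppedHomotopy.prism_mem_chainsIn _ hc fun _ _ _ _ _ hp =>
      ⟨raise_mem_suspUpper _ hp, raise_mem_suspUpper _ hp⟩
  have hsub : suspUpper C ⊆ suspBoundary C := fun _ h => Or.inr h
  have h1 := H.boundary_prism (isCoarse_raise 𝓔 hε _) (isCoarse_raise 𝓔 hε _) (m + 1) (z - e)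
  have h2 : H.prismBoundary (m + 1) (z - e) = H.prism m s := by
    change H.prism m (boundary _ m (z - e)) = _
    rw [map_sub, ← hes', add_sub_cancel_left]
  rw [h2, chainMap_id _ (funext fun p => raise_of_le p.2.2.1)] at h1
  set r := chainMap (isCoarse_raise 𝓔 hε 1) (m + 1) (z - e) with hr
  have hr' : r ∈ chainsIn M _ (suspBoundary C) (m + 1) := by
    intro y hy i
    obtain ⟨x, rfl, -⟩ := exists_of_push_ne_zero hy
    refine Or.inr (Or.inl ?_)
    change (raise ((upper : I) : ℝ) (x i)).2 = upper
    rw [raise_of_ge (x i).2.2.2]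
  refine (homologyClass_eq_zero_iff _).2 (mem_relBoundaries.2 ⟨-H.prism (m + 1) (z - e),
    mem_chainsIn_univ _, r - H.prism m s + e, add_mem (sub_mem hr' (chainsIn_mono hsub _ (hU s hs)))
    he, ?_⟩)
  rw [map_neg]
  change -_ + (r - H.prism m s + e) = z
  rw [eq_sub_of_add_eq h1]
  abel

/-- The midpoint of `I`. -/
def middle : I := ⟨0, by norm_num, by norm_num⟩

lemma lower_le (t : I) : lower ≤ t := t.2.1

lemma le_upper (t : I) : t ≤ upper := t.2.2

variable (M) in
/-- The chain map given by the inclusion of the slice `X × {t}`. -/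
def slice (𝓔 : CoarseStructure X) (ε : X → ℝ) (t : I) (m : ℕ) :
    coarseChains M 𝓔 m →+ coarseChains M (𝓔.warped (metricFamily (-1) 1 ε)) m :=
  chainMap (𝓔.isCoarse_slice (metricFamily (-1) 1 ε) t) m

lemma slice_mem_band {𝓔 : CoarseStructure X} {ε : X → ℝ} {A : Set X} {s t r : I} (h1 : s ≤ r)
    (h2 : r ≤ t) {m : ℕ} {c : coarseChains M 𝓔 m} (hc : c ∈ chainsIn M 𝓔 A m) :
    slice M 𝓔 ε r m c ∈ chainsIn M _ (band A s t) m :=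
  chainsIn_le_comap (B := band A s t) _ (fun _ hx => ⟨hx, h1, h2⟩) m hc

lemma chainMap_raise_slice {𝓔 : CoarseStructure X} {ε : X → ℝ} (hε : ∀ x, 0 < ε x) {s t : I}
    (h : s ≤ t) {m : ℕ} (c : coarseChains M 𝓔 m) :
    chainMap (isCoarse_raise 𝓔 hε t) m (slice M 𝓔 ε s m c) = slice M 𝓔 ε t m c := by
  ext1
  have hcomp : (fun (x : Fin (m + 1) → X × I) => raise (t : ℝ) ∘ x) ∘
      (fun (x : Fin (m + 1) → X) => (fun p => (p, s)) ∘ x) = fun x => (fun p => (p, t)) ∘ x := by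
    funext x i
    exact raise_of_ge h
  refine (push_push ?_).trans (congrArg (push · c.1) hcomp)
  rw [hcomp]
  exact finiteFibres_of_proper (proper_reindex
    (𝓔.isCoarse_slice (metricFamily (-1) 1 ε) t) c.2 id)

/-- The chain swept out by a relative cycle `c` of `(X, A + B)` which is raised from the height `s`
to the height `t`, in a staircase fine enough for `ε`. -/
theorem exists_sweep (𝓔 : CoarseStructure X) {ε : X → ℝ} (hε : ∀ x, 0 < ε x) {A B : Set X} {m : ℕ}
    {c : coarseChains M 𝓔 m} (hc : c ∈ relCycles (chainsIn M 𝓔 univ) (chainsSum M 𝓔 A B) m)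
    {s t : I} (h : s ≤ t) :
    ∃ z ∈ chainsIn M (𝓔.warped (metricFamily (-1) 1 ε)) (band univ s t) (m + 1),
      ∃ α ∈ chainsIn M (𝓔.warped (metricFamily (-1) 1 ε)) (band A s t) m,
      ∃ β ∈ chainsIn M (𝓔.warped (metricFamily (-1) 1 ε)) (band B s t) m,
        boundary _ m z = slice M 𝓔 ε t m c - slice M 𝓔 ε s m c - (α + β) := by
  obtain ⟨N, hN, hNε⟩ := exists_steps hε (s : ℝ) t
  set H := staircase 𝓔 hε (show (s : ℝ) ≤ t from h) N hN hNε
  have hband : ∀ (A : Set X) {k : ℕ} {c : coarseChains M 𝓔 k}, c ∈ chainsIn M 𝓔 A k →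
      H.prism k (slice M 𝓔 ε s k c) ∈ chainsIn M _ (band A s t) (k + 1) := fun A k c hc =>
    staircase_mem_band hε h hN hNε (slice_mem_band le_rfl h hc)
  have hf := H.boundary_prism (isCoarse_raise 𝓔 hε _) (isCoarse_raise 𝓔 hε _) m (slice M 𝓔 ε s m c)
  rw [chainMap_raise_slice hε h, chainMap_raise_slice hε le_rfl] at hf
  refine ⟨_, hband univ (mem_chainsIn_univ c), ?_⟩
  have hside : H.prismBoundary m (slice M 𝓔 ε s m c) ∈
      chainsSum M (𝓔.warped (metricFamily (-1) 1 ε)) (band A s t) (band B s t) m := by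
    cases m with
    | zero => exact zero_mem _
    | succ m =>
      change H.prism m (boundary _ m (chainMap _ _ c)) ∈ _
      rw [← chainMap_boundary]
      obtain ⟨α, hα, β, hβ, hαβ⟩ := AddSubgroup.mem_sup.1 hc.2
      rw [← hαβ, map_add, map_add]
      exact AddSubgroup.add_mem_sup (hband A hα) (hband B hβ)
  obtain ⟨α, hα, β, hβ, hαβ⟩ := AddSubgroup.mem_sup.1 hside
  exact ⟨α, hα, β, hβ, by rw [hαβ, ← hf, add_sub_cancel_right]⟩

end SuspensionIso

/-! ### Finite chains and cones -/

section Cone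

variable {X : Type*} {Y : Type*} {M : Type*} [AddCommGroup M]

/-- The coarse structure in which all sets are entourages. Its coarse chains are the finite chains,
and every cochain is coarse with respect to it. -/
def indiscrete (X : Type*) : CoarseStructure X where
  entourages := univ
  diagonal_mem := mem_univ _
  subset_mem _ _ := mem_univ _
  union_mem _ _ := mem_univ _
  inv_mem _ := mem_univ _
  comp_mem _ _ := mem_univ _

lemma isBounded_indiscrete (K : Set X) : (indiscrete X).IsBounded K := mem_univ _

lemma isCoarseCochain_indiscrete {n : ℕ} (φ : (Fin (n + 1) → X) → M) :
    IsCoarseCochain (indiscrete X) φ := fun _ _ =>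
  ⟨{_}, finite_singleton _, by
    rintro _ rfl
    exact CoarseStructure.isBounded_power_iff.2 fun _ => isBounded_indiscrete _,
    (sUnion_singleton _).symm⟩

lemma isCoarseChain_indiscrete_iff {m : ℕ} {c : (Fin (m + 1) → X) → M} :
    IsCoarseChain (indiscrete X) c ↔ (Function.support c).Finite := by
  constructor
  · intro hc
    simpa using hc.2 univ (CoarseStructure.isBounded_power_iff.2 fun _ => isBounded_indiscrete _)
  · intro hc
    exact ⟨subset_penumbra_iff.2 ⟨univ, mem_univ _, fun _ _ _ _ => mem_univ _⟩,
      fun K _ => hc.subset inter_subset_left⟩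

/-- In a coarsely connected space, all finite chains are coarse chains. -/
lemma isCoarseChain_of_finite {𝓔 : CoarseStructure X} (hconn : 𝓔.IsCoarselyConnected) {m : ℕ}
    {c : (Fin (m + 1) → X) → M} (hc : (Function.support c).Finite) : IsCoarseChain 𝓔 c := by
  have hpair : ∀ p : X × X, {p} ∈ 𝓔.entourages := fun p => by
    obtain ⟨E, hE, hp⟩ := hconn p.1 p.2
    exact 𝓔.subset_mem hE (by simpa using hp)
  have hfin : ∀ s : Set (X × X), s.Finite → s ∈ 𝓔.entourages := fun s hs => by
    induction s, hs using Set.Finite.induction_on with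
    | empty => exact 𝓔.subset_mem 𝓔.diagonal_mem (empty_subset _)
    | insert _ _ ih => exact 𝓔.union_mem (hpair _) ih
  refine ⟨subset_penumbra_iff.2 ⟨⋃ x ∈ Function.support c, range fun p : Fin (m + 1) × Fin (m + 1) =>
    (x p.1, x p.2), hfin _ (hc.biUnion fun x _ => finite_range _), fun x hx i j => ?_⟩,
    fun K _ => hc.subset inter_subset_left⟩
  exact mem_biUnion hx ⟨(i, j), rfl⟩

/-- Finite chains, regarded as coarse chains of a coarsely connected space. -/
def ofFinite {𝓔 : CoarseStructure X} (hconn : 𝓔.IsCoarselyConnected) (m : ℕ) :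
    coarseChains M (indiscrete X) m →+ coarseChains M 𝓔 m :=
  AddMonoidHom.mk' (fun c => ⟨c.1, isCoarseChain_of_finite hconn
    (isCoarseChain_indiscrete_iff.1 c.2)⟩) fun _ _ => rfl

lemma ofFinite_mem_relBoundaries {𝓔 : CoarseStructure X} (hconn : 𝓔.IsCoarselyConnected) {A : Set X}
    {m : ℕ} {c : coarseChains M (indiscrete X) m}
    (hc : c ∈ relBoundaries (chainsIn M (indiscrete X) univ) (chainsIn M (indiscrete X) A) m) :
    ofFinite hconn m c ∈ relBoundaries (chainsIn M 𝓔 univ) (chainsIn M 𝓔 A) m := by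
  obtain ⟨e, -, s, hs, rfl⟩ := mem_relBoundaries.1 hc
  exact mem_relBoundaries.2 ⟨ofFinite hconn _ e, mem_chainsIn_univ _, ofFinite hconn _ s, hs, rfl⟩

lemma injective_cons {m : ℕ} (a : X) :
    Function.Injective fun x : Fin (m + 1) → X => (Fin.cons a x : Fin (m + 2) → X) :=
  Fin.cons_right_injective (α := fun _ => X) a

lemma FiniteFibres.of_injective {α β : Type*} {f : α → β} (hf : Function.Injective f)
    (c : α → M) : FiniteFibres f c := fun _ =>
  (Set.Subsingleton.finite fun _ h _ h' => hf (h.trans h'.symm)).inter_of_left _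

/-- The cone with vertex `a` over finite chains. -/
def cone (a : X) (m : ℕ) :
    coarseChains M (indiscrete X) m →+ coarseChains M (indiscrete X) (m + 1) :=
  AddMonoidHom.mk' (fun c => ⟨coneRaw a c.1, by
    refine isCoarseChain_indiscrete_iff.2 (((isCoarseChain_indiscrete_iff.1 c.2).image
      fun x => (Fin.cons a x : Fin (m + 2) → X)).subset fun y hy => ?_)
    obtain ⟨x, rfl, hx⟩ := exists_of_push_ne_zero hy
    exact ⟨x, hx, rfl⟩⟩) fun c d => by
      ext1
      exact push_add (.of_injective (injective_cons a) _) (.of_injective (injective_cons a) _)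

lemma cone_coe {a : X} {m : ℕ} (c : coarseChains M (indiscrete X) m) :
    (cone a m c).1 = coneRaw a c.1 := rfl

lemma cone_mem_chainsIn {A : Set X} {a : X} (ha : a ∈ A) {m : ℕ}
    {c : coarseChains M (indiscrete X) m} (hc : c ∈ chainsIn M (indiscrete X) A m) :
    cone a m c ∈ chainsIn M (indiscrete X) A (m + 1) := by
  intro y hy i
  obtain ⟨x, rfl, hx⟩ := exists_of_push_ne_zero hy
  refine Fin.cases ?_ (fun i => ?_) i
  · exact ha
  · exact hc x hx i

lemma finiteFibres_finite {β : Type*} {m : ℕ} (f : (Fin (m + 1) → X) → β)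
    (c : coarseChains M (indiscrete X) m) : FiniteFibres f c.1 :=
  .of_finite (isCoarseChain_indiscrete_iff.1 c.2)

/-- `∂ r_a c = c - r_a ∂ c` -/
lemma boundary_cone_succ (a : X) {m : ℕ} (c : coarseChains M (indiscrete X) (m + 1)) :
    boundary _ (m + 1) (cone a (m + 1) c) = c - cone a m (boundary _ m c) := by
  ext1
  have h0 : push (face 0) (coneRaw a c.1) = c.1 := by
    refine (push_push (finiteFibres_finite _ c)).trans ?_
    refine Eq.trans ?_ (push_id c.1)
    congr 1
  have hs : ∀ i : Fin (m + 2), push (face i.succ) (coneRaw a c.1) =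
      push (fun x => (Fin.cons a x : Fin (m + 2) → X)) (push (face i) c.1) := fun i => by
    rw [push_push (finiteFibres_finite _ c)]
    refine (push_push (finiteFibres_finite _ c)).trans ?_
    congr 1
    funext x k
    refine Fin.cases ?_ (fun k => ?_) k
    · simp [face]
    · simp [face]
  have hc : coneRaw a (boundary _ m c).1 = ∑ i : Fin (m + 2), (-1 : ℤ) ^ (i : ℕ) •
      push (fun x => (Fin.cons a x : Fin (m + 2) → X)) (push (face i) c.1) := by
    rw [coneRaw, boundary_coe, push_sum _ fun i _ => .of_injective (injective_cons a) _]
    exact Finset.sum_congr rfl fun i _ => push_zsmul (.of_injective (injective_cons a) _) _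
  rw [boundary_coe, Fin.sum_univ_succ, AddSubgroup.coe_sub, cone_coe, cone_coe, h0, hc,
    sub_eq_add_neg, ← Finset.sum_neg_distrib]
  congr 1
  · simp
  · exact Finset.sum_congr rfl fun i _ => by rw [hs, Fin.val_succ, pow_succ, mul_neg_one, neg_smul]

/-- A finite chain of positive degree is homologous to the cone over its boundary. -/
lemma sub_cone_boundary_mem {A : Set X} (a : X) {m : ℕ}
    (c : coarseChains M (indiscrete X) (m + 1)) :
    c - cone a m (boundary _ m c) ∈
      relBoundaries (chainsIn M (indiscrete X) univ) (chainsIn M (indiscrete X) A) (m + 1) := by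
  rw [← boundary_cone_succ]
  exact boundary_mem_relBoundaries (mem_chainsIn_univ _)

/-- A finite chain of degree zero is null-homologous relative to any nonempty subspace. -/
lemma mem_relBoundaries_of_finite {A : Set X} {a : X} (ha : a ∈ A)
    (c : coarseChains M (indiscrete X) 0) :
    c ∈ relBoundaries (chainsIn M (indiscrete X) univ) (chainsIn M (indiscrete X) A) 0 := by
  refine mem_relBoundaries.2 ⟨cone a 0 c, mem_chainsIn_univ _, c - boundary _ 0 (cone a 0 c), ?_,
    add_sub_cancel _ _⟩
  have h0 : push (face 0) (coneRaw a c.1) = c.1 := by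
    refine (push_push (finiteFibres_finite _ c)).trans ?_
    refine Eq.trans ?_ (push_id c.1)
    congr 1
  have h1 : push (face 1) (coneRaw a c.1) = push (fun _ _ => a) c.1 := by
    refine (push_push (finiteFibres_finite _ c)).trans ?_
    congr 1
    funext x k
    obtain rfl : k = 0 := Fin.fin_one_eq_zero k
    rfl
  intro y hy i
  have hval : (c - boundary _ 0 (cone a 0 c)).1 = push (fun _ _ => a) c.1 := by
    rw [AddSubgroup.coe_sub, boundary_coe, Fin.sum_univ_two, cone_coe, h0, h1]
    simp
  rw [hval] at hy
  obtain ⟨x, rfl, -⟩ := exists_of_push_ne_zero hy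
  exact ha

end Cone

/-! ### Cap products as slant products -/

section Cap

variable {X : Type*} {Y : Type*} {Z : Type*} {M₁ M₂ M₃ : Type*} [AddCommGroup M₁] [AddCommGroup M₂]
  [AddCommGroup M₃]

lemma CoarseStructure.IsCoarse.comp {𝓔 : CoarseStructure X} {𝓕 : CoarseStructure Y}
    {𝓖 : CoarseStructure Z} {f : X → Y} {g : Y → Z} (hg : 𝓕.IsCoarse 𝓖 g) (hf : 𝓔.IsCoarse 𝓕 f) :
    𝓔.IsCoarse 𝓖 (g ∘ f) := by
  refine ⟨fun E hE => ?_, fun K hK => hf.2 _ (hg.2 K hK)⟩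
  rw [← Prod.map_comp_map, image_comp]
  exact hg.1 _ (hf.1 E hE)

lemma push_apply_of_injective {α β : Type*} {f : α → β} (hf : Function.Injective f) (c : α → M₁)
    (a : α) : push f c (f a) = c a := by
  have h : f ⁻¹' {f a} = {a} := by
    ext x
    simp [hf.eq_iff]
  rw [push, h, finsum_mem_singleton]

/-- The slant product with the image under the diagonal is the cap product. -/
lemma slantRaw_diagonal (μ : M₁ →+ M₂ →+ M₃) {N k n : ℕ} (h : N = k + n)
    (c : (Fin (N + 1) → X) → M₁) (φ : (Fin (n + 1) → X) → M₂)
    (hfin : FiniteFibres (fun (z : Fin (N + 1) → X × X) (i : Fin (k + 1)) => (z (frontIdx h i)).1)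
      (fun z => μ (push (fun x => (fun p => (p, p)) ∘ x) c z)
        (φ fun j => (z (backIdx h j)).2))) :
    slantRaw μ h (push (fun x => (fun p => (p, p)) ∘ x) c) φ = capRaw μ h c φ := by
  have hinj : Function.Injective
      (fun x : Fin (N + 1) → X => ((fun p => (p, p)) ∘ x : Fin (N + 1) → X × X)) :=
    fun x y hxy => funext fun i => congrArg Prod.fst (congrFun hxy i)
  have hpull := push_apply_hom (FiniteFibres.of_injective hinj c)
    (fun z => μ.flip (φ fun j => (z (backIdx h j)).2))
  unfold slantRaw slantAux
  simp only [AddMonoidHom.flip_apply] at hpull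
  rw [hpull] at hfin ⊢
  refine push_push fun b => ?_
  refine ((hfin b).preimage hinj.injOn).subset fun x hx => ⟨hx.1, ?_⟩
  rw [Function.mem_support, push_apply_of_injective hinj]
  exact hx.2

/-- A map over `X` is coarse if the coarse structure of the second factor is forgotten. -/
lemma isCoarse_fst {a b : ℝ} (𝓔 : CoarseStructure X)
    {U : X → Set (Icc a b × Icc a b)} (hU : CoarseStructure.IsNhdFamily U)
    (f : X × Icc a b → Y) :
    (𝓔.warped U).IsCoarse (𝓔.prod (indiscrete Y)) fun p => (p.1, f p) := by
  refine ⟨fun E hE => ⟨_, 𝓔.isControlled_warped_fst U E hE, univ, mem_univ _, ?_⟩, fun K hK => ?_⟩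
  · rintro _ ⟨p, hp, rfl⟩
    exact ⟨⟨p, hp, rfl⟩, mem_univ _⟩
  · exact (𝓔.isBounded_warped hU (CoarseStructure.isBounded_prod_iff.1 hK).1).subset
      fun p hp => ⟨⟨_, hp, rfl⟩, mem_univ _⟩

lemma isCoarse_snd {a b : ℝ} (𝓔 : CoarseStructure X)
    {U : X → Set (Icc a b × Icc a b)} (hU : CoarseStructure.IsNhdFamily U)
    (f : X × Icc a b → Y) :
    (𝓔.warped U).IsCoarse ((indiscrete Y).prod 𝓔) fun p => (f p, p.1) := by
  refine ⟨fun E hE => ⟨univ, mem_univ _, _, 𝓔.isControlled_warped_fst U E hE, ?_⟩, fun K hK => ?_⟩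
  · rintro _ ⟨p, hp, rfl⟩
    exact ⟨mem_univ _, ⟨p, hp, rfl⟩⟩
  · exact (𝓔.isBounded_warped hU (CoarseStructure.isBounded_prod_iff.1 hK).2).subset
      fun p hp => ⟨⟨_, hp, rfl⟩, mem_univ _⟩

lemma chainMap_slice_coe {𝓔 : CoarseStructure X} {𝓕 : CoarseStructure Y} {ε : X → ℝ}
    {G : X × I → Y} (hG : (𝓔.warped (metricFamily (-1) 1 ε)).IsCoarse 𝓕 G) (t : I) {m : ℕ}
    (c : coarseChains M₁ 𝓔 m) : (chainMap hG m (slice M₁ 𝓔 ε t m c)).1 =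
      push (fun x => (fun p => G (p, t)) ∘ x) c.1 :=
  push_push (finiteFibres_of_proper (proper_reindex
    (hG.comp (𝓔.isCoarse_slice (metricFamily (-1) 1 ε) t)) c.2 id))

/-- `δ s_b φ = φ` for cocycles `φ` -/
lemma coboundary_contractRaw (b : X) {n : ℕ} {φ : (Fin (n + 2) → X) → M₂}
    (hφ : coboundary X M₂ (n + 1) φ = 0) : coboundary X M₂ n (contractRaw b φ) = φ := by
  funext x
  have h := congrFun hφ (Fin.cons b x)
  simp only [coboundary, AddMonoidHom.coe_mk, ZeroHom.coe_mk, Pi.zero_apply] at h ⊢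
  rw [Fin.sum_univ_succ] at h
  have h0 : face 0 (Fin.cons b x : Fin (n + 3) → X) = x := by
    funext k
    simp [face]
  have hs : ∀ i : Fin (n + 2), face i.succ (Fin.cons b x : Fin (n + 3) → X) =
      (Fin.cons b (face i x) : Fin (n + 2) → X) := fun i => by
    funext k
    refine Fin.cases ?_ (fun k => ?_) k <;> simp [face]
  simp only [h0, hs, Fin.val_zero, pow_zero, one_smul, Fin.val_succ, pow_succ, mul_neg_one,
    neg_smul, Finset.sum_neg_distrib, ← sub_eq_add_neg] at h
  exact (sub_eq_zero.1 h).symm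

/-- A cocycle of degree zero which vanishes on a nonempty subspace is zero. -/
lemma eq_zero_of_cocycle_zero {φ : (Fin 1 → X) → M₂} (hφ : coboundary X M₂ 0 φ = 0) {b : X}
    (hb : φ (fun _ => b) = 0) : φ = 0 := by
  funext x
  have h := congrFun hφ (Fin.cons (x 0) fun _ => b)
  simp only [coboundary, AddMonoidHom.coe_mk, ZeroHom.coe_mk, Pi.zero_apply] at h
  rw [Fin.sum_univ_two] at h
  have h0 : face 0 (Fin.cons (x 0) fun _ => b : Fin 2 → X) = fun _ => b := by
    funext k
    simp [face]
  have h1 : face 1 (Fin.cons (x 0) fun _ => b : Fin 2 → X) = x := by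
    funext k
    obtain rfl : k = 0 := Fin.fin_one_eq_zero k
    rfl
  rw [h0, h1, hb] at h
  simpa using h

end Cap

/-! ### The slant product on the two halves of the suspension -/

section Halves

variable {X : Type u} {M₁ M₂ M₃ : Type*} [AddCommGroup M₁] [AddCommGroup M₂] [AddCommGroup M₃]

lemma Gamma_of_le {𝓔 : CoarseStructure X} {B : Set X} {HA HB : X × Icc (0 : ℝ) 1 → X}
    (hB : 𝓔.IsDeformation B HB) {p : X × I} (hp : p.2 ≤ middle) :
    Gamma HA HB p = (HA (p.1, projIcc 0 1 zero_le_one (-(p.2 : ℝ))), p.1) := by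
  rw [Gamma, projIcc_of_le_left zero_le_one (show (p.2 : ℝ) ≤ 0 from hp)]
  exact Prod.ext rfl (hB.2.1 _)

lemma Gamma_of_ge {𝓔 : CoarseStructure X} {A : Set X} {HA HB : X × Icc (0 : ℝ) 1 → X}
    (hA : 𝓔.IsDeformation A HA) {p : X × I} (hp : middle ≤ p.2) :
    Gamma HA HB p = (p.1, HB (p.1, projIcc 0 1 zero_le_one (p.2 : ℝ))) := by
  rw [Gamma, projIcc_of_le_left zero_le_one (neg_nonpos.2 (show (0 : ℝ) ≤ p.2 from hp))]
  exact Prod.ext (hA.2.1 _) rfl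

lemma chainMap_mem_of_forall {𝓔 : CoarseStructure X} {Y : Type*} {𝓕 : CoarseStructure Y} {f : X → Y}
    (hf : 𝓔.IsCoarse 𝓕 f) {Q : Set X} {R : Set Y} (h : ∀ p ∈ Q, f p ∈ R) {m : ℕ}
    {c : coarseChains M₁ 𝓔 m} (hc : c ∈ chainsIn M₁ 𝓔 Q m) :
    chainMap hf m c ∈ chainsIn M₁ 𝓕 R m := chainsIn_le_comap hf h m hc

lemma slice_mem_chainsIn {𝓔 : CoarseStructure X} {ε : X → ℝ} (t : I) {m : ℕ}
    (c : coarseChains M₁ 𝓔 m) : slice M₁ 𝓔 ε t m c ∈ chainsIn M₁ _ {p | p.2 = t} m := by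
  intro y hy i
  obtain ⟨x, rfl, -⟩ := exists_of_push_ne_zero hy
  rfl

lemma slantChain_coe (μ : M₁ →+ M₂ →+ M₃) {Y : Type*} {𝓔 : CoarseStructure X}
    {𝓕 : CoarseStructure Y} {B : Set Y} {N k n : ℕ} (h : N = k + n)
    (c : coarseChains M₁ (𝓔.prod 𝓕) N) (φ : coarseCochains M₂ 𝓕 B n) :
    (slantChain μ 𝓔 𝓕 B h c φ).1 = slantRaw μ h c.1 φ.1 := rfl

/-- The slant product of the middle slice is the cap product. -/
lemma slantChain_middle (μ : M₁ →+ M₂ →+ M₃) {𝓔 𝓔₁ 𝓔₂ : CoarseStructure X} {B : Set X} {ε : X → ℝ}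
    {G : X × I → X × X} (hG : (𝓔.warped (metricFamily (-1) 1 ε)).IsCoarse (𝓔₁.prod 𝓔₂) G)
    (hmid : ∀ x, G (x, middle) = (x, x)) {m k n : ℕ} (h : m = k + n) (c : coarseChains M₁ 𝓔 m)
    (φ : coarseCochains M₂ 𝓔₂ B n) :
    (slantChain μ 𝓔₁ 𝓔₂ B h (chainMap hG m (slice M₁ 𝓔 ε middle m c)) φ).1 =
      capRaw μ h c.1 φ.1 := by
  have hval : (chainMap hG m (slice M₁ 𝓔 ε middle m c)).1 =
      push (fun x => (fun p => (p, p)) ∘ x) c.1 := by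
    rw [chainMap_slice_coe hG]
    congr 1
    funext x i
    exact hmid _
  have hfin := slantAux_finiteFibres μ (frontIdx h) (backIdx h)
    (chainMap hG m (slice M₁ 𝓔 ε middle m c)).2 φ.2.1
  rw [slantChain_coe, hval]
  rw [hval] at hfin
  exact slantRaw_diagonal μ h c.1 φ.1 hfin

variable {𝓔 : CoarseStructure X} {A B : Set X} {HA HB : X × Icc (0 : ℝ) 1 → X} {ε : X → ℝ}

/-- The lower half of the suspension contributes the first term of the Roe secondary cap product. On
this half the second component of `Γ` is the projection to `X`, so that the slant product with a
coarse cochain is a finite chain, and hence homologous to the cone over its boundary. -/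
theorem slant_lower (μ : M₁ →+ M₂ →+ M₃) (hconn : 𝓔.IsCoarselyConnected)
    (hA : 𝓔.IsDeformation A HA) (hB : 𝓔.IsDeformation B HB) (hε : ∀ x, 0 < ε x) {a : X} (ha : a ∈ A)
    {m n k : ℕ} (h : m + 1 = k + n) (c : coarseChains M₁ 𝓔 m) (φ : coarseCocycles M₂ 𝓔 B n)
    {z : coarseChains M₁ (𝓔.warped (metricFamily (-1) 1 ε)) (m + 1)}
    (hz : z ∈ chainsIn M₁ _ (band univ lower middle) (m + 1))
    {α β : coarseChains M₁ (𝓔.warped (metricFamily (-1) 1 ε)) m}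
    (hα : α ∈ chainsIn M₁ _ (band A lower middle) m)
    (hβ : β ∈ chainsIn M₁ _ (band B lower middle) m)
    (hbd : boundary _ m z = slice M₁ 𝓔 ε middle m c - slice M₁ 𝓔 ε lower m c - (α + β)) :
    ∃ D R : coarseChains M₃ 𝓔 k, D.1 = slantRaw μ h (push (fun x => Gamma HA HB ∘ x) z.1) φ.1 ∧
      R.1 = roeFirst μ a h c.1 φ.1 ∧
      D - R ∈ relBoundaries (chainsIn M₃ 𝓔 univ) (chainsIn M₃ 𝓔 A) k := by
  have hG := isCoarse_snd 𝓔 (isNhdFamily_metricFamily (-1) 1 hε)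
    (fun p => HA (p.1, projIcc 0 1 zero_le_one (-(p.2 : ℝ))))
  set G : X × I → X × X := fun p => (HA (p.1, projIcc 0 1 zero_le_one (-(p.2 : ℝ))), p.1) with hGdef
  set φ' : coarseCochains M₂ 𝓔 B n := ⟨φ.1, φ.2.1⟩ with hφ'
  set D : coarseChains M₃ (indiscrete X) k :=
    slantChain μ (indiscrete X) 𝓔 B h (chainMap hG (m + 1) z) φ' with hD
  have hDval : (ofFinite hconn k D).1 =
      slantRaw μ h (push (fun x => Gamma HA HB ∘ x) z.1) φ.1 := by
    change slantRaw μ h (push (fun x => G ∘ x) z.1) φ.1 = _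
    congr 1
    exact push_congr fun x hx => funext fun i => (Gamma_of_le hB (hz x hx i).2.2).symm
  cases k with
  | zero =>
    refine ⟨ofFinite hconn 0 D, 0, hDval, rfl, ?_⟩
    rw [sub_zero]
    exact ofFinite_mem_relBoundaries hconn (mem_relBoundaries_of_finite ha D)
  | succ k =>
    have h' : m = k + n := by omega
    set C : coarseChains M₃ (indiscrete X) k :=
      slantChain μ (indiscrete X) 𝓔 B h' (chainMap hG m (slice M₁ 𝓔 ε middle m c)) φ' with hC
    have hCval : C.1 = capRaw μ h' c.1 φ.1 := by
      refine slantChain_middle μ hG (fun x => ?_) h' c φ'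
      refine Prod.ext ?_ rfl
      change HA (x, projIcc 0 1 zero_le_one (-(0 : ℝ))) = x
      rw [projIcc_of_le_left zero_le_one (neg_zero.le)]
      exact hA.2.1 x
    set s := chainMap hG m (slice M₁ 𝓔 ε lower m c) + (chainMap hG m α + chainMap hG m β) with hs
    have hsum : s ∈ chainsSum M₁ ((indiscrete X).prod 𝓔) (A ×ˢ univ) (univ ×ˢ B) m := by
      refine add_mem (AddSubgroup.mem_sup_left ?_) (AddSubgroup.add_mem_sup ?_ ?_)
      · refine chainMap_mem_of_forall hG (Q := {p | p.2 = lower}) ?_ ?_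
        · rintro ⟨x, t⟩ (rfl : t = lower)
          refine ⟨?_, mem_univ _⟩
          change HA (x, projIcc 0 1 zero_le_one (-(-1 : ℝ))) ∈ A
          rw [neg_neg, projIcc_right]
          exact hA.2.2.1 x
        · exact slice_mem_chainsIn _ c
      · exact chainMap_mem_of_forall hG (R := A ×ˢ univ) (fun p hp =>
          ⟨hA.2.2.2 _ hp.1 _, mem_univ _⟩) hα
      · exact chainMap_mem_of_forall hG (R := univ ×ˢ B) (fun p hp =>
          ⟨mem_univ _, hp.1⟩) hβ
    have hbD : boundary _ k D = C - slantChain μ (indiscrete X) 𝓔 B h' s φ' := by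
      have key := slant_boundary μ h' h (show m + 1 = k + (n + 1) by omega)
        (chainMap hG (m + 1) z) φ'
      rw [show coboundary X M₂ n φ'.1 = 0 from φ.2.2, slantRaw_zero, smul_zero, add_zero] at key
      have hbz : boundary _ m (chainMap hG (m + 1) z) =
          chainMap hG m (slice M₁ 𝓔 ε middle m c) - s := by
        rw [← chainMap_boundary, hbd, sub_sub, map_sub, map_add, map_add]
      rw [← Subtype.ext key, hbz, map_sub, AddMonoidHom.sub_apply]
    refine ⟨ofFinite hconn _ D, ofFinite hconn _ (cone a k C), hDval, ?_, ?_⟩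
    · change coneRaw a C.1 = coneRaw a (capRaw μ _ c.1 φ.1)
      rw [hCval]
    · rw [← map_sub]
      refine ofFinite_mem_relBoundaries hconn ?_
      have h1 := sub_cone_boundary_mem (A := A) a D
      rw [hbD, map_sub] at h1
      have h2 := sub_mem h1 (mem_relBoundaries_of_mem (T := chainsIn M₃ (indiscrete X) univ)
        (cone_mem_chainsIn ha (slantChain_mem_chainsIn μ h' hsum φ')))
      rwa [sub_sub, sub_add_cancel] at h2

/-- The upper half of the suspension contributes the second term of the Roe secondary cap product.
On this half the first component of `Γ` is the projection to `X`, so that the slant product with any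
cochain is locally finite, and `δ s_b φ = φ`. -/
theorem slant_upper (μ : M₁ →+ M₂ →+ M₃)
    (hA : 𝓔.IsDeformation A HA) (hB : 𝓔.IsDeformation B HB) (hε : ∀ x, 0 < ε x) {b : X} (hb : b ∈ B)
    {m n k : ℕ} (h : m + 1 = k + n) (c : coarseChains M₁ 𝓔 m) (φ : coarseCocycles M₂ 𝓔 B n)
    {z : coarseChains M₁ (𝓔.warped (metricFamily (-1) 1 ε)) (m + 1)}
    (hz : z ∈ chainsIn M₁ _ (band univ middle upper) (m + 1))
    {α β : coarseChains M₁ (𝓔.warped (metricFamily (-1) 1 ε)) m}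
    (hα : α ∈ chainsIn M₁ _ (band A middle upper) m)
    (hβ : β ∈ chainsIn M₁ _ (band B middle upper) m)
    (hbd : boundary _ m z = slice M₁ 𝓔 ε upper m c - slice M₁ 𝓔 ε middle m c - (α + β)) :
    ∃ D R : coarseChains M₃ 𝓔 k, D.1 = slantRaw μ h (push (fun x => Gamma HA HB ∘ x) z.1) φ.1 ∧
      R.1 = roeSecond μ b h c.1 φ.1 ∧
      D - (-1 : ℤ) ^ m • R ∈ relBoundaries (chainsIn M₃ 𝓔 univ) (chainsIn M₃ 𝓔 A) k := by
  cases n with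
  | zero =>
    have hφ : φ.1 = 0 := eq_zero_of_cocycle_zero φ.2.2 (φ.2.1.2 (fun _ => b) fun _ => hb)
    refine ⟨0, 0, ?_, rfl, by simp⟩
    rw [hφ, slantRaw_zero]
    rfl
  | succ n =>
    have h' : m = k + n := by omega
    have hG := isCoarse_fst 𝓔 (isNhdFamily_metricFamily (-1) 1 hε)
      (fun p => HB (p.1, projIcc 0 1 zero_le_one (p.2 : ℝ)))
    set G : X × I → X × X := fun p => (p.1, HB (p.1, projIcc 0 1 zero_le_one (p.2 : ℝ))) with hGdef
    set ψ : coarseCochains M₂ (indiscrete X) B n := ⟨contractRaw b φ.1, isCoarseCochain_indiscrete _,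
      fun x hx => φ.2.1.2 _ fun i => Fin.cases hb hx i⟩ with hψ
    set C : coarseChains M₃ 𝓔 k :=
      slantChain μ 𝓔 (indiscrete X) B h' (chainMap hG m (slice M₁ 𝓔 ε middle m c)) ψ with hC
    have hCval : C.1 = capRaw μ h' c.1 (contractRaw b φ.1) := by
      refine slantChain_middle μ hG (fun x => ?_) h' c ψ
      refine Prod.ext rfl ?_
      change HB (x, projIcc 0 1 zero_le_one (0 : ℝ)) = x
      rw [projIcc_left]
      exact hB.2.1 x
    set s := (chainMap hG m α + chainMap hG m β) - chainMap hG m (slice M₁ 𝓔 ε upper m c) with hs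
    have hsum : s ∈ chainsSum M₁ (𝓔.prod (indiscrete X)) (A ×ˢ univ) (univ ×ˢ B) m := by
      refine sub_mem (AddSubgroup.add_mem_sup ?_ ?_) (AddSubgroup.mem_sup_right ?_)
      · exact chainMap_mem_of_forall hG (R := A ×ˢ univ) (fun p hp =>
          ⟨hp.1, mem_univ _⟩) hα
      · exact chainMap_mem_of_forall hG (R := univ ×ˢ B) (fun p hp =>
          ⟨mem_univ _, hB.2.2.2 _ hp.1 _⟩) hβ
      · refine chainMap_mem_of_forall hG (Q := {p | p.2 = upper}) ?_ ?_
        · rintro ⟨x, t⟩ (rfl : t = upper)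
          refine ⟨mem_univ _, ?_⟩
          change HB (x, projIcc 0 1 zero_le_one (1 : ℝ)) ∈ B
          rw [projIcc_right]
          exact hB.2.2.1 x
        · exact slice_mem_chainsIn _ c
    have hbz : boundary _ m (chainMap hG (m + 1) z) =
        -(chainMap hG m (slice M₁ 𝓔 ε middle m c) + s) := by
      rw [← chainMap_boundary, hbd, hs, map_sub, map_sub, map_add]
      abel
    set e := slantChain μ 𝓔 (indiscrete X) B (show m + 1 = (k + 1) + n by omega)
      (chainMap hG (m + 1) z) ψ with he
    set σ := slantChain μ 𝓔 (indiscrete X) B h' s ψ with hσ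
    have key := slant_boundary μ h' (show m + 1 = (k + 1) + n by omega) h (chainMap hG (m + 1) z) ψ
    rw [show coboundary X M₂ n ψ.1 = φ.1 from coboundary_contractRaw b φ.2.2, hbz, map_neg, map_add,
      AddMonoidHom.neg_apply, AddMonoidHom.add_apply, ← hC, ← hσ, ← he] at key
    -- The sign is its own inverse, so the boundary formula can be solved for the slant product.
    have hsign : ∀ y : (Fin (k + 1) → X) → M₃, (-1 : ℤ) ^ m • ((-1 : ℤ) ^ (m + 1) • y) = -y :=
      fun y => by
        rw [smul_smul, ← pow_add, show m + (m + 1) = 2 * m + 1 by ring, pow_succ, pow_mul]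
        simp
    -- `C` is the contribution of the middle slice and `σ` that of the sides and the upper slice, which
    -- lies in `A`, as `s_b φ` vanishes on `B`.
    refine ⟨(-1 : ℤ) ^ m • (C + σ + boundary 𝓔 k e), C, ?_, hCval, ?_⟩
    · have hpush : push (fun x => Gamma HA HB ∘ x) z.1 = (chainMap hG (m + 1) z).1 :=
        push_congr fun x hx => funext fun i => Gamma_of_ge hA (hz x hx i).2.1
      rw [hpush]
      have h3 := congrArg (fun y => (-1 : ℤ) ^ m • y) (eq_sub_of_add_eq' key.symm)
      simp only [hsign] at h3
      rw [neg_eq_iff_eq_neg] at h3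
      rw [h3, AddSubgroup.coe_zsmul, AddSubgroup.coe_add, AddSubgroup.coe_neg, ← smul_neg]
      congr 1
      rw [neg_sub, sub_neg_eq_add]
      exact add_comm _ _
    · rw [← smul_sub, add_assoc, add_sub_cancel_left]
      refine zsmul_mem (add_mem ?_ (boundary_mem_relBoundaries (mem_chainsIn_univ _))) _
      exact mem_relBoundaries_of_mem (slantChain_mem_chainsIn μ h' hsum ψ)

end Halves

/-! ### Families of neighbourhoods supporting `Γ` -/

section Family

variable {X : Type u}

lemma IsBounded.union {𝓔 : CoarseStructure X} (hconn : 𝓔.IsCoarselyConnected) {K L : Set X}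
    (hK : 𝓔.IsBounded K) (hL : 𝓔.IsBounded L) : 𝓔.IsBounded (K ∪ L) := by
  rcases K.eq_empty_or_nonempty with rfl | ⟨x, hx⟩
  · rwa [empty_union]
  rcases L.eq_empty_or_nonempty with rfl | ⟨y, hy⟩
  · rwa [union_empty]
  obtain ⟨E, hE, hxy⟩ := hconn x y
  have hKx : K ∪ L ⊆ penumbra (diagonal X ∪ K ×ˢ K ∪ {p | ∃ z, (p.1, z) ∈ L ×ˢ L ∧
      (z, p.2) ∈ {q : X × X | (q.2, q.1) ∈ E}}) {x} := by
    rintro z (hz | hz)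
    · exact ⟨x, rfl, Or.inl (Or.inr ⟨hz, hx⟩)⟩
    · exact ⟨x, rfl, Or.inr ⟨y, ⟨hz, hy⟩, hxy⟩⟩
  exact ((isBounded_singleton x).penumbra (𝓔.union_mem (𝓔.union_mem 𝓔.diagonal_mem hK)
    (𝓔.comp_mem hL (𝓔.inv_mem hE)))).subset hKx

/-- `t⁻ = max(-t, 0)` -/
def negPart (t : I) : Icc (0 : ℝ) 1 := projIcc 0 1 zero_le_one (-(t : ℝ))

/-- `t⁺ = max(t, 0)` -/
def posPart (t : I) : Icc (0 : ℝ) 1 := projIcc 0 1 zero_le_one (t : ℝ)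

lemma posPart_sub_negPart (t : I) : (posPart t : ℝ) - negPart t = t := by
  obtain ⟨t, h1, h2⟩ := t
  change max 0 (min 1 t) - max 0 (min 1 (-t)) = t
  rcases le_total 0 t with h | h
  · rw [min_eq_right h2, max_eq_right h, min_eq_right (by linarith), max_eq_left (by linarith),
      sub_zero]
  · rw [min_eq_right h2, max_eq_left h, min_eq_right (by linarith), max_eq_right (by linarith)]
    ring

lemma uniformContinuous_negPart : UniformContinuous negPart :=
  CompactSpace.uniformContinuous_of_continuous
    (continuous_projIcc.comp (continuous_neg.comp continuous_subtype_val))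

lemma uniformContinuous_posPart : UniformContinuous posPart :=
  CompactSpace.uniformContinuous_of_continuous (continuous_projIcc.comp continuous_subtype_val)

/-- There is a family in `𝒩^σ(X, A ∪ B; I)` for which `Γ` is a coarse map. -/
theorem exists_family {𝓔 : CoarseStructure X} (hconn : 𝓔.IsCoarselyConnected) {A B : Set X}
    {HA HB : X × Icc (0 : ℝ) 1 → X} (hA : 𝓔.IsDeformation A HA) (hB : 𝓔.IsDeformation B HB) :
    ∃ U : X → Set (I × I), 𝓔.IsSuspensionFamily (A ∪ B) U ∧
      (𝓔.warped U).IsCoarse (𝓔.prod 𝓔) (Gamma HA HB) := by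
  obtain ⟨UA, hUA, hcA⟩ := hA.1
  obtain ⟨UB, hUB, hcB⟩ := hB.1
  set U : X → Set (I × I) := fun x => Prod.map negPart negPart ⁻¹' UA x ∩
    Prod.map posPart posPart ⁻¹' UB x with hU
  have hnhd : CoarseStructure.IsNhdFamily U := by
    intro x
    have h1 := hUA.1 x
    have h2 := hUB.1 x
    rw [nhdsSet_diagonal_eq_uniformity] at h1 h2 ⊢
    exact Filter.inter_mem (uniformContinuous_negPart h1) (uniformContinuous_posPart h2)
  refine ⟨U, ⟨hnhd, fun ε hε => ?_⟩, ?_, fun K hK => ?_⟩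
  · obtain ⟨E, hE, hEA⟩ := hUA.2 (ε / 2) (half_pos hε)
    obtain ⟨F, hF, hFB⟩ := hUB.2 (ε / 2) (half_pos hε)
    refine ⟨E ∪ F, 𝓔.union_mem hE hF, fun x hx p hp => ?_⟩
    have h1 := hEA x (fun ⟨y, hy, hxy⟩ => hx ⟨y, Or.inl hy, Or.inl hxy⟩) _ hp.1
    have h2 := hFB x (fun ⟨y, hy, hxy⟩ => hx ⟨y, Or.inr hy, Or.inr hxy⟩) _ hp.2
    rw [← posPart_sub_negPart p.1, ← posPart_sub_negPart p.2, sub_sub_sub_comm]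
    refine (abs_sub _ _).trans ?_
    simp only [Prod.map_fst, Prod.map_snd] at h1 h2
    linarith
  · refine CoarseStructure.isControlled_generate ?_
    rintro _ (⟨E, hE, rfl⟩ | rfl)
    · refine ⟨_, hcA _ (𝓔.horizontal_mem_warped UA hE), _, hcB _ (𝓔.horizontal_mem_warped UB hE), ?_⟩
      rintro _ ⟨p, hp, rfl⟩
      exact ⟨⟨((p.1.1, negPart p.1.2), (p.2.1, negPart p.2.2)), ⟨hp.1, congrArg negPart hp.2⟩, rfl⟩,
        ⟨((p.1.1, posPart p.1.2), (p.2.1, posPart p.2.2)), ⟨hp.1, congrArg posPart hp.2⟩, rfl⟩⟩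
    · refine ⟨_, hcA _ (𝓔.vertical_mem_warped UA), _, hcB _ (𝓔.vertical_mem_warped UB), ?_⟩
      rintro _ ⟨p, hp, rfl⟩
      exact ⟨⟨((p.1.1, negPart p.1.2), (p.2.1, negPart p.2.2)), ⟨hp.1, hp.2.1⟩, rfl⟩,
        ⟨((p.1.1, posPart p.1.2), (p.2.1, posPart p.2.2)), ⟨hp.1, hp.2.2⟩, rfl⟩⟩
  · obtain ⟨h1, h2⟩ := CoarseStructure.isBounded_prod_iff.1 hK
    refine (𝓔.isBounded_warped hnhd (IsBounded.union hconn h1 h2)).subset fun p hp => ⟨?_, mem_univ _⟩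
    rcases le_total p.2 middle with ht | ht
    · exact Or.inr ⟨_, hp, by rw [Gamma_of_le hB ht]⟩
    · exact Or.inl ⟨_, hp, by rw [Gamma_of_ge hA ht]⟩

/-- Families of neighbourhoods have metric refinements. -/
lemma exists_metricFamily_subset {U : X → Set (I × I)} (hU : CoarseStructure.IsNhdFamily U) :
    ∃ ε : X → ℝ, (∀ x, 0 < ε x) ∧ ∀ x, metricFamily (-1) 1 ε x ⊆ U x := by
  have h : ∀ x, ∃ ε > 0, ∀ p : I × I, |(p.1 : ℝ) - p.2| < ε → p ∈ U x := fun x => by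
    have hUx := hU x
    rw [nhdsSet_diagonal_eq_uniformity, Metric.mem_uniformity_dist] at hUx
    obtain ⟨ε, hε, h⟩ := hUx
    exact ⟨ε, hε, fun p hp => h hp⟩
  choose ε hε h using h
  exact ⟨ε, hε, fun x p hp => h x p hp⟩

end Family

/-! ### Comparison of the two products -/

section Comparison

variable {X : Type u} {M₁ M₂ M₃ : Type*} [AddCommGroup M₁] [AddCommGroup M₂] [AddCommGroup M₃]
  {𝓔 : CoarseStructure X} {A B : Set X} {ε : X → ℝ}

/-- The two halves of the suspension of a relative cycle `c`, the parts `α₁ + α₂` and `β₁ + β₂` of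
their boundaries lying over `A` and `B`. -/
structure SuspensionChain (M : Type*) [AddCommGroup M] (𝓔 : CoarseStructure X) (A B : Set X)
    (ε : X → ℝ) {m : ℕ} (c : coarseChains M 𝓔 m) where
  (z₁ z₂ : coarseChains M (𝓔.warped (metricFamily (-1) 1 ε)) (m + 1))
  (α₁ β₁ α₂ β₂ : coarseChains M (𝓔.warped (metricFamily (-1) 1 ε)) m)
  hz₁ : z₁ ∈ chainsIn M _ (band univ lower middle) (m + 1)
  hz₂ : z₂ ∈ chainsIn M _ (band univ middle upper) (m + 1)
  hα₁ : α₁ ∈ chainsIn M _ (band A lower middle) m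
  hβ₁ : β₁ ∈ chainsIn M _ (band B lower middle) m
  hα₂ : α₂ ∈ chainsIn M _ (band A middle upper) m
  hβ₂ : β₂ ∈ chainsIn M _ (band B middle upper) m
  boundary₁ : boundary _ m z₁ = slice M 𝓔 ε middle m c - slice M 𝓔 ε lower m c - (α₁ + β₁)
  boundary₂ : boundary _ m z₂ = slice M 𝓔 ε upper m c - slice M 𝓔 ε middle m c - (α₂ + β₂)

lemma exists_suspensionChain (hε : ∀ x, 0 < ε x) {m : ℕ}
    (c : relCycles (chainsIn M₁ 𝓔 univ) (chainsSum M₁ 𝓔 A B) m) :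
    Nonempty (SuspensionChain M₁ 𝓔 A B ε c.1) := by
  obtain ⟨z₁, hz₁, α₁, hα₁, β₁, hβ₁, h₁⟩ := exists_sweep 𝓔 hε c.2 (lower_le middle)
  obtain ⟨z₂, hz₂, α₂, hα₂, β₂, hβ₂, h₂⟩ := exists_sweep 𝓔 hε c.2 (le_upper middle)
  exact ⟨⟨z₁, z₂, α₁, β₁, α₂, β₂, hz₁, hz₂, hα₁, hβ₁, hα₂, hβ₂, h₁, h₂⟩⟩

namespace SuspensionChain

variable {m : ℕ} {c : coarseChains M₁ 𝓔 m} (Z : SuspensionChain M₁ 𝓔 A B ε c)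

/-- The suspension of `c`, with the sign which makes its boundary the slice `X × {-1}`. -/
def total : coarseChains M₁ (𝓔.warped (metricFamily (-1) 1 ε)) (m + 1) := -(Z.z₁ + Z.z₂)

lemma boundary_total : boundary _ m Z.total = slice M₁ 𝓔 ε lower m c - slice M₁ 𝓔 ε upper m c +
    (Z.α₁ + Z.α₂ + (Z.β₁ + Z.β₂)) := by
  rw [total, map_neg, map_add, Z.boundary₁, Z.boundary₂]
  abel

lemma sides_mem : Z.α₁ + Z.α₂ ∈ chainsIn M₁ (𝓔.warped (metricFamily (-1) 1 ε)) {p | p.1 ∈ A} m ∧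
    Z.β₁ + Z.β₂ ∈ chainsIn M₁ (𝓔.warped (metricFamily (-1) 1 ε)) {p | p.1 ∈ B} m :=
  ⟨add_mem (chainsIn_mono (fun _ h => h.1) m Z.hα₁) (chainsIn_mono (fun _ h => h.1) m Z.hα₂),
    add_mem (chainsIn_mono (fun _ h => h.1) m Z.hβ₁) (chainsIn_mono (fun _ h => h.1) m Z.hβ₂)⟩

lemma upperBoundary_mem : -slice M₁ 𝓔 ε upper m c + (Z.α₁ + Z.α₂ + (Z.β₁ + Z.β₂)) ∈
    chainsIn M₁ (𝓔.warped (metricFamily (-1) 1 ε)) (suspUpper (A ∪ B)) m :=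
  add_mem (neg_mem (chainsIn_mono (fun _ h => Or.inl h) m (slice_mem_chainsIn upper c)))
    (add_mem (chainsIn_mono (fun _ h => Or.inr (Or.inl h)) m Z.sides_mem.1)
      (chainsIn_mono (fun _ h => Or.inr (Or.inr h)) m Z.sides_mem.2))

lemma total_mem : Z.total ∈ relCycles (chainsIn M₁ (𝓔.warped (metricFamily (-1) 1 ε)) univ)
    (chainsIn M₁ _ (suspBoundary (A ∪ B))) (m + 1) := by
  refine ⟨mem_chainsIn_univ _, ?_⟩
  change boundary _ m Z.total ∈ chainsIn M₁ _ (suspBoundary (A ∪ B)) m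
  rw [Z.boundary_total, sub_eq_add_neg, add_assoc]
  exact add_mem (chainsIn_mono (fun _ h => Or.inl h) m (slice_mem_chainsIn lower c))
    (chainsIn_mono (fun _ h => Or.inr h) m Z.upperBoundary_mem)

end SuspensionChain

lemma connecting_total {m : ℕ} (c : relCycles (chainsIn M₁ 𝓔 univ) (chainsSum M₁ 𝓔 A B) m)
    (Z : SuspensionChain M₁ 𝓔 A B ε c.1) :
    connecting (chainsIn M₁ _ univ) (chainsIn M₁ _ (suspBoundary (A ∪ B)))
      (chainsIn M₁ _ (suspUpper (A ∪ B))) m (homologyClass _ _ (m + 1) ⟨Z.total, Z.total_mem⟩) =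
      HX.map (𝓔.isCoarse_slice (metricFamily (-1) 1 ε) lower) (W := suspBoundary (A ∪ B))
        (D := suspUpper (A ∪ B)) (fun _ _ => Or.inl rfl) (fun _ h => Or.inr h) m
        (HXsum.toUnion M₁ 𝓔 A B m (homologyClass _ _ m c)) := by
  refine (homologyClass_eq_iff _ _).2 (mem_relBoundaries_of_mem ?_)
  change boundary _ m Z.total - slice M₁ 𝓔 ε lower m c.1 ∈ _
  rw [Z.boundary_total, sub_eq_add_neg (slice M₁ 𝓔 ε lower m c.1), add_assoc, add_sub_cancel_left]
  exact Z.upperBoundary_mem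

/-- Every class has a suspension. -/
theorem exists_connecting_eq (hexc : 𝓔.IsExcisive A B) (hε : ∀ x, 0 < ε x) {m : ℕ}
    (x : HX M₁ 𝓔 univ (A ∪ B) m) :
    ∃ ζ, connecting (chainsIn M₁ (𝓔.warped (metricFamily (-1) 1 ε)) univ)
      (chainsIn M₁ _ (suspBoundary (A ∪ B))) (chainsIn M₁ _ (suspUpper (A ∪ B))) m ζ =
      HX.map (𝓔.isCoarse_slice (metricFamily (-1) 1 ε) lower) (W := suspBoundary (A ∪ B))
        (D := suspUpper (A ∪ B)) (fun _ _ => Or.inl rfl) (fun _ h => Or.inr h) m x := by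
  obtain ⟨y, rfl⟩ := toUnion_surjective hexc m x
  obtain ⟨c, rfl⟩ := homologyClass_surjective _ _ _ y
  obtain ⟨Z⟩ := exists_suspensionChain hε c
  exact ⟨_, connecting_total c Z⟩

/-- The suspension homomorphism, for a family of metric neighbourhoods. -/
theorem exists_suspensionHom (hexc : 𝓔.IsExcisive A B) (hε : ∀ x, 0 < ε x) (m : ℕ) :
    ∃ σ : HX M₁ 𝓔 univ (A ∪ B) m →+
        HX M₁ (𝓔.warped (metricFamily (-1) 1 ε)) univ (suspBoundary (A ∪ B)) (m + 1),
      ∀ x, connecting (chainsIn M₁ _ univ)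
        (chainsIn M₁ _ (suspBoundary (A ∪ B))) (chainsIn M₁ _ (suspUpper (A ∪ B))) m (σ x) =
        HX.map (𝓔.isCoarse_slice (metricFamily (-1) 1 ε) lower) (W := suspBoundary (A ∪ B))
          (D := suspUpper (A ∪ B)) (fun _ _ => Or.inl rfl) (fun _ h => Or.inr h) m x := by
  choose σ hσ using exists_connecting_eq (M₁ := M₁) (m := m) hexc hε
  refine ⟨AddMonoidHom.mk' σ fun x y => connecting_injective 𝓔 hε _ m ?_, hσ⟩
  rw [map_add, hσ, hσ, hσ, map_add]

/-- The slant product of the image under `Γ` of the suspension of `c` is the Roe secondary cap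
product, up to a relative boundary. -/
theorem slant_total (μ : M₁ →+ M₂ →+ M₃) (hconn : 𝓔.IsCoarselyConnected)
    {HA HB : X × Icc (0 : ℝ) 1 → X} (hA : 𝓔.IsDeformation A HA) (hB : 𝓔.IsDeformation B HB)
    (hε : ∀ x, 0 < ε x) (hΓ : (𝓔.warped (metricFamily (-1) 1 ε)).IsCoarse (𝓔.prod 𝓔) (Gamma HA HB))
    {a b : X} (ha : a ∈ A) (hb : b ∈ B) {m n k : ℕ} (h : m + 1 = k + n) {c : coarseChains M₁ 𝓔 m}
    (Z : SuspensionChain M₁ 𝓔 A B ε c) (φ : coarseCocycles M₂ 𝓔 B n) :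
    ∃ R : coarseChains M₃ 𝓔 k, R.1 = roeCapRaw μ a b h c.1 φ.1 ∧
      R - slantChain μ 𝓔 𝓔 B h (chainMap hΓ (m + 1) Z.total) ⟨φ.1, φ.2.1⟩ ∈
        relBoundaries (chainsIn M₃ 𝓔 univ) (chainsIn M₃ 𝓔 A) k := by
  obtain ⟨D₁, R₁, hD₁, hR₁, h₁⟩ :=
    slant_lower μ hconn hA hB hε ha h c φ Z.hz₁ Z.hα₁ Z.hβ₁ Z.boundary₁
  obtain ⟨D₂, R₂, hD₂, hR₂, h₂⟩ := slant_upper μ hA hB hε hb h c φ Z.hz₂ Z.hα₂ Z.hβ₂ Z.boundary₂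
  refine ⟨-R₁ - (-1 : ℤ) ^ m • R₂, ?_, ?_⟩
  · rw [roeCapRaw, ← hR₁, ← hR₂]
    rfl
  · have e₁ : slantChain μ 𝓔 𝓔 B h (chainMap hΓ (m + 1) Z.z₁) ⟨φ.1, φ.2.1⟩ = D₁ :=
      Subtype.ext hD₁.symm
    have e₂ : slantChain μ 𝓔 𝓔 B h (chainMap hΓ (m + 1) Z.z₂) ⟨φ.1, φ.2.1⟩ = D₂ :=
      Subtype.ext hD₂.symm
    rw [SuspensionChain.total, map_neg, map_add, map_neg, map_add, AddMonoidHom.neg_apply,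
      AddMonoidHom.add_apply, e₁, e₂]
    convert add_mem h₁ h₂ using 1
    abel

/-- The slant product of the suspension of `x` with `y` is represented by the Roe secondary cap
product of any representatives, and with respect to any base-points. -/
theorem exists_slant_eq (μ : M₁ →+ M₂ →+ M₃) (hconn : 𝓔.IsCoarselyConnected)
    {HA HB : X × Icc (0 : ℝ) 1 → X} (hA : 𝓔.IsDeformation A HA) (hB : 𝓔.IsDeformation B HB)
    {U : X → Set (I × I)} (hΓ : (𝓔.warped U).IsCoarse (𝓔.prod 𝓔) (Gamma HA HB))
    {a b : X} (ha : a ∈ A) (hb : b ∈ B) {m n k : ℕ} (h : m + 1 = k + n)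
    (c : relCycles (chainsIn M₁ 𝓔 univ) (chainsSum M₁ 𝓔 A B) m) (φ : coarseCocycles M₂ 𝓔 B n)
    {ζ : HX M₁ (𝓔.warped U) univ (suspBoundary (A ∪ B)) (m + 1)}
    {θ : HXsum M₁ (𝓔.prod 𝓔) (A ×ˢ univ) (univ ×ˢ B) (m + 1)}
    (hζ : IsSuspension 𝓔 (A ∪ B) U (HXsum.toUnion M₁ 𝓔 A B m (homologyClass _ _ m c)) ζ)
    (hθ : HXsum.toUnion M₁ (𝓔.prod 𝓔) (A ×ˢ univ) (univ ×ˢ B) (m + 1) θ =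
      HX.map hΓ (fun _ _ => mem_univ _) (Gamma_mem hA hB) (m + 1) ζ) :
    ∃ d : relCycles (chainsIn M₃ 𝓔 univ) (chainsIn M₃ 𝓔 A) k,
      d.1.1 = roeCapRaw μ a b h c.1.1 φ.1 ∧
      slant μ 𝓔 𝓔 A B h θ (cohomologyClass M₂ 𝓔 B n φ) = homologyClass _ _ k d := by
  obtain ⟨ε, hε, hεU, ζ', hconnecting, rfl⟩ := hζ
  have hr := 𝓔.isCoarse_refinement (isNhdFamily_metricFamily (-1) 1 hε) hεU
  have hΓ' : (𝓔.warped (metricFamily (-1) 1 ε)).IsCoarse (𝓔.prod 𝓔) (Gamma HA HB) := hΓ.comp hr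
  obtain ⟨Z⟩ := exists_suspensionChain hε c
  obtain rfl : ζ' = homologyClass _ _ (m + 1) ⟨Z.total, Z.total_mem⟩ :=
    connecting_injective 𝓔 hε _ m (hconnecting.trans (connecting_total c Z).symm)
  obtain ⟨R, hR, hRD⟩ := slant_total μ hconn hA hB hε hΓ' ha hb h Z φ
  set w := chainMap hΓ' (m + 1) Z.total with hw
  have hwval : chainMap hΓ (m + 1) (chainMap hr (m + 1) Z.total) = w := by
    ext1
    change push _ (push _ _) = push _ _
    congr 1
    exact push_id _
  have hwmem : w ∈ relCycles (chainsIn M₁ (𝓔.prod 𝓔) univ)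
      (chainsSum M₁ (𝓔.prod 𝓔) (A ×ˢ univ) (univ ×ˢ B)) (m + 1) := by
    refine ⟨mem_chainsIn_univ _, ?_⟩
    change boundary _ m w ∈ chainsSum M₁ (𝓔.prod 𝓔) (A ×ˢ univ) (univ ×ˢ B) m
    rw [hw, ← chainMap_boundary, Z.boundary_total, map_add, map_sub, map_add]
    refine add_mem (sub_mem (AddSubgroup.mem_sup_left ?_) (AddSubgroup.mem_sup_right ?_))
      (AddSubgroup.add_mem_sup ?_ ?_)
    · refine chainMap_mem_of_forall hΓ' (R := A ×ˢ univ) (fun p hp => ⟨?_, mem_univ _⟩)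
        (slice_mem_chainsIn lower c.1)
      change HA (p.1, projIcc 0 1 zero_le_one (-(p.2 : ℝ))) ∈ A
      rw [show p.2 = lower from hp, show -((lower : I) : ℝ) = 1 from neg_neg _, projIcc_right]
      exact hA.2.2.1 _
    · refine chainMap_mem_of_forall hΓ' (R := univ ×ˢ B) (fun p hp => ⟨mem_univ _, ?_⟩)
        (slice_mem_chainsIn upper c.1)
      change HB (p.1, projIcc 0 1 zero_le_one (p.2 : ℝ)) ∈ B
      rw [show p.2 = upper from hp, show ((upper : I) : ℝ) = 1 from rfl, projIcc_right]
      exact hB.2.2.1 _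
    · exact chainMap_mem_of_forall hΓ' (R := A ×ˢ univ)
        (fun p hp => ⟨hA.2.2.2 _ hp _, mem_univ _⟩) Z.sides_mem.1
    · exact chainMap_mem_of_forall hΓ' (R := univ ×ˢ B)
        (fun p hp => ⟨mem_univ _, hB.2.2.2 _ hp _⟩) Z.sides_mem.2
  obtain rfl : θ = homologyClass _ _ (m + 1) ⟨w, hwmem⟩ := by
    refine toUnion_injective (isExcisive_prod 𝓔 𝓔 A B) (m + 1) (hθ.trans ?_)
    refine (homologyClass_eq_iff _ _).2 (mem_relBoundaries_of_mem ?_)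
    change chainMap hΓ (m + 1) (chainMap hr (m + 1) Z.total) - w ∈ _
    rw [hwval, sub_self]
    exact zero_mem _
  have hslant := slantChain_mem_relCycles μ h ⟨w, hwmem⟩ φ
  have hRmem : R ∈ relCycles (chainsIn M₃ 𝓔 univ) (chainsIn M₃ 𝓔 A) k := by
    have := add_mem (relBoundaries_le_relCycles hRD) hslant
    rwa [sub_add_cancel] at this
  exact ⟨⟨R, hRmem⟩, hR, ((homologyClass_eq_iff ⟨R, hRmem⟩ ⟨_, hslant⟩).2 hRD).symm⟩

end Comparison

end
end CoarseCap

open CoarseCap in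
theorem mainTheorem2 {X : Type*} (𝓔 : CoarseCap.CoarseStructure X) (A B : Set X)
    (hconn : 𝓔.IsCoarselyConnected) (hcount : 𝓔.IsCountablyGenerated)
    (hA : 𝓔.IsWeakDeformationRetract A) (hB : 𝓔.IsWeakDeformationRetract B)
    (hexc : 𝓔.IsExcisive A B)
    {M₁ M₂ M₃ : Type*} [AddCommGroup M₁] [AddCommGroup M₂] [AddCommGroup M₃]
    (μ : M₁ →+ M₂ →+ M₃) (m n k : ℕ) (h : m + 1 = k + n) :
    ∃ Φ : CoarseCap.HX M₁ 𝓔 Set.univ (A ∪ B) m →+ CoarseCap.HXcoh M₂ 𝓔 B n →+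
        CoarseCap.HX M₃ 𝓔 Set.univ A k,
      (∀ a ∈ A, ∀ b ∈ B, ∀ x y w,
        CoarseCap.IsRoeSecondaryCap μ 𝓔 A B a b h x y w ↔ w = Φ x y) ∧
      (∀ x y w, CoarseCap.IsSecondaryCap μ 𝓔 A B h x y w ↔
        w = (-1 : ℤ) ^ (m + 1) • Φ x y) := by
  obtain ⟨HA, hHA⟩ := hA
  obtain ⟨HB, hHB⟩ := hB
  obtain ⟨U, hU, hΓ⟩ := exists_family hconn hHA hHB
  -- The map `Φ` is built from the deformations and the family chosen here.
  obtain ⟨ε, hε, hεU⟩ := exists_metricFamily_subset hU.1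
  obtain ⟨σ, hσ⟩ := exists_suspensionHom (M₁ := M₁) hexc hε m
  let S := (HX.map (𝓔.isCoarse_refinement (isNhdFamily_metricFamily (-1) 1 hε) hεU)
    (fun _ h => h) (fun _ h => h) (m + 1)).comp σ
  have hS : ∀ x, IsSuspension 𝓔 (A ∪ B) U x (S x) := fun x => ⟨ε, hε, hεU, σ x, hσ x, rfl⟩
  let e := AddEquiv.ofBijective (HXsum.toUnion M₁ (𝓔.prod 𝓔) (A ×ˢ univ) (univ ×ˢ B) (m + 1))
    ⟨toUnion_injective (isExcisive_prod 𝓔 𝓔 A B) _,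
      toUnion_surjective (isExcisive_prod 𝓔 𝓔 A B) _⟩
  let Θ := e.symm.toAddMonoidHom.comp
    ((HX.map hΓ (fun _ _ => mem_univ _) (Gamma_mem hHA hHB) (m + 1)).comp S)
  have hΘ : ∀ x, HXsum.toUnion M₁ (𝓔.prod 𝓔) (A ×ˢ univ) (univ ×ˢ B) (m + 1) (Θ x) =
      HX.map hΓ (fun _ _ => mem_univ _) (Gamma_mem hHA hHB) (m + 1) (S x) := fun x =>
    e.apply_symm_apply _
  refine ⟨(slant μ 𝓔 𝓔 A B h).comp Θ, fun a ha b hb x y w => ⟨?_, ?_⟩, fun x y w => ⟨?_, ?_⟩⟩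
  · rintro ⟨c, φ, d, rfl, rfl, hd, rfl⟩
    obtain ⟨d', hd', heq⟩ := exists_slant_eq μ hconn hHA hHB hΓ ha hb h c φ (hS _) (hΘ _)
    obtain rfl : d = d' := Subtype.ext (Subtype.ext (hd.trans hd'.symm))
    exact heq.symm
  · rintro rfl
    obtain ⟨x, rfl⟩ := toUnion_surjective hexc m x
    obtain ⟨c, rfl⟩ := homologyClass_surjective _ _ _ x
    obtain ⟨φ, rfl⟩ := QuotientAddGroup.mk'_surjective _ y
    obtain ⟨d, hd, heq⟩ := exists_slant_eq μ hconn hHA hHB hΓ ha hb h c φ (hS _) (hΘ _)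
    exact ⟨c, φ, d, rfl, rfl, hd, heq⟩
  · rintro ⟨HA', HB', hHA', hHB', U', -, hΓ', ζ, θ, hζ, hθ, rfl⟩
    obtain ⟨x, rfl⟩ := toUnion_surjective hexc m x
    obtain ⟨c, rfl⟩ := homologyClass_surjective _ _ _ x
    obtain ⟨φ, rfl⟩ := QuotientAddGroup.mk'_surjective _ y
    congr 1
    rcases isEmpty_or_nonempty X with hX | ⟨⟨o⟩⟩
    · -- All chain groups of the empty space vanish.
      have hsub : Subsingleton (HX M₃ 𝓔 univ A k) := by
        refine ⟨fun u v => ?_⟩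
        obtain ⟨u, rfl⟩ := homologyClass_surjective _ _ _ u
        obtain ⟨v, rfl⟩ := homologyClass_surjective _ _ _ v
        congr 1
        ext y
        exact (IsEmpty.false (y 0)).elim
      exact Subsingleton.elim _ _
    · obtain ⟨d, hd, heq⟩ := exists_slant_eq μ hconn hHA hHB hΓ (hHA.2.2.1 o) (hHB.2.2.1 o) h c φ
        (hS _) (hΘ _)
      obtain ⟨d', hd', heq'⟩ := exists_slant_eq μ hconn hHA' hHB' hΓ' (hHA.2.2.1 o) (hHB.2.2.1 o)
        h c φ hζ hθ
      obtain rfl : d = d' := Subtype.ext (Subtype.ext (hd.trans hd'.symm))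
      exact heq'.trans heq.symm
  · rintro rfl
    exact ⟨HA, HB, hHA, hHB, U, hU, hΓ, S x, Θ x, hS x, hΘ x, rfl⟩
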